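/- For a number field $K$ let $\Delta_K$ denote its discriminant, $\mathrm{Cl}(K)$ the class group of its ring of integers, and for a prime $\ell$ let $h_\ell(K)=\#\{c\in\mathrm{Cl}(K): c^\ell=1\}$ be the order of the $\ell$-torsion subgroup. For a quadratic number field $K$ let $\chi$ be the corresponding quadratic character, that is, the Kronecker symbol $\chi=(\Delta_K/\cdot)$ viewed as a Dirichlet character modulo $|\Delta_K|$, and let $L(s,\chi)$ be its Dirichlet $L$-function (continued analytically to $\mathbb{C}$). Let $\ell\ge 3$ be prime, let $\theta\in(0,\tfrac12)$, and let \[0<\xi<\frac{2\theta-\theta^2}{4\ell}.\] Then for every real $A$ and every $\varepsilon>0$ there is a constant $C=C(\ell,\theta,\xi,\varepsilon,A)$ such that the following holds. If $K$ is a quadratic number field with corresponding quadratic character $\chi$, and \[|L(\sigma+it,\chi)|\le A\,|\Delta_K|^{\xi}\qquad\text{for all real } \sigma\ge 1-\theta,\ |t|\le 1,\] then \[h_\ell(K)\le C\,|\Delta_K|^{1/2-1/(2\ell)+\varepsilon}.\] (The constant $C$ is asserted to exist; it is not claimed to be effectively computable.) -/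

import Mathlib

open NumberField
open scoped NumberTheorySymbols

/-! ### The Kronecker symbol `(D / ·)` of a discriminant as a Dirichlet character -/

/-- For `4 ∣ D` and odd `n`, the Jacobi symbol `(D / n)` depends only on `n` modulo `|D|`. -/
theorem jacobiSym_mod_natAbs_of_four_dvd {D : ℤ} (h4 : 4 ∣ D) {n : ℕ} (hn : Odd n) :
    J(D | n % D.natAbs) = J(D | n) := by
  obtain ⟨m, rfl⟩ := h4
  have habs : (4 * m).natAbs = 4 * m.natAbs := by simp [Int.natAbs_mul]
  have hodd : Odd (n % (4 * m).natAbs) := by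
    rw [habs, Nat.odd_iff, Nat.mod_mod_of_dvd n ⟨2 * m.natAbs, by ring⟩]
    exact Nat.odd_iff.mp hn
  rw [jacobiSym.mul_left, jacobiSym.mul_left, jacobiSym.at_four hodd, jacobiSym.at_four hn,
    one_mul, one_mul, jacobiSym.mod_right m hn, habs]

/-- The value of the Kronecker symbol `(D / n)` at a positive integer `n` prime to the
discriminant `D`.  If `4 ∣ D` then `n` is odd, and this is the Jacobi symbol `(D / n)`; if
`D ≡ 1 (mod 4)` it is `(n / |D|)`, which equals `(D / n)` by quadratic reciprocity. -/
def kroneckerValue (D : ℤ) (n : ℕ) : ℤ :=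
  if 4 ∣ D then J(D | n) else J((n : ℤ) | D.natAbs)

theorem odd_of_four_dvd_of_coprime {D : ℤ} (h4 : 4 ∣ D) {n : ℕ} (hn : n.Coprime D.natAbs) :
    Odd n := by
  have h2 : 2 ∣ D.natAbs := Int.natCast_dvd.mp (dvd_trans ⟨2, by norm_num⟩ h4)
  exact Nat.coprime_two_right.mp (hn.coprime_dvd_right h2)

theorem kroneckerValue_mod {D : ℤ} {n : ℕ} (hn : n.Coprime D.natAbs) :
    kroneckerValue D (n % D.natAbs) = kroneckerValue D n := by
  unfold kroneckerValue
  split_ifs with h4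
  · exact jacobiSym_mod_natAbs_of_four_dvd h4 (odd_of_four_dvd_of_coprime h4 hn)
  · rw [jacobiSym.mod_left (n : ℤ), Int.natCast_mod]

theorem kroneckerValue_mul {D : ℤ} {m n : ℕ} (hm : m.Coprime D.natAbs) (hn : n.Coprime D.natAbs) :
    kroneckerValue D (m * n) = kroneckerValue D m * kroneckerValue D n := by
  unfold kroneckerValue
  split_ifs with h4
  · exact jacobiSym.mul_right' D (odd_of_four_dvd_of_coprime h4 hm).pos.ne'
      (odd_of_four_dvd_of_coprime h4 hn).pos.ne'
  · rw [Nat.cast_mul, jacobiSym.mul_left]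

theorem coprime_val_of_isUnit {N : ℕ} {a : ZMod N} (ha : IsUnit a) : a.val.Coprime N := by
  obtain ⟨u, rfl⟩ := ha
  exact ZMod.val_coe_unit_coprime u

open Classical in
/-- The Kronecker symbol `(D / ·)` of a discriminant `D` (an integer `≡ 0, 1 (mod 4)`) as a
Dirichlet character modulo `|D|`: zero at integers not prime to `D`, and completely multiplicative,
with `χ(p)` the Legendre symbol `(D / p)` at odd primes (`kroneckerChar_odd_prime`) and
`χ(2) = 0, 1, -1` according as `D` is even, `D ≡ 1 (mod 8)`, `D ≡ 5 (mod 8)`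
(`kroneckerChar_two`). -/
noncomputable def kroneckerChar (D : ℤ) : DirichletCharacter ℂ D.natAbs where
  toFun a := if IsUnit a then (kroneckerValue D a.val : ℂ) else 0
  map_one' := by
    rw [if_pos isUnit_one, ZMod.val_one_eq_one_mod, kroneckerValue_mod (Nat.coprime_one_left _)]
    simp [kroneckerValue, jacobiSym.one_left, jacobiSym.one_right]
  map_mul' a b := by
    by_cases ha : IsUnit a
    · by_cases hb : IsUnit b
      · have ca := coprime_val_of_isUnit ha
        have cb := coprime_val_of_isUnit hb
        rw [if_pos (ha.mul hb), if_pos ha, if_pos hb, ZMod.val_mul,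
          kroneckerValue_mod (ca.mul_left cb), kroneckerValue_mul ca cb, Int.cast_mul]
      · rw [if_neg hb, if_neg (fun h => hb (IsUnit.mul_iff.mp h).2), mul_zero]
    · rw [if_neg ha, if_neg (fun h => ha (IsUnit.mul_iff.mp h).1), zero_mul]
  map_nonunit' a ha := if_neg ha

open Classical in
theorem kroneckerChar_natCast {D : ℤ} {n : ℕ} (hn : n.Coprime D.natAbs) :
    kroneckerChar D (n : ZMod D.natAbs) = kroneckerValue D n := by
  have h : kroneckerChar D (n : ZMod D.natAbs) =
      if IsUnit (n : ZMod D.natAbs) then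
        (kroneckerValue D (n : ZMod D.natAbs).val : ℂ) else 0 := rfl
  rw [h, if_pos ((ZMod.isUnit_iff_coprime n _).mpr hn), ZMod.val_natCast, kroneckerValue_mod hn]

/-- The value at an odd prime `p` is the Legendre symbol `(D / p)`. -/
theorem kroneckerChar_odd_prime {D : ℤ} (hD : D % 4 = 0 ∨ D % 4 = 1)
    {p : ℕ} (hp : p.Prime) (hp2 : p ≠ 2) :
    kroneckerChar D (p : ZMod D.natAbs) = (J(D | p) : ℤ) := by
  have hodd : Odd p := hp.odd_of_ne_two hp2
  by_cases hc : p.Coprime D.natAbs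
  · rw [kroneckerChar_natCast hc]
    congr 1
    unfold kroneckerValue
    split_ifs with h4
    · rfl
    · have hD1 : D % 4 = 1 := by omega
      rcases Int.natAbs_eq D with h | h
      · have h1 : D.natAbs % 4 = 1 := by omega
        conv_rhs => rw [h]
        exact jacobiSym.quadratic_reciprocity_one_mod_four' hodd h1
      · have h3 : D.natAbs % 4 = 3 := by omega
        have hDodd : Odd D.natAbs := Nat.odd_iff.mpr (by omega)
        conv_rhs => rw [h, jacobiSym.neg _ hodd]
        rcases Nat.odd_mod_four_iff.mp (Nat.odd_iff.mp hodd) with h' | h'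
        · rw [ZMod.χ₄_nat_one_mod_four h', one_mul,
            jacobiSym.quadratic_reciprocity_one_mod_four h' hDodd]
        · rw [ZMod.χ₄_nat_three_mod_four h',
            jacobiSym.quadratic_reciprocity_three_mod_four h' h3, neg_one_mul]
  · have hu : ¬ IsUnit (p : ZMod D.natAbs) := fun h => hc ((ZMod.isUnit_iff_coprime p _).mp h)
    have h0 : J(D | p) = 0 := by
      refine jacobiSym.eq_zero_iff.mpr ⟨hp.ne_zero, fun h => hc ?_⟩
      rw [Nat.coprime_comm]
      simpa [Int.gcd] using h
    rw [MulChar.map_nonunit _ hu, h0, Int.cast_zero]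

/-- The value at `2` is `1`, `-1`, `0` according as `D ≡ 1 (mod 8)`, `D ≡ 5 (mod 8)`, or `D` is
even. -/
theorem kroneckerChar_two {D : ℤ} (hD : D % 4 = 0 ∨ D % 4 = 1) :
    kroneckerChar D ((2 : ℕ) : ZMod D.natAbs) =
      if D % 8 = 1 then 1 else if D % 8 = 5 then -1 else 0 := by
  rcases hD with h0 | h1
  · have hc : ¬ Nat.Coprime 2 D.natAbs := by
      rw [Nat.coprime_two_left, Nat.odd_iff]; omega
    have hu : ¬ IsUnit ((2 : ℕ) : ZMod D.natAbs) :=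
      fun h => hc ((ZMod.isUnit_iff_coprime 2 _).mp h)
    rw [MulChar.map_nonunit _ hu, if_neg (by omega), if_neg (by omega)]
  · have hDodd : Odd D.natAbs := Nat.odd_iff.mpr (by omega)
    rw [kroneckerChar_natCast (Nat.coprime_two_left.mpr hDodd), kroneckerValue,
      if_neg (by omega), Nat.cast_ofNat, jacobiSym.at_two hDodd, ZMod.χ₈_nat_eq_if_mod_eight,
      if_neg (by omega)]
    rcases (by omega : D % 8 = 1 ∨ D % 8 = 5) with h | h
    · rw [if_pos (by omega), if_pos h, Int.cast_one]
    · rw [if_neg (by omega), if_neg (by omega), if_pos h]; simp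

section QuadraticFields

variable (K : Type*) [Field K] [NumberField K]

instance neZero_natAbs_discr : NeZero (discr K).natAbs :=
  ⟨Int.natAbs_ne_zero.mpr (discr_ne_zero K)⟩

/-- The quadratic character of a quadratic number field `K`: the Kronecker symbol `(Δ_K / ·)`, a
Dirichlet character modulo `|Δ_K|`. -/
noncomputable def quadraticFieldChar : DirichletCharacter ℂ (discr K).natAbs :=
  kroneckerChar (discr K)

/-- The `ℓ`-torsion subgroup `Cl_ℓ(K)` of the class group: the classes `c` with `c ^ ℓ = 1`. -/
noncomputable def classGroupTorsion (ℓ : ℕ) : Subgroup (ClassGroup (𝓞 K)) :=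
  (powMonoidHom ℓ : ClassGroup (𝓞 K) →* ClassGroup (𝓞 K)).ker

/-- `h_ℓ(K) = #Cl_ℓ(K)`. -/
noncomputable def classTorsionNumber (ℓ : ℕ) : ℕ := Nat.card (classGroupTorsion K ℓ)

end QuadraticFields

/-!
Write `D = |Δ_K|`, let `χ` be the quadratic character of `K`, `a(n)` the number of ideals of norm `n`,
and call an ideal primitive if no rational integer `m > 1` divides it.  The proof compares two
evaluations of the smoothed sum `S = ∑ a(n) w(n)`, with the weight `w(n) = exp (-(log n)² / (2 T))`,
`T = log x`, where `x = D ^ a` and `a` is slightly less than `1 / (2 ℓ)`.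

*Lower bound.*  As `∑ a(n) n ^ (-s) = ζ(s) L(s, χ)` (`idealCount_eq_zetaMul`), the sum `S` is the
integral of `ζ(s) L(s, χ) exp (T s² / 2)` over a vertical line.  Shifting the segment `|Im s| ≤ 1` to
`Re s = 1 - θ`, where `L(s, χ) = O(D ^ ξ)`, gives `S ≥ L(1, χ) x ^ (1 / 2) / 2`, up to an error
`D ^ ξ x ^ ((1 - θ)² / 2)` (`exists_norm_tsum_zetaMul_sub_le`, `half_exp_le_tsum_gaussWeight`).  The
condition on `ξ` says that the error saves a power of `D`.  Hence it is smaller than the main term by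
Siegel's theorem `L(1, χ) ≫ D ^ (-η)` (`DirichletCharacter.exists_le_norm_LFunction_one`), which is
where the constant becomes ineffective.  Siegel's theorem is deduced from the positivity of the
coefficients of `ζ(s) L(s, χ)` and `ζ(s) L(s, χ₁) L(s, χ) L(s, χ₁ χ)`, by Estermann's method
(`exists_mul_rpow_le_re_apply_one`).

*Upper bound.*  By Rankin's trick the ideals of norm more than `x ^ (1 + c)`, and the multiples of the
primitive ideals of norm at most `x ^ (1 - c)`, contribute a negligible amount.  If `P` is the number
of primitive ideals of norm at most `x ^ (1 + c)`, then the rest is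
`O(x ^ (1 / 2) x ^ (-(1 - c)) P)` (`exists_norm_tsum_gaussWeight_le`).  Therefore
`P ≫ L(1, χ) x ^ (1 - c)`.

*Counting primitive ideals.*  Let `I` and `J` be primitive of norm at most `N`, where `N ^ (2 ℓ)` is
less than a small multiple of `D`, and let `I ^ ℓ` and `J ^ ℓ` lie in one class.  If a generator of
their quotient has conjugates of nearly the same absolute value, then multiplying it by `N(J) ^ ℓ`
gives an integer of `K` with conjugates smaller than `√D / 2`.  Such an integer is rational, and
`ℓ` being odd this forces `I = J` (`IsPrimitiveIdeal.eq_of_abs_log_le`).  There are `h / h_ℓ` classes of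
`ℓ`-th powers, and up to units `O(R + 1)` possible positions for the ratio of the conjugates, so that
`P h_ℓ ≤ h (2 R + 1)` (`card_primitive_mul_classTorsionNumber_le`).

The class number formula says that `h R` is `√D L(1, χ)` up to a bounded factor, and `R ≥ 1` for
large `D`.  So `L(1, χ)` cancels and `h_ℓ ≪ √D x ^ (-(1 - c))`, which is the claim.
-/

/-! ### Partial sums of Dirichlet characters and the size of `L(s, ψ)` -/

namespace DirichletCharacter

/-- The partial sum `∑_{k < n} ψ(k)`. -/
noncomputable def partialSum {q : ℕ} (ψ : DirichletCharacter ℂ q) (n : ℕ) : ℂ :=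
  ∑ k ∈ Finset.range n, ψ k

theorem partialSum_succ {q : ℕ} (ψ : DirichletCharacter ℂ q) (n : ℕ) :
    ψ.partialSum (n + 1) = ψ.partialSum n + ψ n := Finset.sum_range_succ _ _

theorem partialSum_periodic {q : ℕ} [NeZero q] {ψ : DirichletCharacter ℂ q} (hψ : ψ ≠ 1) :
    Function.Periodic ψ.partialSum q := by
  intro n
  induction n with
  | zero =>
    have h := ψ.sum_eq_zero_of_ne_one hψ
    rw [zero_add]
    simp only [partialSum, Finset.range_zero, Finset.sum_empty]
    rw [← h, Finset.sum_range]
    refine Fintype.sum_equiv (ZMod.finEquiv q).toEquiv _ _ fun i ↦ ?_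
    congr 1
    rcases q with _ | q
    · exact i.elim0
    · exact Fin.cast_val_eq_self i
  | succ n ih =>
    rw [show n + 1 + q = (n + q) + 1 by ring, partialSum_succ, partialSum_succ, ih]
    simp

theorem norm_partialSum_le {q : ℕ} (ψ : DirichletCharacter ℂ q) (n : ℕ) :
    ‖ψ.partialSum n‖ ≤ n := by
  refine (norm_sum_le _ _).trans ?_
  calc _ ≤ ∑ _k ∈ Finset.range n, (1 : ℝ) := Finset.sum_le_sum fun k _ ↦ ψ.norm_le_one _
    _ = n := by simp

theorem norm_partialSum_le_min {q : ℕ} [NeZero q] {ψ : DirichletCharacter ℂ q} (hψ : ψ ≠ 1)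
    (n : ℕ) : ‖ψ.partialSum n‖ ≤ min (n : ℝ) q := by
  rw [← (partialSum_periodic hψ).map_mod_nat n]
  refine (norm_partialSum_le ψ _).trans (le_min ?_ ?_)
  · exact_mod_cast Nat.mod_le _ _
  · exact_mod_cast (Nat.mod_lt _ (NeZero.pos q)).le

end DirichletCharacter

theorem norm_cpow_neg_sub_cpow_neg_le {a : ℝ} (ha : 0 < a) {s : ℂ} (hs : 0 < s.re) :
    ‖((a + 1 : ℝ) : ℂ) ^ (-s) - (a : ℂ) ^ (-s)‖ ≤ ‖s‖ * a ^ (-s.re - 1) := by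
  have hs0 : -s ≠ 0 := by
    intro h; rw [neg_eq_zero] at h; simp [h] at hs
  have key := Convex.norm_image_sub_le_of_norm_hasDerivWithin_le
    (f := fun u : ℝ ↦ (u : ℂ) ^ (-s)) (f' := fun u : ℝ ↦ -s * (u : ℂ) ^ (-s - 1))
    (s := Set.Icc a (a + 1)) (x := a) (y := a + 1) (C := ‖s‖ * a ^ (-s.re - 1)) ?_ ?_
    (convex_Icc _ _) (by simp) (by simp)
  · simpa using key
  · intro u hu
    exact (hasDerivAt_ofReal_cpow_const (ha.trans_le hu.1).ne' hs0).hasDerivWithinAt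
  · intro u hu
    have hu0 : 0 < u := ha.trans_le hu.1
    rw [norm_mul, norm_neg, Complex.norm_cpow_eq_rpow_re_of_pos hu0]
    gcongr
    simp only [Complex.sub_re, Complex.neg_re, Complex.one_re]
    exact Real.rpow_le_rpow_of_nonpos ha hu.1 (by linarith)

namespace DirichletCharacter

/-- The terms of the series for `L(s, ψ)` obtained by partial summation, which converges absolutely
for `Re s > 0`.  The index is shifted to start at `0`, and `partialSum (n + 2)` is the sum of `ψ(k)`
over `1 ≤ k ≤ n + 1` as soon as `ψ(0) = 0`. -/
noncomputable def abelTerm {q : ℕ} (ψ : DirichletCharacter ℂ q) (n : ℕ) (s : ℂ) : ℂ :=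
  ψ.partialSum (n + 2) * (((n + 1 : ℝ) : ℂ) ^ (-s) - ((n + 1 + 1 : ℝ) : ℂ) ^ (-s))

theorem norm_abelTerm_le {q : ℕ} (ψ : DirichletCharacter ℂ q) (n : ℕ) {s : ℂ} (hs : 0 < s.re) :
    ‖ψ.abelTerm n s‖ ≤ ‖ψ.partialSum (n + 2)‖ * (‖s‖ * (n + 1 : ℝ) ^ (-s.re - 1)) := by
  rw [abelTerm, norm_mul, norm_sub_rev]
  gcongr
  exact norm_cpow_neg_sub_cpow_neg_le (by positivity) hs

theorem sum_range_abelTerm {q : ℕ} (ψ : DirichletCharacter ℂ q) (hψ0 : ψ 0 = 0) (s : ℂ) (N : ℕ) :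
    ∑ n ∈ Finset.range N, ψ.abelTerm n s =
      ∑ n ∈ Finset.range N, ψ (n + 1 : ℕ) * ((n + 1 : ℝ) : ℂ) ^ (-s)
        - ψ.partialSum (N + 1) * ((N + 1 : ℝ) : ℂ) ^ (-s) := by
  induction N with
  | zero => simp [partialSum, hψ0]
  | succ N ih =>
    rw [Finset.sum_range_succ, ih, Finset.sum_range_succ, abelTerm, partialSum_succ ψ (N + 1)]
    push_cast
    ring

theorem summable_rpow_neg_sub_one {σ : ℝ} (hσ : 0 < σ) :
    Summable fun n : ℕ ↦ ((n : ℝ) + 1) ^ (-σ - 1) := by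
  have h := (summable_nat_add_iff 1).mpr
    (Real.summable_nat_rpow.mpr (show -σ - 1 < -1 by linarith))
  simpa using h

variable {q : ℕ} [NeZero q] {ψ : DirichletCharacter ℂ q}

theorem map_zero_of_ne_one (hψ : ψ ≠ 1) : ψ 0 = 0 := by
  refine MulChar.map_nonunit _ fun h ↦ hψ ?_
  have hq : q = 1 := by
    by_contra hq
    have : Nontrivial (ZMod q) := ZMod.nontrivial_iff.mpr hq
    exact not_isUnit_zero h
  subst hq
  exact Subsingleton.elim _ _

theorem summable_abelTerm (hψ : ψ ≠ 1) {s : ℂ} (hs : 0 < s.re) :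
    Summable fun n ↦ ψ.abelTerm n s := by
  refine Summable.of_norm_bounded
    (((summable_rpow_neg_sub_one hs).mul_left (‖s‖)).mul_left (q : ℝ)) fun n ↦ ?_
  refine (norm_abelTerm_le ψ n hs).trans ?_
  gcongr
  exact (norm_partialSum_le_min hψ _).trans (min_le_right _ _)

theorem tsum_abelTerm_of_one_lt_re (hψ : ψ ≠ 1) {s : ℂ} (hs : 1 < s.re) :
    ∑' n, ψ.abelTerm n s = ψ.LFunction s := by
  have h0 : 0 < s.re := by linarith
  have hψ0 := map_zero_of_ne_one hψ
  have hL : HasSum (fun n : ℕ ↦ ψ (n + 1 : ℕ) * ((n + 1 : ℝ) : ℂ) ^ (-s)) (ψ.LFunction s) := by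
    have h := (ZMod.LSeriesSummable_of_one_lt_re ψ hs).LSeriesHasSum
    rw [← LFunction_eq_LSeries ψ hs] at h
    have h' := (hasSum_nat_add_iff' 1).mpr h
    simp only [Finset.range_one, Finset.sum_singleton, LSeries.term_zero, sub_zero] at h'
    refine h'.congr_fun fun n ↦ ?_
    rw [LSeries.term_of_ne_zero (Nat.succ_ne_zero n), Complex.cpow_neg, div_eq_mul_inv]
    push_cast
    rfl
  refine tendsto_nhds_unique (summable_abelTerm hψ h0).hasSum.tendsto_sum_nat ?_
  simp_rw [sum_range_abelTerm ψ hψ0]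
  rw [← sub_zero (ψ.LFunction s)]
  refine hL.tendsto_sum_nat.sub ?_
  rw [tendsto_zero_iff_norm_tendsto_zero]
  have hlim : Filter.Tendsto (fun N : ℕ ↦ (q : ℝ) * ((N : ℝ) + 1) ^ (-s.re)) Filter.atTop
      (nhds 0) := by
    rw [← mul_zero (q : ℝ)]
    refine Filter.Tendsto.const_mul _ ?_
    exact (tendsto_rpow_neg_atTop h0).comp
      (Filter.tendsto_atTop_add_const_right _ _ tendsto_natCast_atTop_atTop)
  refine squeeze_zero (fun _ ↦ norm_nonneg _) (fun N ↦ ?_) hlim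
  rw [norm_mul, Complex.norm_cpow_eq_rpow_re_of_pos (by positivity), Complex.neg_re]
  gcongr
  exact (norm_partialSum_le_min hψ _).trans (min_le_right _ _)

/-- Both sides are analytic on bounded pieces of `Re s > 0`, and they agree for `Re s > 1`. -/
theorem tsum_abelTerm (hψ : ψ ≠ 1) {s : ℂ} (hs : 0 < s.re) :
    ∑' n, ψ.abelTerm n s = ψ.LFunction s := by
  set U : Set ℂ := {z | s.re / 2 < z.re} ∩ Metric.ball 0 (‖s‖ + 3) with hU
  have hUo : IsOpen U := (isOpen_lt continuous_const Complex.continuous_re).inter Metric.isOpen_ball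
  have hUc : IsPreconnected U :=
    ((convex_halfSpace_re_gt _).inter (convex_ball _ _)).isPreconnected
  have hsU : s ∈ U := ⟨by simp; linarith, by simp⟩
  have hre : s.re ≤ ‖s‖ := Complex.re_le_norm s
  have h2U : ((s.re + 2 : ℝ) : ℂ) ∈ U := by
    refine ⟨by simp; linarith, ?_⟩
    rw [mem_ball_zero_iff, Complex.norm_real, Real.norm_of_nonneg (by linarith)]
    linarith
  have hd : DifferentiableOn ℂ (fun z ↦ ∑' n, ψ.abelTerm n z) U := by
    refine Complex.differentiableOn_tsum_of_summable_norm
      (((summable_rpow_neg_sub_one (half_pos hs)).mul_left (‖s‖ + 3)).mul_left (q : ℝ))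
      (fun n ↦ ?_) hUo (fun n z hz ↦ ?_)
    · unfold abelTerm
      have h1 : ((n + 1 : ℝ) : ℂ) ≠ 0 := by exact_mod_cast n.succ_ne_zero
      have h2 : ((n + 1 + 1 : ℝ) : ℂ) ≠ 0 := by exact_mod_cast (n + 1).succ_ne_zero
      refine Differentiable.differentiableOn ?_
      refine Differentiable.const_mul (Differentiable.sub ?_ ?_) _
      · exact differentiable_neg.const_cpow (Or.inl h1)
      · exact differentiable_neg.const_cpow (Or.inl h2)
    · have hz1 : s.re / 2 < z.re := hz.1
      have hz0 : 0 < z.re := by linarith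
      refine (norm_abelTerm_le ψ n hz0).trans ?_
      have hz2 : ‖z‖ ≤ ‖s‖ + 3 := (mem_ball_zero_iff.mp hz.2).le
      gcongr
      · exact (norm_partialSum_le_min hψ _).trans (min_le_right _ _)
      · linarith [n.cast_nonneg (α := ℝ)]
  have han : AnalyticOnNhd ℂ (fun z ↦ ∑' n, ψ.abelTerm n z) U := hd.analyticOnNhd hUo
  have han' : AnalyticOnNhd ℂ ψ.LFunction U :=
    (differentiable_LFunction hψ).differentiableOn.analyticOnNhd hUo
  refine han.eqOn_of_preconnected_of_eventuallyEq han' hUc h2U ?_ hsU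
  have : {z : ℂ | 1 < z.re} ∈ nhds ((s.re + 2 : ℝ) : ℂ) :=
    (isOpen_lt continuous_const Complex.continuous_re).mem_nhds (by simp; linarith)
  filter_upwards [this] with z hz using tsum_abelTerm_of_one_lt_re hψ hz

theorem norm_LFunction_le (hψ : ψ ≠ 1) {s : ℂ} (hs : 1 / 2 ≤ s.re) :
    ‖ψ.LFunction s‖ ≤ q * (‖s‖ * ∑' n : ℕ, ((n : ℝ) + 1) ^ (-(1 / 2 : ℝ) - 1)) := by
  have h0 : 0 < s.re := by linarith
  rw [← tsum_abelTerm hψ h0, ← tsum_mul_left, ← tsum_mul_left]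
  refine tsum_of_norm_bounded ((((summable_rpow_neg_sub_one (by norm_num)).mul_left
    (‖s‖)).mul_left (q : ℝ)).hasSum) fun n ↦ ?_
  refine (norm_abelTerm_le ψ n h0).trans ?_
  gcongr
  · exact (norm_partialSum_le_min hψ _).trans (min_le_right _ _)
  · linarith [n.cast_nonneg (α := ℝ)]

/-- Interpolating between the two bounds `n` and `q` for the partial sums makes the loss an
arbitrarily small power of the modulus. -/
theorem norm_LFunction_one_le (hψ : ψ ≠ 1) {ε : ℝ} (hε : 0 < ε) (hε1 : ε ≤ 1) :
    ‖ψ.LFunction 1‖ ≤ (q : ℝ) ^ ε * (2 * ∑' n : ℕ, ((n : ℝ) + 1) ^ (-ε - 1)) := by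
  rw [← tsum_abelTerm hψ (by simp), ← tsum_mul_left, ← tsum_mul_left]
  refine tsum_of_norm_bounded ((((summable_rpow_neg_sub_one hε).mul_left
    2).mul_left _).hasSum) fun n ↦ ?_
  refine (norm_abelTerm_le ψ n (by simp)).trans ?_
  have hq : (0 : ℝ) < q := by exact_mod_cast NeZero.pos q
  have hn : (0 : ℝ) < (n : ℝ) + 1 := by positivity
  -- `min(n + 2, q) ≤ q ^ ε * (n + 2) ^ (1 - ε)`
  have h1 : ‖ψ.partialSum (n + 2)‖ ≤ (q : ℝ) ^ ε * (2 * ((n : ℝ) + 1) ^ (1 - ε)) := by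
    have hm := norm_partialSum_le_min hψ (n + 2)
    have ha : ‖ψ.partialSum (n + 2)‖ ≤ q := hm.trans (min_le_right _ _)
    have hb : ‖ψ.partialSum (n + 2)‖ ≤ 2 * ((n : ℝ) + 1) := by
      refine (hm.trans (min_le_left _ _)).trans ?_
      push_cast; linarith [n.cast_nonneg (α := ℝ)]
    rcases (norm_nonneg (ψ.partialSum (n + 2))).eq_or_lt with h | h
    · rw [← h]; positivity
    calc ‖ψ.partialSum (n + 2)‖
        = ‖ψ.partialSum (n + 2)‖ ^ ε * ‖ψ.partialSum (n + 2)‖ ^ (1 - ε) := by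
          rw [← Real.rpow_add h]; simp
      _ ≤ (q : ℝ) ^ ε * (2 * ((n : ℝ) + 1)) ^ (1 - ε) := by
          gcongr
      _ ≤ (q : ℝ) ^ ε * (2 * ((n : ℝ) + 1) ^ (1 - ε)) := by
          rw [Real.mul_rpow (by norm_num) hn.le]
          gcongr
          calc (2 : ℝ) ^ (1 - ε) ≤ 2 ^ (1 : ℝ) :=
                Real.rpow_le_rpow_of_exponent_le (by norm_num) (by linarith)
            _ = 2 := by norm_num
  calc _ ≤ (q : ℝ) ^ ε * (2 * ((n : ℝ) + 1) ^ (1 - ε)) *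
        (‖(1 : ℂ)‖ * ((n : ℝ) + 1) ^ (-(1 : ℂ).re - 1)) := by gcongr
    _ = (q : ℝ) ^ ε * (2 * (((n : ℝ) + 1) ^ (1 - ε) * ((n : ℝ) + 1) ^ (-(1 : ℝ) - 1))) := by
        simp; ring
    _ = _ := by
        rw [← Real.rpow_add hn]; ring_nf

/-- The `L`-function of a real-valued nontrivial character is real on the positive real axis. -/
theorem LFunction_im_eq_zero (hψ : ψ ≠ 1) (hreal : ∀ a, (ψ a).im = 0) {σ : ℝ} (hσ : 0 < σ) :
    (ψ.LFunction σ).im = 0 := by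
  have hs : 0 < (σ : ℂ).re := by simpa
  rw [← tsum_abelTerm hψ hs, Complex.im_tsum (summable_abelTerm hψ hs)]
  refine (tsum_congr fun n ↦ ?_).trans tsum_zero
  have h1 : (ψ.partialSum (n + 2)).im = 0 := by
    rw [partialSum, Complex.im_sum]
    exact Finset.sum_eq_zero fun _ _ ↦ hreal _
  have h2 (x : ℝ) (hx : 0 ≤ x) : ((x : ℂ) ^ (-(σ : ℂ))).im = 0 := by
    rw [← Complex.ofReal_neg, ← Complex.ofReal_cpow hx, Complex.ofReal_im]
  rw [abelTerm, Complex.mul_im, h1, Complex.sub_im, h2 _ (by positivity), h2 _ (by positivity)]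
  simp

end DirichletCharacter

/-! ### A lower bound at `s = 1` from a sign to the left of `1` -/

theorem exists_norm_riemannZeta_le_on_sphere :
    ∃ C : ℝ, 0 < C ∧ ∀ s ∈ Metric.sphere (2 : ℂ) (3 / 2), ‖riemannZeta s‖ ≤ C := by
  have hc : ContinuousOn riemannZeta (Metric.sphere (2 : ℂ) (3 / 2)) := by
    refine differentiableOn_riemannZeta.continuousOn.mono fun s hs h1 ↦ ?_
    rw [Set.mem_singleton_iff] at h1
    rw [h1, mem_sphere_iff_norm] at hs
    norm_num at hs
  obtain ⟨C, hC⟩ := (isCompact_sphere _ _).exists_bound_of_continuousOn hc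
  exact ⟨max C 1, by positivity, fun s hs ↦ (hC s hs).trans (le_max_left _ _)⟩

theorem iteratedDeriv_const_mul_inv_sub_one (c : ℂ) (m : ℕ) :
    iteratedDeriv m (fun s : ℂ ↦ c * (s - 1)⁻¹) 2 = c * ((-1) ^ m * m.factorial) := by
  have h := iteratedDeriv_comp_sub_const m (fun s : ℂ ↦ s⁻¹) 1
  rw [iteratedDeriv_const_mul_field, h, iteratedDeriv_eq_iterate]
  simp only [iter_deriv_inv]
  norm_num

open scoped ComplexOrder in
/-- Let `ζ f` have nonnegative Dirichlet coefficients, the first being `1`.  The Taylor coefficients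
of `ζ(s) f(s) - f(1) / (s - 1)` in powers of `2 - s` are `b_m - f(1)` with `b_m ≥ 0` and `b_0 ≥ 1`,
and Cauchy's estimates on `|s - 2| = 3 / 2` make all but the first `M` of them negligible at `β`. -/
theorem exists_one_sub_le_re_mul_pow :
    ∃ C : ℝ, 1 ≤ C ∧ ∀ (f : ℂ → ℂ) (a : ℕ → ℂ) (B β : ℝ) (M : ℕ), Differentiable ℂ f →
      0 ≤ a → a 1 = 1 → (∀ s : ℂ, 1 < s.re → LSeriesSummable a s) →
      (∀ s : ℂ, 1 < s.re → LSeries a s = riemannZeta s * f s) →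
      1 ≤ B → (∀ s ∈ Metric.closedBall (2 : ℂ) (3 / 2), ‖f s‖ ≤ B) →
      7 / 8 < β → β < 1 → (riemannZeta β * f β).re ≤ 0 → C * B * (3 / 4) ^ M ≤ 1 / 2 →
      (1 - β) / 2 ≤ (f 1).re * (2 - β) ^ M := by
  obtain ⟨C, hC0, hC⟩ := exists_norm_riemannZeta_le_on_sphere
  refine ⟨4 * (C + 2), by linarith, fun f a B β M hf ha ha1 hsum hL hB hfB hβ hβ1 hsign hM ↦ ?_⟩
  set G : ℂ → ℂ := fun s ↦ riemannZeta₀ s * f s + dslope f 1 s with hG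
  have hdsl : Differentiable ℂ (dslope f 1) := by
    rw [← differentiableOn_univ, Complex.differentiableOn_dslope Filter.univ_mem]
    exact hf.differentiableOn
  have hGd : Differentiable ℂ G := (differentiable_riemannZeta₀.mul hf).add hdsl
  have hGne (s : ℂ) (hs : s ≠ 1) : G s = riemannZeta s * f s - f 1 * (s - 1)⁻¹ := by
    have hs' : s - 1 ≠ 0 := sub_ne_zero.mpr hs
    simp only [hG, riemannZeta_eq_inv_sub_add hs, dslope_of_ne f hs, slope_def_field]
    field_simp
    ring
  have h1mem : (1 : ℂ) ∈ Metric.closedBall (2 : ℂ) (3 / 2) := by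
    rw [mem_closedBall_iff_norm]; norm_num
  have hbound : ∀ s ∈ Metric.sphere (2 : ℂ) (3 / 2), ‖G s‖ ≤ (C + 2) * B := by
    intro s hs
    have hsn : ‖s - 2‖ = 3 / 2 := mem_sphere_iff_norm.mp hs
    have hs1 : (1 : ℝ) / 2 ≤ ‖s - 1‖ := by
      have := norm_sub_norm_le (s - 2) (-1)
      rw [norm_neg, norm_one, hsn, show s - 2 - -1 = s - 1 by ring] at this
      linarith
    have hsne : s ≠ 1 := by rintro rfl; norm_num at hs1
    rw [hGne s hsne]
    refine (norm_sub_le _ _).trans ?_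
    rw [norm_mul, norm_mul, norm_inv]
    have h2 : ‖s - 1‖⁻¹ ≤ 2 := by
      rw [inv_le_comm₀ (by linarith) (by norm_num)]; linarith
    have := hC s hs
    have := hfB s (Metric.sphere_subset_closedBall hs)
    have := hfB 1 h1mem
    calc _ ≤ C * B + B * 2 := by gcongr
      _ = _ := by ring
  have hcauchy (m : ℕ) : ‖((m.factorial : ℂ))⁻¹ * iteratedDeriv m G 2‖
      ≤ (C + 2) * B * (2 / 3) ^ m := by
    have := Complex.norm_iteratedDeriv_le_of_forall_mem_sphere_norm_le m (by norm_num)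
      hGd.diffContOnCl hbound
    rw [norm_mul, norm_inv, Complex.norm_natCast]
    have hm : (0 : ℝ) < m.factorial := by exact_mod_cast m.factorial_pos
    rw [inv_mul_le_iff₀ hm]
    refine this.trans (le_of_eq ?_)
    rw [show (2 / 3 : ℝ) = (3 / 2)⁻¹ by norm_num, inv_pow]
    ring
  -- the Taylor coefficients `b_m` of `ζ f` at `2`
  set b : ℕ → ℝ := fun m ↦ ((-1) ^ m * (((m.factorial : ℂ))⁻¹ * iteratedDeriv m (LSeries a) 2)).re
  have habs : LSeries.abscissaOfAbsConv a < (2 : ℝ) := by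
    refine (LSeries.abscissaOfAbsConv_le_of_forall_lt_LSeriesSummable (x := 1) fun y hy ↦
      hsum y (by simpa using hy)).trans_lt ?_
    exact_mod_cast (by norm_num : (1 : ℝ) < 2)
  have hb0 (m : ℕ) : 0 ≤ b m := by
    have h := LSeries.iteratedDeriv_alternating ha habs m
    have h2 : 0 ≤ ((m.factorial : ℂ))⁻¹ * ((-1) ^ m * iteratedDeriv m (LSeries a) (2 : ℝ)) := by
      refine mul_nonneg ?_ h
      simp
    have h3 := (Complex.nonneg_iff.mp h2).1
    simp only [b]
    rw [mul_left_comm]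
    simpa using h3
  have hb1 : 1 ≤ b 0 := by
    have h2 := hsum 2 (by simp)
    have h : LSeries.term a 2 1 ≤ LSeries a 2 :=
      h2.le_tsum 1 fun n _ ↦ by
        have := LSeries.term_nonneg (ha n) (2 : ℝ)
        simpa using this
    have h' := (Complex.le_def.mp h).1
    simp [LSeries.term_of_ne_zero, ha1] at h'
    simpa [b] using h'
  have hcoef (m : ℕ) : ((m.factorial : ℂ))⁻¹ * iteratedDeriv m G 2 * (β - 2) ^ m
      = ((-1) ^ m * (((m.factorial : ℂ))⁻¹ * iteratedDeriv m (LSeries a) 2) - f 1)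
        * ((2 - β : ℝ) : ℂ) ^ m := by
    have hev : G =ᶠ[nhds 2] (LSeries a - fun s ↦ f 1 * (s - 1)⁻¹) := by
      have : {z : ℂ | 1 < z.re} ∈ nhds (2 : ℂ) :=
        (isOpen_lt continuous_const Complex.continuous_re).mem_nhds (by simp)
      filter_upwards [this] with z hz
      have hz1 : z ≠ 1 := by rintro rfl; simp at hz
      rw [hGne z hz1, ← hL z hz]; rfl
    have hA : AnalyticAt ℂ (LSeries a) 2 :=
      LSeries_analyticOnNhd a 2 (by simpa using habs)
    have hI : AnalyticAt ℂ (fun s : ℂ ↦ f 1 * (s - 1)⁻¹) 2 := by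
      refine analyticAt_const.mul (AnalyticAt.inv (by fun_prop) (by norm_num))
    have hm : (m.factorial : ℂ) ≠ 0 := by exact_mod_cast m.factorial_ne_zero
    rw [hev.iteratedDeriv_eq, iteratedDeriv_sub hA.contDiffAt hI.contDiffAt,
      iteratedDeriv_const_mul_inv_sub_one]
    rw [show ((β : ℂ) - 2) ^ m = (-1) ^ m * ((2 - β : ℝ) : ℂ) ^ m by
      rw [← mul_pow]; push_cast; ring]
    have hsq : ((-1 : ℂ) ^ m) * (-1) ^ m = 1 := by rw [← mul_pow]; simp
    field_simp
    linear_combination (-(f 1) * m.factorial * ((2 - β : ℝ) : ℂ) ^ m) * hsq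
  set y : ℝ := 2 - β with hy
  have hy1 : 1 < y := by linarith
  have hy2 : y < 9 / 8 := by linarith
  have hT : HasSum (fun m ↦ (((m.factorial : ℂ))⁻¹ * iteratedDeriv m G 2 * (β - 2) ^ m).re)
      (G β).re := by
    have h := Complex.hasSum_re (Complex.hasSum_taylorSeries_of_entire hGd 2 β)
    refine h.congr_fun fun m ↦ ?_
    simp only [smul_eq_mul]
    ring_nf
  have hre (m : ℕ) : (((m.factorial : ℂ))⁻¹ * iteratedDeriv m G 2 * (β - 2) ^ m).re
      = (b m - (f 1).re) * y ^ m := by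
    rw [hcoef, ← Complex.ofReal_pow, Complex.re_mul_ofReal, Complex.sub_re]
  have htail : -(1 / 2) ≤ ∑' m, (b (m + M) - (f 1).re) * y ^ (m + M) := by
    have hgeo : HasSum (fun m : ℕ ↦ (C + 2) * B * (3 / 4) ^ M * (3 / 4 : ℝ) ^ m)
        ((C + 2) * B * (3 / 4) ^ M * 4) := by
      have := (hasSum_geometric_of_lt_one (r := (3 / 4 : ℝ)) (by norm_num)
        (by norm_num)).mul_left ((C + 2) * B * (3 / 4) ^ M)
      norm_num at this ⊢
      exact this
    have hle := tsum_of_norm_bounded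
      (f := fun m ↦ (b (m + M) - (f 1).re) * y ^ (m + M)) hgeo fun m ↦ ?_
    · have := (abs_le.mp ((Real.norm_eq_abs _).symm.le.trans hle)).1
      nlinarith
    · rw [← hre]
      refine (Complex.abs_re_le_norm _).trans ?_
      rw [norm_mul]
      have h2 : ‖((β : ℂ) - 2) ^ (m + M)‖ ≤ (9 / 8) ^ (m + M) := by
        rw [norm_pow]
        have : ‖(β : ℂ) - 2‖ = y := by
          rw [show (β : ℂ) - 2 = ((-y : ℝ) : ℂ) by simp [hy], Complex.norm_real, norm_neg,
            Real.norm_of_nonneg (by linarith)]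
        rw [this]
        gcongr
      calc _ ≤ (C + 2) * B * (2 / 3) ^ (m + M) * (9 / 8) ^ (m + M) := by
            gcongr
            exact hcauchy _
        _ = (C + 2) * B * (3 / 4) ^ (m + M) := by
            rw [mul_assoc, ← mul_pow]; norm_num
        _ = _ := by rw [pow_add]; ring
  have hsplit : (G β).re = ∑ m ∈ Finset.range M, (b m - (f 1).re) * y ^ m
      + ∑' m, (b (m + M) - (f 1).re) * y ^ (m + M) := by
    simp_rw [hre] at hT
    rw [hT.summable.sum_add_tsum_nat_add, hT.tsum_eq]
  have hM0 : 0 < M := by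
    rcases Nat.eq_zero_or_pos M with h | h
    · rw [h, pow_zero, mul_one] at hM
      nlinarith
    · exact h
  have hhead : 1 - (f 1).re * ((y ^ M - 1) / (y - 1))
      ≤ ∑ m ∈ Finset.range M, (b m - (f 1).re) * y ^ m := by
    simp_rw [sub_mul]
    rw [Finset.sum_sub_distrib, ← Finset.mul_sum, geom_sum_eq hy1.ne']
    gcongr
    have := Finset.single_le_sum (f := fun m ↦ b m * y ^ m) (s := Finset.range M)
      (fun m _ ↦ mul_nonneg (hb0 m) (by positivity)) (Finset.mem_range.mpr hM0)
    simp only [pow_zero, mul_one] at this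
    linarith
  have hβne : (β : ℂ) ≠ 1 := by exact_mod_cast hβ1.ne
  have hGβ : (G β).re ≤ (f 1).re / (y - 1) := by
    rw [hGne _ hβne, Complex.sub_re]
    have : ((β : ℂ) - 1)⁻¹ = ((-(y - 1)⁻¹ : ℝ) : ℂ) := by
      rw [← inv_neg]; push_cast [hy]; ring
    rw [this, Complex.re_mul_ofReal]
    have : (f 1).re * -(y - 1)⁻¹ = -((f 1).re / (y - 1)) := by ring
    linarith
  have hpos : 0 < y - 1 := by linarith
  have hfin : 1 / 2 ≤ (f 1).re * y ^ M / (y - 1) := by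
    have : (f 1).re * ((y ^ M - 1) / (y - 1))
        = (f 1).re * y ^ M / (y - 1) - (f 1).re / (y - 1) := by
      ring
    linarith
  rw [le_div_iff₀ hpos] at hfin
  linarith

open scoped ComplexOrder in
/-- A lower bound for `f(1)`, losing only a small power of the size `B` of `f` when `β` is close to
`1`.  It is `exists_one_sub_le_re_mul_pow` with `M` about `4 log (2 C B)`, large enough to make the
Taylor tail negligible. -/
theorem exists_mul_rpow_le_re_apply_one :
    ∃ c : ℝ, 0 < c ∧ ∀ (f : ℂ → ℂ) (a : ℕ → ℂ) (B β : ℝ), Differentiable ℂ f →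
      0 ≤ a → a 1 = 1 → (∀ s : ℂ, 1 < s.re → LSeriesSummable a s) →
      (∀ s : ℂ, 1 < s.re → LSeries a s = riemannZeta s * f s) →
      1 ≤ B → (∀ s ∈ Metric.closedBall (2 : ℂ) (3 / 2), ‖f s‖ ≤ B) →
      7 / 8 < β → β < 1 → (riemannZeta β * f β).re ≤ 0 →
      c * (1 - β) * B ^ (-4 * (1 - β)) ≤ (f 1).re := by
  obtain ⟨C, hC1, hC⟩ := exists_one_sub_le_re_mul_pow
  refine ⟨(2 * Real.exp 1 * (2 * C) ^ 4)⁻¹, by positivity,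
    fun f a B β hf ha ha1 hsum hL hB hfB hβ hβ1 hsign ↦ ?_⟩
  have hCB : 1 ≤ 2 * C * B := by nlinarith
  have hCB0 : 0 < 2 * C * B := by linarith
  set δ := 1 - β with hδ
  have hδ0 : 0 < δ := by linarith
  have hδ1 : δ < 1 / 8 := by linarith
  set M : ℕ := ⌈4 * Real.log (2 * C * B)⌉₊
  have hlog0 : 0 ≤ Real.log (2 * C * B) := Real.log_nonneg hCB
  have hM : (M : ℝ) ≤ 4 * Real.log (2 * C * B) + 1 := (Nat.ceil_lt_add_one (by positivity)).le
  have hM' : 4 * Real.log (2 * C * B) ≤ M := Nat.le_ceil _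
  have hsmall : C * B * (3 / 4) ^ M ≤ 1 / 2 := by
    -- `3 / 4 ≤ e ^ (-1 / 4)`
    have h34 : (3 / 4 : ℝ) ≤ Real.exp (-(1 / 4)) := by
      have := Real.add_one_le_exp (-(1 / 4) : ℝ); linarith
    have : (3 / 4 : ℝ) ^ M ≤ (2 * C * B)⁻¹ := by
      calc (3 / 4 : ℝ) ^ M ≤ Real.exp (-(1 / 4)) ^ M := by gcongr
        _ = Real.exp (M * (-(1 / 4))) := (Real.exp_nat_mul _ _).symm
        _ ≤ Real.exp (-Real.log (2 * C * B)) := by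
            apply Real.exp_le_exp.mpr; linarith
        _ = _ := by rw [Real.exp_neg, Real.exp_log hCB0]
    calc C * B * (3 / 4) ^ M ≤ C * B * (2 * C * B)⁻¹ := by gcongr
      _ = 1 / 2 := by field_simp
  have key := hC f a B β M hf ha ha1 hsum hL hB hfB hβ hβ1 hsign hsmall
  have hpow : (2 - β) ^ M ≤ Real.exp 1 * (2 * C) ^ 4 * B ^ (4 * δ) := by
    calc (2 - β) ^ M ≤ Real.exp δ ^ M := by
          gcongr
          · linarith
          · have := Real.add_one_le_exp δ; linarith
      _ = Real.exp (M * δ) := (Real.exp_nat_mul _ _).symm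
      _ ≤ Real.exp (1 + Real.log (2 * C * B) * (4 * δ)) := by
          apply Real.exp_le_exp.mpr
          nlinarith
      _ = Real.exp 1 * (2 * C * B) ^ (4 * δ) := by
          rw [Real.exp_add, Real.rpow_def_of_pos hCB0]
      _ = Real.exp 1 * ((2 * C) ^ (4 * δ) * B ^ (4 * δ)) := by
          rw [Real.mul_rpow (by positivity) (by positivity)]
      _ ≤ Real.exp 1 * ((2 * C) ^ (4 : ℝ) * B ^ (4 * δ)) := by
          gcongr <;> linarith
      _ = _ := by
          rw [show (4 : ℝ) = ((4 : ℕ) : ℝ) by norm_num, Real.rpow_natCast]; ring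
  have hp0 : 0 < (2 - β) ^ M := by
    have : 0 < 2 - β := by linarith
    positivity
  have hf0 : 0 < (f 1).re := by
    by_contra h
    push Not at h
    have : (f 1).re * (2 - β) ^ M ≤ 0 := mul_nonpos_of_nonpos_of_nonneg h hp0.le
    linarith
  have hBp : 0 < B ^ (4 * δ) := by positivity
  have h2 : δ / 2 ≤ (f 1).re * (Real.exp 1 * (2 * C) ^ 4 * B ^ (4 * δ)) :=
    key.trans (by gcongr)
  rw [show -4 * δ = -(4 * δ) by ring, Real.rpow_neg (by linarith)]
  rw [← sub_nonneg] at h2 ⊢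
  have : (f 1).re - (2 * Real.exp 1 * (2 * C) ^ 4)⁻¹ * δ * (B ^ (4 * δ))⁻¹
    = ((f 1).re * (Real.exp 1 * (2 * C) ^ 4 * B ^ (4 * δ)) - δ / 2)
      / (Real.exp 1 * (2 * C) ^ 4 * B ^ (4 * δ)) := by
    field_simp
  rw [this]
  positivity

/-! ### Siegel's theorem -/

namespace DirichletCharacter

open ArithmeticFunction

theorem zetaMul_prime_pow {q : ℕ} (χ : DirichletCharacter ℂ q) {p : ℕ} (hp : p.Prime) (k : ℕ) :
    χ.zetaMul (p ^ k) = ∑ i ∈ Finset.range (k + 1), χ p ^ i := by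
  rw [zetaMul, coe_zeta_mul_apply, Nat.sum_divisors_prime_pow hp]
  refine Finset.sum_congr rfl fun i _ ↦ ?_
  rw [← χ.apply_eq_toArithmeticFunction_apply (pow_ne_zero i hp.ne_zero), Nat.cast_pow, map_pow]

theorem zetaMul_one {q : ℕ} (χ : DirichletCharacter ℂ q) : χ.zetaMul 1 = 1 :=
  χ.isMultiplicative_zetaMul.map_one

section product

variable {q₁ q₂ q₃ : ℕ}

theorem isMultiplicative_zetaMul_mul (χ₁ : DirichletCharacter ℂ q₁) (χ₂ : DirichletCharacter ℂ q₂)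
    (ψ : DirichletCharacter ℂ q₃) :
    (χ₁.zetaMul * (toArithmeticFunction (χ₂ ·) * toArithmeticFunction (ψ ·))).IsMultiplicative :=
  χ₁.isMultiplicative_zetaMul.mul
    ((isMultiplicative_toArithmeticFunction χ₂).mul (isMultiplicative_toArithmeticFunction ψ))

theorem zetaMul_mul_comm (χ₁ : DirichletCharacter ℂ q₁) (χ₂ : DirichletCharacter ℂ q₂)
    (ψ : DirichletCharacter ℂ q₃) :
    χ₁.zetaMul * (toArithmeticFunction (χ₂ ·) * toArithmeticFunction (ψ ·))
      = χ₂.zetaMul * (toArithmeticFunction (χ₁ ·) * toArithmeticFunction (ψ ·)) := by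
  simp only [zetaMul]
  ring

theorem toArithmeticFunction_mul_apply {χ₁ : DirichletCharacter ℂ q₁}
    {χ₂ : DirichletCharacter ℂ q₂} {ψ : DirichletCharacter ℂ q₃}
    (hψ : ∀ n : ℕ, ψ n = χ₁ n * χ₂ n) (n : ℕ) :
    (toArithmeticFunction (χ₂ ·) * toArithmeticFunction (ψ ·)) n = χ₂ n * χ₁.zetaMul n := by
  rw [ArithmeticFunction.mul_apply, zetaMul, ArithmeticFunction.mul_apply, Finset.mul_sum]
  refine Finset.sum_congr rfl fun x hx ↦ ?_
  obtain ⟨hx1, hx2⟩ := Nat.mem_divisorsAntidiagonal.mp hx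
  have h1 : x.1 ≠ 0 := fun h ↦ hx2 (by simp [← hx1, h])
  have h2 : x.2 ≠ 0 := fun h ↦ hx2 (by simp [← hx1, h])
  simp only [toArithmeticFunction, coe_mk, h1, h2, if_false, natCoe_apply, zeta_apply, hψ, ← hx1]
  push_cast
  rw [map_mul]
  ring

open scoped ComplexOrder

/-- The local factor at `p` is `1 / ((1 - z) (1 - a z) (1 - b z) (1 - a b z))` with `a = χ₁(p)` and
`b = χ₂(p)`; if `a = b = -1` it is a power series in `z ^ 2`. -/
theorem zetaMul_mul_prime_pow_nonneg {χ₁ : DirichletCharacter ℂ q₁} {χ₂ : DirichletCharacter ℂ q₂}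
    {ψ : DirichletCharacter ℂ q₃} (hψ : ∀ n : ℕ, ψ n = χ₁ n * χ₂ n) (h₁ : χ₁ ^ 2 = 1)
    (h₂ : χ₂ ^ 2 = 1) {p : ℕ} (hp : p.Prime) (k : ℕ) :
    0 ≤ (χ₁.zetaMul * (toArithmeticFunction (χ₂ ·) * toArithmeticFunction (ψ ·))) (p ^ k) := by
  have aux {r₁ r₂ : ℕ} {η₁ : DirichletCharacter ℂ r₁} {η₂ : DirichletCharacter ℂ r₂}
      (hη : ∀ n : ℕ, ψ n = η₁ n * η₂ n) (hη₁ : η₁ ^ 2 = 1)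
      (hpos : ∀ j, 0 ≤ η₂ (p ^ j : ℕ) ∨ η₁.zetaMul (p ^ j) = 0) :
      0 ≤ (η₁.zetaMul * (toArithmeticFunction (η₂ ·) * toArithmeticFunction (ψ ·))) (p ^ k) := by
    rw [ArithmeticFunction.mul_apply]
    refine Finset.sum_nonneg fun x hx ↦ mul_nonneg (zetaMul_nonneg hη₁ _) ?_
    rw [toArithmeticFunction_mul_apply hη]
    obtain ⟨hx1, -⟩ := Nat.mem_divisorsAntidiagonal.mp hx
    obtain ⟨j, -, hj⟩ := (Nat.dvd_prime_pow hp).mp (Dvd.intro_left x.1 hx1)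
    rw [hj]
    rcases hpos j with h | h
    · exact mul_nonneg h (zetaMul_nonneg hη₁ _)
    · rw [h, mul_zero]
  have pos {r : ℕ} {η : DirichletCharacter ℂ r} (h : 0 ≤ η p) (j : ℕ) : 0 ≤ η (p ^ j : ℕ) := by
    rw [Nat.cast_pow, map_pow]; exact pow_nonneg h j
  rcases MulChar.isQuadratic_iff_sq_eq_one.mpr h₂ p with hb | hb | hb
  · exact aux hψ h₁ fun j ↦ .inl (pos (by simp [hb]) j)
  · exact aux hψ h₁ fun j ↦ .inl (pos (by simp [hb]) j)
  rcases MulChar.isQuadratic_iff_sq_eq_one.mpr h₁ p with ha | ha | ha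
  · rw [zetaMul_mul_comm]
    exact aux (fun n ↦ by rw [hψ, mul_comm]) h₂ fun j ↦ .inl (pos (by simp [ha]) j)
  · rw [zetaMul_mul_comm]
    exact aux (fun n ↦ by rw [hψ, mul_comm]) h₂ fun j ↦ .inl (pos (by simp [ha]) j)
  refine aux hψ h₁ fun j ↦ ?_
  rcases Nat.even_or_odd j with hj | hj
  · left
    rw [Nat.cast_pow, map_pow, hb, hj.neg_one_pow]
    exact zero_le_one
  · right
    rw [zetaMul_prime_pow χ₁ hp, ha, neg_one_geom_sum, if_pos hj.add_one]

theorem zetaMul_mul_nonneg {χ₁ : DirichletCharacter ℂ q₁} {χ₂ : DirichletCharacter ℂ q₂}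
    {ψ : DirichletCharacter ℂ q₃} (hψ : ∀ n : ℕ, ψ n = χ₁ n * χ₂ n) (h₁ : χ₁ ^ 2 = 1)
    (h₂ : χ₂ ^ 2 = 1) (n : ℕ) :
    0 ≤ (χ₁.zetaMul * (toArithmeticFunction (χ₂ ·) * toArithmeticFunction (ψ ·))) n := by
  rcases eq_or_ne n 0 with rfl | hn
  · simp
  · rw [(isMultiplicative_zetaMul_mul χ₁ χ₂ ψ).multiplicative_factorization _ hn]
    exact Finset.prod_nonneg fun p hp ↦
      zetaMul_mul_prime_pow_nonneg hψ h₁ h₂ (Nat.prime_of_mem_primeFactors hp) _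

end product

section LSeries

variable {q : ℕ} [NeZero q]

theorem LSeriesSummable_toArithmeticFunction (χ : DirichletCharacter ℂ q) {s : ℂ} (hs : 1 < s.re) :
    LSeriesSummable (toArithmeticFunction (χ ·)) s :=
  (LSeriesSummable_congr _ fun h ↦ (χ.apply_eq_toArithmeticFunction_apply h).symm).mpr <|
    ZMod.LSeriesSummable_of_one_lt_re χ hs

theorem LSeries_toArithmeticFunction (χ : DirichletCharacter ℂ q) {s : ℂ} (hs : 1 < s.re) :
    LSeries (toArithmeticFunction (χ ·)) s = χ.LFunction s := by
  rw [χ.LFunction_eq_LSeries hs]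
  exact (LSeries_congr χ.apply_eq_toArithmeticFunction_apply s).symm

theorem LSeries_zetaMul (χ : DirichletCharacter ℂ q) {s : ℂ} (hs : 1 < s.re) :
    LSeries χ.zetaMul s = riemannZeta s * χ.LFunction s := by
  have h1 : LSeries ((zeta : ArithmeticFunction ℂ) ·) s = riemannZeta s := by
    rw [← LSeries_zeta_eq_riemannZeta hs]
    simp_rw [← natCoe_apply]
  have h2 : LSeriesSummable ((zeta : ArithmeticFunction ℂ) ·) s := LSeriesSummable_zeta_iff.mpr hs
  rw [zetaMul, ArithmeticFunction.LSeries_mul' h2 (χ.LSeriesSummable_toArithmeticFunction hs),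
    χ.LSeries_toArithmeticFunction hs, h1]

end LSeries

section Siegel

theorem im_apply_eq_zero_of_sq_eq_one {q : ℕ} {χ : DirichletCharacter ℂ q} (hχ : χ ^ 2 = 1)
    (a : ZMod q) : (χ a).im = 0 := by
  rcases MulChar.isQuadratic_iff_sq_eq_one.mpr hχ a with h | h | h <;> simp [h]

variable {q : ℕ} [NeZero q]

theorem riemannZeta_im_ofReal (x : ℝ) : (riemannZeta x).im = 0 := by
  have h := riemannZeta_conj (x : ℂ)
  rw [Complex.conj_ofReal] at h
  exact Complex.conj_eq_iff_im.mp h.symm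

theorem exists_riemannZeta_re_neg :
    ∃ δ : ℝ, 0 < δ ∧ ∀ β : ℝ, 1 - δ < β → β < 1 → (riemannZeta β).re < 0 := by
  have hcont : Continuous fun x : ℝ ↦ (riemannZeta₁ x).re :=
    Complex.continuous_re.comp (differentiable_riemannZeta₁.continuous.comp
      Complex.continuous_ofReal)
  have hpos : ∀ᶠ x : ℝ in nhds 1, 0 < (riemannZeta₁ x).re :=
    hcont.continuousAt.eventually (lt_mem_nhds (by simp))
  obtain ⟨δ, hδ, h⟩ := Metric.eventually_nhds_iff.mp hpos
  refine ⟨δ, hδ, fun β h1 h2 ↦ ?_⟩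
  have hb : 0 < (riemannZeta₁ β).re := h (by rw [Real.dist_eq, abs_lt]; constructor <;> linarith)
  have hne : (β : ℂ) ≠ 1 := by exact_mod_cast h2.ne
  rw [riemannZeta_eq_inv_sub_mul hne,
    show ((β : ℂ) - 1)⁻¹ = (((β - 1)⁻¹ : ℝ) : ℂ) by push_cast; rfl,
    Complex.re_ofReal_mul]
  exact mul_neg_of_neg_of_pos (inv_lt_zero.mpr (by linarith)) hb

open scoped ComplexOrder in
theorem LFunction_two_re_pos {χ : DirichletCharacter ℂ q} (hχ2 : χ ^ 2 = 1) :
    0 < (χ.LFunction (2 : ℝ)).re := by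
  have habs (a : ℕ → ℂ) (ha : ∀ s : ℂ, 1 < s.re → LSeriesSummable a s) :
      LSeries.abscissaOfAbsConv a < (2 : ℝ) := by
    refine (LSeries.abscissaOfAbsConv_le_of_forall_lt_LSeriesSummable (x := 1) fun y hy ↦
      ha y (by simpa using hy)).trans_lt ?_
    exact_mod_cast (by norm_num : (1 : ℝ) < 2)
  have h1 : 0 < LSeries χ.zetaMul (2 : ℝ) :=
    LSeries.positive (fun n ↦ zetaMul_nonneg hχ2 n) (by rw [zetaMul_one]; exact one_pos)
      (habs _ fun s hs ↦ χ.LSeriesSummable_zetaMul hs)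
  have h2 : 0 < riemannZeta (2 : ℝ) := by
    rw [← LSeries_one_eq_riemannZeta (by simp)]
    exact LSeries.positive (fun n ↦ zero_le_one) one_pos
      (habs _ fun s hs ↦ LSeriesSummable_one_iff.mpr hs)
  rw [LSeries_zetaMul _ (by simp)] at h1
  have h3 := (Complex.pos_iff.mp h1).1
  have h4 := (Complex.pos_iff.mp h2).1
  rw [Complex.mul_re, riemannZeta_im_ofReal, zero_mul, sub_zero] at h3
  exact (pos_iff_pos_of_mul_pos h3).mp h4

/-- A quadratic `L`-function that is negative at `β < 1` has a real zero between `β` and `1`, since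
it is positive at `2` and has no zero in `[1, 2]`. -/
theorem exists_LFunction_eq_zero {χ : DirichletCharacter ℂ q} (hχ2 : χ ^ 2 = 1) (hχ : χ ≠ 1)
    {β : ℝ} (hβ : 0 < β) (hβ1 : β < 1) (hneg : (χ.LFunction β).re < 0) :
    ∃ x : ℝ, β < x ∧ x < 1 ∧ χ.LFunction x = 0 := by
  have hcont : Continuous fun x : ℝ ↦ (χ.LFunction x).re :=
    Complex.continuous_re.comp
      ((differentiable_LFunction hχ).continuous.comp Complex.continuous_ofReal)
  obtain ⟨x, hx, hx0⟩ := intermediate_value_Icc (by linarith : β ≤ 2) hcont.continuousOn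
    ⟨hneg.le, (LFunction_two_re_pos hχ2).le⟩
  have hz : χ.LFunction x = 0 :=
    Complex.ext hx0 (LFunction_im_eq_zero hχ (im_apply_eq_zero_of_sq_eq_one hχ2) (hβ.trans_le hx.1))
  refine ⟨x, lt_of_le_of_ne hx.1 fun h ↦ ?_, not_le.mp fun h ↦ ?_, hz⟩
  · rw [← h] at hx0; exact hneg.ne hx0
  · exact LFunction_ne_zero_of_one_le_re (s := x) χ (.inl hχ) (by simpa) hz

theorem exists_norm_LFunction_le_mul :
    ∃ C : ℝ, 1 ≤ C ∧ ∀ (q : ℕ) [NeZero q] (χ : DirichletCharacter ℂ q), χ ≠ 1 →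
      ∀ s ∈ Metric.closedBall (2 : ℂ) (3 / 2), ‖χ.LFunction s‖ ≤ C * q := by
  refine ⟨max 1 (4 * ∑' n : ℕ, ((n : ℝ) + 1) ^ (-(1 / 2 : ℝ) - 1)), le_max_left _ _,
    fun q _ χ hχ s hs ↦ ?_⟩
  have hs' : ‖s - 2‖ ≤ 3 / 2 := mem_closedBall_iff_norm.mp hs
  have hre : 1 / 2 ≤ s.re := by
    have := (Complex.abs_re_le_norm (s - 2)).trans hs'
    have := (abs_le.mp this).1
    simp at this
    linarith
  have hn : ‖s‖ ≤ 4 := by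
    have := norm_add_le (s - 2) 2
    simp at this
    linarith
  refine (norm_LFunction_le hχ hre).trans ?_
  rw [mul_comm]
  have h0 : (0 : ℝ) ≤ ∑' n : ℕ, ((n : ℝ) + 1) ^ (-(1 / 2 : ℝ) - 1) :=
    tsum_nonneg fun n ↦ by positivity
  gcongr
  exact (mul_le_mul_of_nonneg_right hn h0).trans (le_max_right _ _)

theorem prod_one_sub_ne_zero {q : ℕ} (χ : DirichletCharacter ℂ q) (N : ℕ) {β : ℝ} (hβ : 0 < β) :
    ∏ p ∈ N.primeFactors, (1 - χ p * (p : ℂ) ^ (-(β : ℂ))) ≠ 0 := by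
  refine Finset.prod_ne_zero_iff.mpr fun p hp h ↦ ?_
  have hp2 := (Nat.prime_of_mem_primeFactors hp).one_lt
  have h1 : ‖χ p * (p : ℂ) ^ (-(β : ℂ))‖ < 1 := by
    rw [norm_mul, Complex.norm_natCast_cpow_of_pos (by lia)]
    have h2 : (p : ℝ) ^ (-(β : ℂ)).re < 1 :=
      Real.rpow_lt_one_of_one_lt_of_neg (by exact_mod_cast hp2) (by simpa)
    have h3 : 0 ≤ (p : ℝ) ^ (-(β : ℂ)).re := by positivity
    have := χ.norm_le_one (p : ZMod q)
    nlinarith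
  rw [← sub_eq_zero.mp h, norm_one] at h1
  exact lt_irrefl _ h1

/-- Two quadratic characters whose product is principal have the same real zeros. -/
theorem LFunction_eq_zero_of_mul_eq_one {q₁ q₂ : ℕ} [NeZero q₁] [NeZero q₂]
    {χ₁ : DirichletCharacter ℂ q₁} {χ₂ : DirichletCharacter ℂ q₂} (h₁ : χ₁ ^ 2 = 1)
    (h : changeLevel (Nat.dvd_mul_right q₁ q₂) χ₁ * changeLevel (Nat.dvd_mul_left q₂ q₁) χ₂ = 1)
    {β : ℝ} (hβ : 0 < β) (hβ1 : β < 1) (hz : χ₁.LFunction β = 0) : χ₂.LFunction β = 0 := by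
  have heq : changeLevel (Nat.dvd_mul_left q₂ q₁) χ₂
      = changeLevel (Nat.dvd_mul_right q₁ q₂) χ₁ := by
    have h2 : changeLevel (Nat.dvd_mul_right q₁ q₂) χ₁ * changeLevel (Nat.dvd_mul_right q₁ q₂) χ₁
        = 1 := by rw [← map_mul, ← sq, h₁, map_one]
    exact mul_left_cancel (h.trans h2.symm)
  have hne : (β : ℂ) ≠ 1 := by exact_mod_cast hβ1.ne
  have e1 := LFunction_changeLevel (Nat.dvd_mul_right q₁ q₂) χ₁ (s := β) (.inr hne)
  have e2 := LFunction_changeLevel (Nat.dvd_mul_left q₂ q₁) χ₂ (s := β) (.inr hne)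
  rw [heq, e1, hz, zero_mul] at e2
  exact (mul_eq_zero.mp e2.symm).resolve_right (prod_one_sub_ne_zero χ₂ _ hβ)

theorem changeLevel_mul_changeLevel_natCast {q₁ q₂ : ℕ} [NeZero q₁] [NeZero q₂]
    (χ₁ : DirichletCharacter ℂ q₁) (χ₂ : DirichletCharacter ℂ q₂) (n : ℕ) :
    (changeLevel (Nat.dvd_mul_right q₁ q₂) χ₁ * changeLevel (Nat.dvd_mul_left q₂ q₁) χ₂) n
      = χ₁ n * χ₂ n := by
  rw [MulChar.mul_apply]
  by_cases hn : IsUnit (n : ZMod (q₁ * q₂))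
  · have hc : IsCoprime (n : ℤ) ((q₁ * q₂ : ℕ) : ℤ) :=
      Nat.isCoprime_iff_coprime.mpr ((ZMod.isUnit_iff_coprime _ _).mp hn)
    have e1 := changeLevel_eq_cast_of_dvd' χ₁ (Nat.dvd_mul_right q₁ q₂) hc
    have e2 := changeLevel_eq_cast_of_dvd' χ₂ (Nat.dvd_mul_left q₂ q₁) hc
    rw [Int.cast_natCast, Int.cast_natCast] at e1 e2
    rw [e1, e2]
  · rw [MulChar.map_nonunit _ hn, zero_mul]
    rw [ZMod.isUnit_iff_coprime, Nat.coprime_mul_iff_right, not_and_or] at hn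
    rcases hn with h | h
    · rw [χ₁.map_nonunit fun h' ↦ h ((ZMod.isUnit_iff_coprime _ _).mp h'), zero_mul]
    · rw [χ₂.map_nonunit fun h' ↦ h ((ZMod.isUnit_iff_coprime _ _).mp h'), mul_zero]

open scoped ComplexOrder in
/-- **Siegel's theorem** for quadratic characters.  If `L(s, χ) ≥ 0` at a fixed point `β < 1` for
every `χ`, the lower bound comes from `ζ(s) L(s, χ)`; otherwise some `L(s, χ₁)` has a zero close to
`1`, and it comes from `ζ(s) L(s, χ₁) L(s, χ) L(s, χ₁ χ)`.  The constant depends on `χ₁`, and is not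
effective. -/
theorem exists_le_norm_LFunction_one {ε : ℝ} (hε : 0 < ε) :
    ∃ c : ℝ, 0 < c ∧ ∀ (q : ℕ) [NeZero q] (χ : DirichletCharacter ℂ q), χ ^ 2 = 1 → χ ≠ 1 →
      c * (q : ℝ) ^ (-ε) ≤ ‖χ.LFunction 1‖ := by
  obtain ⟨c, hc, hlow⟩ := exists_mul_rpow_le_re_apply_one
  obtain ⟨C, hC1, hC⟩ := exists_norm_LFunction_le_mul
  obtain ⟨δ, hδ, hζ⟩ := exists_riemannZeta_re_neg
  have hC0 : 0 < C := by linarith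
  obtain ⟨η, hη0, hη8, hηδ, hηε⟩ : ∃ η : ℝ, 0 < η ∧ η < 1 / 8 ∧ η < δ ∧ 16 * η ≤ ε := by
    refine ⟨min (1 / 16) (min (δ / 2) (ε / 16)), by positivity, ?_, ?_, ?_⟩
    · exact (min_le_left _ _).trans_lt (by norm_num)
    · exact ((min_le_right _ _).trans (min_le_left _ _)).trans_lt (by linarith)
    · linarith [(min_le_right (1 / 16) (min (δ / 2) (ε / 16))).trans (min_le_right _ _)]
  -- the bound obtained from `ζ(s) L(s, χ)` and a point `1 - x` where that product is not positive
  have single (q : ℕ) [NeZero q] (χ : DirichletCharacter ℂ q) (hχ2 : χ ^ 2 = 1) (hχ : χ ≠ 1)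
      (x : ℝ) (hx0 : 0 < x) (hx : x ≤ η)
      (hs : (riemannZeta (1 - x : ℝ) * χ.LFunction (1 - x : ℝ)).re ≤ 0) :
      c * x * C ^ (-4 * x) * (q : ℝ) ^ (-ε) ≤ ‖χ.LFunction 1‖ := by
    have hq : (1 : ℝ) ≤ q := by exact_mod_cast NeZero.one_le
    have h := hlow χ.LFunction χ.zetaMul (C * q) (1 - x) (differentiable_LFunction hχ)
      (fun n ↦ zetaMul_nonneg hχ2 n) χ.zetaMul_one (fun s hs ↦ χ.LSeriesSummable_zetaMul hs)
      (fun s hs ↦ χ.LSeries_zetaMul hs) (by nlinarith) (hC q χ hχ) (by linarith) (by linarith) hs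
    rw [sub_sub_cancel, Real.mul_rpow hC0.le (by linarith)] at h
    have h2 : (q : ℝ) ^ (-ε) ≤ (q : ℝ) ^ (-4 * x) :=
      Real.rpow_le_rpow_of_exponent_le hq (by linarith)
    calc _ ≤ c * x * C ^ (-4 * x) * (q : ℝ) ^ (-4 * x) := by gcongr
      _ = c * x * (C ^ (-4 * x) * (q : ℝ) ^ (-4 * x)) := by ring
      _ ≤ _ := h.trans ((le_abs_self _).trans (Complex.abs_re_le_norm _))
  by_cases hall : ∀ (q : ℕ) [NeZero q] (χ : DirichletCharacter ℂ q), χ ^ 2 = 1 → χ ≠ 1 →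
      0 ≤ (χ.LFunction (1 - η : ℝ)).re
  · refine ⟨c * η * C ^ (-4 * η), by positivity, fun q _ χ hχ2 hχ ↦
      single q χ hχ2 hχ η hη0 le_rfl ?_⟩
    rw [Complex.mul_re, riemannZeta_im_ofReal, zero_mul, sub_zero]
    exact mul_nonpos_of_nonpos_of_nonneg (hζ _ (by linarith) (by linarith)).le (hall q χ hχ2 hχ)
  push Not at hall
  obtain ⟨q₁, _, χ₁, h₁2, h₁, hneg⟩ := hall
  obtain ⟨β, hβ, hβ1, hz⟩ := exists_LFunction_eq_zero h₁2 h₁ (by linarith) (by linarith) hneg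
  set x := 1 - β with hx
  have hxη : x ≤ η := by linarith
  have hx0 : 0 < x := by linarith
  have hβx : β = 1 - x := by ring
  have hq₁ : (1 : ℝ) ≤ q₁ := by exact_mod_cast NeZero.one_le
  have hL₁ : 0 < ‖χ₁.LFunction 1‖ := norm_pos_iff.mpr (LFunction_apply_one_ne_zero h₁)
  set ε' := min (ε / 2) 1 with hε'
  have hε'0 : 0 < ε' := by positivity
  set T : ℝ := 2 * ∑' n : ℕ, ((n : ℝ) + 1) ^ (-ε' - 1) with hT
  have hT0 : 0 < T := by
    refine mul_pos two_pos ((summable_rpow_neg_sub_one hε'0).tsum_pos (fun n ↦ by positivity) 0 ?_)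
    simp
  set c₁ : ℝ := c * x * C ^ (-4 * x) with hc₁
  set c₂ : ℝ := c * x * (C ^ 3 * q₁ ^ 2) ^ (-4 * x) / (‖χ₁.LFunction 1‖ * (q₁ ^ ε' * T)) with hc₂
  refine ⟨min c₁ c₂, lt_min (by positivity) (by positivity), fun q _ χ hχ2 hχ ↦ ?_⟩
  have hq : (1 : ℝ) ≤ q := by exact_mod_cast NeZero.one_le
  set ψ := changeLevel (Nat.dvd_mul_right q₁ q) χ₁
    * changeLevel (Nat.dvd_mul_left q q₁) χ with hψdef
  by_cases hψ : ψ = 1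
  · have hzero : χ.LFunction β = 0 :=
      LFunction_eq_zero_of_mul_eq_one h₁2 hψ (by linarith) hβ1 hz
    refine le_trans (mul_le_mul_of_nonneg_right (min_le_left _ _) (by positivity))
      (single q χ hχ2 hχ x hx0 hxη ?_)
    rw [← hβx, hzero, mul_zero, Complex.zero_re]
  have hψn (n : ℕ) : ψ n = χ₁ n * χ n := changeLevel_mul_changeLevel_natCast χ₁ χ n
  have hsum (s : ℂ) (hs : 1 < s.re) := ArithmeticFunction.LSeriesSummable_mul
    (χ.LSeriesSummable_toArithmeticFunction hs) (ψ.LSeriesSummable_toArithmeticFunction hs)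
  have hB1 : 1 ≤ C ^ 3 * q₁ ^ 2 * (q : ℝ) ^ 2 :=
    one_le_mul_of_one_le_of_one_le (one_le_mul_of_one_le_of_one_le (one_le_pow₀ hC1)
      (one_le_pow₀ hq₁)) (one_le_pow₀ hq)
  set g : ArithmeticFunction ℂ :=
    χ₁.zetaMul * (toArithmeticFunction (χ ·) * toArithmeticFunction (ψ ·)) with hg
  have h := hlow (fun s ↦ χ₁.LFunction s * (χ.LFunction s * ψ.LFunction s)) g
    (C ^ 3 * q₁ ^ 2 * q ^ 2) β
    ((differentiable_LFunction h₁).mul ((differentiable_LFunction hχ).mul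
      (differentiable_LFunction hψ)))
    (fun n ↦ zetaMul_mul_nonneg hψn h₁2 hχ2 n)
    (isMultiplicative_zetaMul_mul χ₁ χ ψ).map_one
    (fun s hs ↦ ArithmeticFunction.LSeriesSummable_mul (χ₁.LSeriesSummable_zetaMul hs) (hsum s hs))
    (fun s hs ↦ by
      rw [ArithmeticFunction.LSeries_mul' (χ₁.LSeriesSummable_zetaMul hs) (hsum s hs),
        ArithmeticFunction.LSeries_mul' (χ.LSeriesSummable_toArithmeticFunction hs)
          (ψ.LSeriesSummable_toArithmeticFunction hs), LSeries_zetaMul _ hs,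
        LSeries_toArithmeticFunction _ hs, LSeries_toArithmeticFunction _ hs, mul_assoc])
    hB1
    (fun s hs ↦ by
      have e1 := hC q₁ χ₁ h₁ s hs
      have e2 := hC q χ hχ s hs
      have e3 := hC (q₁ * q) ψ hψ s hs
      rw [norm_mul, norm_mul]
      calc _ ≤ C * q₁ * (C * q * (C * (q₁ * q : ℕ))) := by gcongr
        _ = _ := by push_cast; ring)
    (by linarith) hβ1 (by simp [hz])
  rw [← hx, Real.mul_rpow (by positivity) (by positivity)] at h
  have hψ1 := norm_LFunction_one_le hψ hε'0 (min_le_right _ _)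
  have hup : (χ₁.LFunction 1 * (χ.LFunction 1 * ψ.LFunction 1)).re
      ≤ ‖χ₁.LFunction 1‖ * (‖χ.LFunction 1‖ * ((q₁ : ℝ) ^ ε' * (q : ℝ) ^ ε' * T)) := by
    refine (le_abs_self _).trans ((Complex.abs_re_le_norm _).trans ?_)
    rw [norm_mul, norm_mul]
    gcongr
    rw [← Real.mul_rpow (by positivity) (by positivity)]
    simpa using hψ1
  have hq2 : (q : ℝ) ^ (-(ε / 2)) ≤ ((q : ℝ) ^ 2) ^ (-4 * x) := by
    rw [← Real.rpow_natCast, ← Real.rpow_mul (by positivity)]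
    exact Real.rpow_le_rpow_of_exponent_le hq (by push_cast; linarith)
  have hqε : (q : ℝ) ^ (-(ε / 2)) ≤ (q : ℝ) ^ (-ε') :=
    Real.rpow_le_rpow_of_exponent_le hq (neg_le_neg (min_le_left _ _))
  have hqpos : (0 : ℝ) < (q : ℝ) ^ ε' := by positivity
  have main : c₂ * ((q : ℝ) ^ 2) ^ (-4 * x) * (q : ℝ) ^ (-ε') ≤ ‖χ.LFunction 1‖ := by
    have := h.trans hup
    rw [hc₂, Real.rpow_neg (by positivity), div_mul_eq_mul_div, ← div_eq_mul_inv, div_div,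
      div_le_iff₀ (by positivity)]
    refine le_trans (le_of_eq ?_) (this.trans (le_of_eq ?_)) <;> ring
  calc min c₁ c₂ * (q : ℝ) ^ (-ε) ≤ c₂ * (q : ℝ) ^ (-ε) := by
        gcongr
        exact min_le_right _ _
    _ = c₂ * (q : ℝ) ^ (-(ε / 2)) * (q : ℝ) ^ (-(ε / 2)) := by
        rw [mul_assoc, ← Real.rpow_add (by linarith)]; ring_nf
    _ ≤ c₂ * ((q : ℝ) ^ 2) ^ (-4 * x) * (q : ℝ) ^ (-ε') := by
        have : 0 < c₂ := by positivity
        gcongr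
    _ ≤ _ := main

end Siegel
end DirichletCharacter

/-! ### Sums with a logarithmic Gaussian weight -/

/-- The weight `exp (-(log n) ^ 2 / (2 T))`.  With `T = log x` a sum of `a(n)` against it is
concentrated near `n = x`. -/
noncomputable def gaussWeight (T : ℝ) (n : ℕ) : ℝ := Real.exp (-(Real.log n) ^ 2 / (2 * T))

theorem gaussWeight_pos (T : ℝ) (n : ℕ) : 0 < gaussWeight T n := Real.exp_pos _

theorem gaussWeight_le {T : ℝ} (hT : 0 < T) (σ : ℝ) {n : ℕ} (hn : n ≠ 0) :
    gaussWeight T n ≤ Real.exp (T * σ ^ 2 / 2) * (n : ℝ) ^ (-σ) := by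
  have hn0 : (0 : ℝ) < n := by exact_mod_cast Nat.pos_of_ne_zero hn
  rw [gaussWeight, Real.rpow_def_of_pos hn0, ← Real.exp_add, Real.exp_le_exp,
    div_le_iff₀ (by positivity)]
  nlinarith [sq_nonneg (Real.log n - T * σ)]

theorem summable_mul_gaussWeight {a : ℕ → ℂ} {c T : ℝ} (hT : 0 < T) (ha0 : a 0 = 0)
    (hsum : LSeriesSummable a c) : Summable fun n ↦ a n * gaussWeight T n := by
  refine Summable.of_norm_bounded (hsum.norm.mul_left (Real.exp (T * c ^ 2 / 2))) fun n ↦ ?_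
  rcases eq_or_ne n 0 with rfl | hn
  · simp [ha0]
  · rw [norm_mul, Complex.norm_real, Real.norm_of_nonneg (gaussWeight_pos T n).le,
      LSeries.norm_term_eq, if_neg hn, Complex.ofReal_re]
    have := mul_le_mul_of_nonneg_left (gaussWeight_le hT c hn) (norm_nonneg (a n))
    rw [Real.rpow_neg n.cast_nonneg] at this
    refine this.trans (le_of_eq ?_)
    ring

theorem norm_cexp_half_mul_sq (T σ t : ℝ) :
    ‖Complex.exp (T / 2 * (σ + t * Complex.I) ^ 2)‖ = Real.exp (T / 2 * (σ ^ 2 - t ^ 2)) := by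
  rw [Complex.norm_exp]
  congr 1
  rw [show (T / 2 * (σ + t * Complex.I) ^ 2 : ℂ)
      = ((T / 2 * (σ ^ 2 - t ^ 2) : ℝ) : ℂ) + ((T * σ * t : ℝ) : ℂ) * Complex.I by
    push_cast; linear_combination (T / 2 * t ^ 2 : ℂ) * Complex.I_sq,
    Complex.add_re, Complex.ofReal_re, Complex.re_ofReal_mul, Complex.I_re, mul_zero, add_zero]

theorem integrable_exp_half_mul_sq_sub {T : ℝ} (hT : 0 < T) (c : ℝ) :
    MeasureTheory.Integrable fun t : ℝ ↦ Real.exp (T / 2 * (c ^ 2 - t ^ 2)) := by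
  refine ((integrable_exp_neg_mul_sq (half_pos hT)).const_mul
    (Real.exp (T / 2 * c ^ 2))).congr (.of_forall fun t ↦ ?_)
  simp only
  rw [← Real.exp_add]
  ring_nf

/-- The Gaussian is its own Fourier transform: the weighted sum is the integral of the Dirichlet
series against `exp (T s ^ 2 / 2)` over a vertical line. -/
theorem integral_LSeries_mul_cexp {a : ℕ → ℂ} {c T : ℝ} (hT : 0 < T) (ha0 : a 0 = 0)
    (hsum : LSeriesSummable a c) :
    ∫ t : ℝ, LSeries a (c + t * Complex.I) * Complex.exp (T / 2 * (c + t * Complex.I) ^ 2)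
      = (Real.pi / (T / 2) : ℂ) ^ (1 / 2 : ℂ) * ∑' n, a n * gaussWeight T n := by
  have hterm (n : ℕ) (t : ℝ) : LSeries.term a (c + t * Complex.I) n
      * Complex.exp (T / 2 * (c + t * Complex.I) ^ 2)
      = a n * Complex.exp (-(T / 2 : ℂ) * (t : ℂ) ^ 2 + Complex.I * (T * c - Real.log n) * t
        + (T / 2 * c ^ 2 - c * Real.log n)) := by
    rcases eq_or_ne n 0 with rfl | hn
    · simp [ha0]
    · have hnC : (n : ℂ) ≠ 0 := by exact_mod_cast hn
      rw [LSeries.term_of_ne_zero hn, div_eq_mul_inv, ← Complex.cpow_neg,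
        Complex.cpow_def_of_ne_zero hnC, mul_assoc, ← Complex.exp_add, ← Complex.natCast_log]
      congr 2
      linear_combination (T / 2 * t ^ 2 : ℂ) * Complex.I_sq
  have hnorm (n : ℕ) (t : ℝ) : ‖LSeries.term a (c + t * Complex.I) n
      * Complex.exp (T / 2 * (c + t * Complex.I) ^ 2)‖
      = ‖LSeries.term a c n‖ * Real.exp (T / 2 * (c ^ 2 - t ^ 2)) := by
    rw [norm_mul, norm_cexp_half_mul_sq, LSeries.norm_term_eq, LSeries.norm_term_eq]
    simp
  have hint (n : ℕ) : MeasureTheory.Integrable fun t : ℝ ↦ LSeries.term a (c + t * Complex.I) n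
      * Complex.exp (T / 2 * (c + t * Complex.I) ^ 2) := by
    simp_rw [hterm]
    refine (integrable_cexp_quadratic (b := (T / 2 : ℂ)) ?_ _ _).const_mul _
    simpa using hT
  have hval (n : ℕ) : ∫ t : ℝ, LSeries.term a (c + t * Complex.I) n
      * Complex.exp (T / 2 * (c + t * Complex.I) ^ 2)
      = (Real.pi / (T / 2) : ℂ) ^ (1 / 2 : ℂ) * (a n * gaussWeight T n) := by
    have hT' : (T : ℂ) ≠ 0 := by exact_mod_cast hT.ne'
    simp_rw [hterm]
    rw [MeasureTheory.integral_const_mul, integral_cexp_quadratic (by simpa using hT), neg_neg,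
      gaussWeight, Complex.ofReal_exp]
    rw [show (T / 2 * c ^ 2 - c * Real.log n - (Complex.I * (T * c - Real.log n)) ^ 2
        / (4 * -(T / 2)) : ℂ) = ((-(Real.log n) ^ 2 / (2 * T) : ℝ) : ℂ) by
      push_cast
      rw [mul_pow, Complex.I_sq]
      field_simp
      ring]
    ring
  have h := MeasureTheory.hasSum_integral_of_summable_integral_norm hint (by
    simp_rw [hnorm, MeasureTheory.integral_const_mul]
    exact hsum.norm.mul_right _)
  simp_rw [hval] at h
  rw [← tsum_mul_left, h.tsum_eq]
  refine MeasureTheory.integral_congr_ae (.of_forall fun t ↦ ?_)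
  simp only [LSeries]
  rw [tsum_mul_right]

theorem norm_pi_div_half_cpow {T : ℝ} (hT : 0 < T) :
    ‖(Real.pi / (T / 2) : ℂ) ^ (1 / 2 : ℂ)‖ = √(Real.pi / (T / 2)) := by
  have h : 0 < Real.pi / (T / 2) := by positivity
  rw [show (Real.pi / (T / 2) : ℂ) = ((Real.pi / (T / 2) : ℝ) : ℂ) by push_cast; rfl,
    Complex.norm_cpow_eq_rpow_re_of_pos h, Real.sqrt_eq_rpow]
  norm_num

/-- Shifting the part `|t| ≤ 1` of the line `Re s = c` to `Re s = α` bounds the integral over the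
line by the size of `G` on the three other sides of the rectangle; the rest of the line is
negligible because of the Gaussian factor. -/
theorem norm_integral_mul_cexp_le {G : ℂ → ℂ} (hG : Differentiable ℂ G) {α c T K : ℝ}
    (hα : 0 < α) (hαc : α ≤ c) (hT : 1 ≤ T)
    (hline : ∀ t : ℝ, ‖G (c + t * Complex.I)‖ ≤ K)
    (hleft : ∀ t : ℝ, |t| ≤ 1 → ‖G (α + t * Complex.I)‖ ≤ K)
    (hhor : ∀ σ t : ℝ, α ≤ σ → σ ≤ c → |t| = 1 → ‖G (σ + t * Complex.I)‖ ≤ K) :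
    ‖∫ t : ℝ, G (c + t * Complex.I) * Complex.exp (T / 2 * (c + t * Complex.I) ^ 2)‖
      ≤ K * (2 * Real.exp (T / 2 * α ^ 2)
        + (2 * (c - α) + Real.exp (1 / 2) * √(Real.pi / (1 / 2))) *
          Real.exp (T / 2 * (c ^ 2 - 1))) := by
  have hK : 0 ≤ K := (norm_nonneg _).trans (hline 0)
  have hT0 : 0 < T := by linarith
  set E : ℂ → ℂ := fun s ↦ G s * Complex.exp (T / 2 * s ^ 2) with hE
  have hEd : Differentiable ℂ E := by fun_prop
  have hEc (σ : ℝ) : Continuous fun t : ℝ ↦ E (σ + t * Complex.I) :=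
    hEd.continuous.comp (by fun_prop)
  have hEn (σ t : ℝ) (h : ‖G (σ + t * Complex.I)‖ ≤ K) :
      ‖E (σ + t * Complex.I)‖ ≤ K * Real.exp (T / 2 * (σ ^ 2 - t ^ 2)) := by
    rw [hE]
    simp only
    rw [norm_mul, norm_cexp_half_mul_sq]
    gcongr
  have hint : MeasureTheory.Integrable fun t : ℝ ↦ E (c + t * Complex.I) :=
    ((integrable_exp_half_mul_sq_sub hT0 c).const_mul K).mono' (hEc c).aestronglyMeasurable
      (.of_forall fun t ↦ hEn c t (hline t))
  have hrect := Complex.integral_boundary_rect_eq_zero_of_differentiableOn E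
    (α + (-1 : ℝ) * Complex.I) (c + (1 : ℝ) * Complex.I) hEd.differentiableOn
  simp only [Complex.add_re, Complex.ofReal_re, Complex.mul_re, Complex.I_re, mul_zero,
    Complex.ofReal_im, Complex.I_im, mul_one, sub_self, add_zero, Complex.add_im, Complex.mul_im,
    zero_add] at hrect
  set I₁ := ∫ x : ℝ in α..c, E (x + ((-1 : ℝ) : ℂ) * Complex.I)
  set I₂ := ∫ x : ℝ in α..c, E (x + ((1 : ℝ) : ℂ) * Complex.I)
  set I₃ := ∫ y : ℝ in (-1 : ℝ)..1, E (c + y * Complex.I) with hI₃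
  set I₄ := ∫ y : ℝ in (-1 : ℝ)..1, E (α + y * Complex.I)
  have hside (t : ℝ) (ht : |t| = 1) : ‖∫ x : ℝ in α..c, E (x + (t : ℂ) * Complex.I)‖
      ≤ K * Real.exp (T / 2 * (c ^ 2 - 1)) * (c - α) := by
    rw [← abs_of_nonneg (sub_nonneg.mpr hαc)]
    refine intervalIntegral.norm_integral_le_of_norm_le_const fun x hx ↦ ?_
    rw [Set.uIoc_of_le hαc] at hx
    refine (hEn x t (hhor x t hx.1.le hx.2 ht)).trans ?_
    have ht2 : t ^ 2 = 1 := by rw [← sq_abs, ht, one_pow]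
    have hx0 : 0 ≤ x := (hα.trans hx.1).le
    rw [ht2]
    gcongr
    exact hx.2
  have h4 : ‖I₄‖ ≤ K * Real.exp (T / 2 * α ^ 2) * 2 := by
    have : (2 : ℝ) = |1 - (-1)| := by norm_num
    rw [this]
    refine intervalIntegral.norm_integral_le_of_norm_le_const fun t ht ↦ ?_
    rw [Set.uIoc_of_le (by norm_num)] at ht
    refine (hEn α t (hleft t (abs_le.mpr ⟨ht.1.le, ht.2⟩))).trans ?_
    rw [← this]
    gcongr
    nlinarith [sq_nonneg t]
  have h3 : ‖I₃‖ ≤ ‖I₁‖ + ‖I₂‖ + ‖I₄‖ := by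
    have : Complex.I • I₃ = I₂ - I₁ + Complex.I • I₄ := by linear_combination hrect
    have h := congrArg norm this
    rw [norm_smul, Complex.norm_I, one_mul] at h
    rw [h]
    refine (norm_add_le _ _).trans ?_
    rw [norm_smul, Complex.norm_I, one_mul]
    gcongr
    refine (norm_sub_le _ _).trans (le_of_eq (add_comm _ _))
  have htail : ‖∫ t : ℝ in (Set.Ioc (-1) 1)ᶜ, E (c + t * Complex.I)‖
      ≤ K * (Real.exp (1 / 2) * √(Real.pi / (1 / 2))) * Real.exp (T / 2 * (c ^ 2 - 1)) := by
    have hg : MeasureTheory.Integrable fun t : ℝ ↦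
        K * Real.exp (1 / 2) * Real.exp (T / 2 * (c ^ 2 - 1)) * Real.exp (-(1 / 2) * t ^ 2) :=
      (integrable_exp_neg_mul_sq (by norm_num)).const_mul _
    refine (MeasureTheory.norm_integral_le_of_norm_le hg.integrableOn
      ((MeasureTheory.ae_restrict_iff' measurableSet_Ioc.compl).mpr
        (.of_forall fun t ht ↦ ?_))).trans
      ((MeasureTheory.setIntegral_le_integral hg (.of_forall fun t ↦ by positivity)).trans
        (le_of_eq ?_))
    · refine (hEn c t (hline t)).trans ?_
      rw [mul_assoc, mul_assoc, ← Real.exp_add, ← Real.exp_add]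
      gcongr
      have ht1 : 1 ≤ t ^ 2 := by
        rw [Set.mem_compl_iff, Set.mem_Ioc, not_and_or, not_lt, not_le] at ht
        rcases ht with h | h <;> nlinarith
      nlinarith
    · rw [MeasureTheory.integral_const_mul, integral_gaussian]
      ring
  rw [← MeasureTheory.integral_add_compl (measurableSet_Ioc (a := (-1 : ℝ)) (b := 1)) hint]
  refine (norm_add_le _ _).trans ?_
  rw [← intervalIntegral.integral_of_le (by norm_num), ← hI₃]
  have e1 := hside (-1) (by simp)
  have e2 := hside 1 (by simp)
  calc _ ≤ (K * Real.exp (T / 2 * (c ^ 2 - 1)) * (c - α)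
        + K * Real.exp (T / 2 * (c ^ 2 - 1)) * (c - α) + K * Real.exp (T / 2 * α ^ 2) * 2)
        + K * (Real.exp (1 / 2) * √(Real.pi / (1 / 2))) * Real.exp (T / 2 * (c ^ 2 - 1)) := by
        refine add_le_add (h3.trans ?_) htail
        gcongr
    _ = _ := by ring

theorem norm_LSeries_le_tsum {a : ℕ → ℂ} (ha : ∀ n, ‖a n‖ ≤ 1) {c : ℝ} (hc : 1 < c) (t : ℝ) :
    ‖LSeries a (c + t * Complex.I)‖ ≤ ∑' n, ‖LSeries.term 1 c n‖ := by
  have hs : LSeriesSummable 1 (c : ℂ) := LSeriesSummable_one_iff.mpr (by simpa using hc)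
  refine tsum_of_norm_bounded hs.norm.hasSum fun n ↦ ?_
  rw [LSeries.norm_term_eq, LSeries.norm_term_eq]
  simp only [Complex.add_re, Complex.ofReal_re, Complex.mul_re, Complex.I_re, mul_zero,
    Complex.ofReal_im, Complex.I_im, mul_one, sub_self, add_zero, Pi.one_apply, norm_one]
  split_ifs
  · exact le_rfl
  · gcongr
    exact ha n

open ArithmeticFunction in
/-- Here `ζ(s) (L(s, χ) - L(1, χ))` is entire, so that no residue appears; it is estimated by
`norm_integral_mul_cexp_le` with the hypothesis on `L(s, χ)` in `Re s ≥ 1 - θ`, `|Im s| ≤ 1`. -/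
theorem exists_norm_tsum_zetaMul_sub_le {θ : ℝ} (hθ : θ ∈ Set.Ioo (0 : ℝ) (1 / 2)) :
    ∃ C : ℝ, 0 < C ∧ ∀ (q : ℕ) [NeZero q] (χ : DirichletCharacter ℂ q) (H T : ℝ), χ ≠ 1 → 1 ≤ T →
      (∀ σ t : ℝ, 1 - θ ≤ σ → |t| ≤ 1 → ‖χ.LFunction (σ + t * Complex.I)‖ ≤ H) →
      ‖∑' n, χ.zetaMul n * gaussWeight T n
          - χ.LFunction 1 * ∑' n, (zeta n : ℂ) * gaussWeight T n‖
        ≤ C * √T * (1 + H) * Real.exp (T / 2 * (1 - θ) ^ 2) := by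
  obtain ⟨hθ0, hθ2⟩ := hθ
  obtain ⟨c, hc⟩ : ∃ c : ℝ, c = 11 / 10 := ⟨_, rfl⟩
  set α : ℝ := 1 - θ with hα
  set Z₁ : ℝ := ∑' n, ‖LSeries.term 1 (c : ℂ) n‖ with hZ₁
  have hZ₁0 : 0 ≤ Z₁ := tsum_nonneg fun _ ↦ norm_nonneg _
  -- a compact set that contains three sides of the rectangle and avoids the pole of `ζ`
  set S : Set ℂ := (Set.Icc α c ×ℂ Set.Icc (-1) 1) ∩ {s | θ ≤ ‖s - 1‖} with hS
  have hScomp : IsCompact S := (isCompact_Icc.reProdIm isCompact_Icc).inter_right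
    (isClosed_le continuous_const (by fun_prop))
  obtain ⟨Z₂, hZ₂⟩ := hScomp.exists_bound_of_continuousOn (f := riemannZeta)
    (differentiableOn_riemannZeta.continuousOn.mono fun s hs h1 ↦ by
      have h2 : θ ≤ ‖s - 1‖ := hs.2
      rw [Set.mem_singleton_iff.mp h1, sub_self, norm_zero] at h2
      linarith)
  have hZ₂' (s : ℂ) (hs : s ∈ S) : ‖riemannZeta s‖ ≤ |Z₂| := (hZ₂ s hs).trans (le_abs_self _)
  set Z := Z₁ + |Z₂| with hZ
  have hZ0 : 0 ≤ Z := by positivity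
  set V : ℝ := 2 + (2 * (c - α) + Real.exp (1 / 2) * √(Real.pi / (1 / 2))) with hV
  have hV0 : 0 < V := by
    have : 0 ≤ c - α := by linarith
    positivity
  refine ⟨(Z + 1) * (2 + Z) * V, by positivity, fun q _ χ H T hχ hT hbd ↦ ?_⟩
  have hT0 : 0 < T := by linarith
  have hH1 : ‖χ.LFunction 1‖ ≤ H := by simpa using hbd 1 0 (by linarith) (by simp)
  have hH0 : 0 ≤ H := (norm_nonneg _).trans hH1
  set f := χ.LFunction with hf
  have hfd : Differentiable ℂ f := DirichletCharacter.differentiable_LFunction hχ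
  set G : ℂ → ℂ := fun s ↦ riemannZeta₁ s * dslope f 1 s with hG
  have hdsl : Differentiable ℂ (dslope f 1) := by
    rw [← differentiableOn_univ, Complex.differentiableOn_dslope Filter.univ_mem]
    exact hfd.differentiableOn
  have hGd : Differentiable ℂ G := differentiable_riemannZeta₁.mul hdsl
  have hGne (s : ℂ) (hs : s ≠ 1) : G s = riemannZeta s * (f s - f 1) := by
    simp only [hG, riemannZeta_eq_inv_sub_mul hs, dslope_of_ne f hs, slope_def_field]
    ring
  have hc1 (t : ℝ) : 1 < ((c : ℂ) + t * Complex.I).re := by simp [hc]; norm_num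
  have hcsum : LSeriesSummable χ.zetaMul (c : ℂ) :=
    χ.LSeriesSummable_zetaMul (by rw [Complex.ofReal_re]; norm_num [hc])
  have hcsum' : LSeriesSummable (fun n ↦ (zeta n : ℂ)) (c : ℂ) :=
    LSeriesSummable_zeta_iff.mpr (by rw [Complex.ofReal_re]; norm_num [hc])
  set b : ℕ → ℂ := χ.zetaMul - f 1 • fun n ↦ (zeta n : ℂ) with hb
  have hbL (t : ℝ) : LSeries b (c + t * Complex.I) = G (c + t * Complex.I) := by
    have hne : (c : ℂ) + t * Complex.I ≠ 1 := by
      intro h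
      have := hc1 t
      rw [h] at this
      simp at this
    have hs1 := χ.LSeriesSummable_zetaMul (hc1 t)
    have hs2 : LSeriesSummable (fun n ↦ (zeta n : ℂ)) (c + t * Complex.I) :=
      LSeriesSummable_zeta_iff.mpr (hc1 t)
    rw [hb, LSeries_sub hs1 (hs2.smul _), LSeries_smul, χ.LSeries_zetaMul (hc1 t),
      LSeries_zeta_eq_riemannZeta (hc1 t), hGne _ hne]
    ring
  have hbsum : LSeriesSummable b (c : ℂ) := hcsum.sub (hcsum'.smul _)
  have hint := integral_LSeries_mul_cexp hT0 (a := b) (by simp [hb]) hbsum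
  simp_rw [hbL] at hint
  have hζline (t : ℝ) : ‖riemannZeta (c + t * Complex.I)‖ ≤ Z₁ := by
    rw [← LSeries_one_eq_riemannZeta (hc1 t)]
    exact norm_LSeries_le_tsum (by simp) (by norm_num [hc]) t
  have hfline (t : ℝ) : ‖f (c + t * Complex.I)‖ ≤ Z₁ := by
    rw [hf, χ.LFunction_eq_LSeries (hc1 t)]
    exact norm_LSeries_le_tsum (fun n ↦ χ.norm_le_one _) (by norm_num [hc]) t
  have hside (σ t : ℝ) (h1 : α ≤ σ) (h2 : σ ≤ c) (h3 : |t| ≤ 1)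
      (h4 : θ ≤ ‖(σ + t * Complex.I : ℂ) - 1‖) :
      ‖G (σ + t * Complex.I)‖ ≤ Z * (2 + Z) * (1 + H) := by
    have hne : (σ + t * Complex.I : ℂ) ≠ 1 := by
      intro h
      rw [h, sub_self, norm_zero] at h4
      linarith
    have hmem : (σ + t * Complex.I : ℂ) ∈ S := by
      refine ⟨Complex.mem_reProdIm.mpr ⟨?_, ?_⟩, h4⟩
      · simpa using ⟨h1, h2⟩
      · simpa using abs_le.mp h3
    rw [hGne _ hne, norm_mul]
    have e1 := hZ₂' _ hmem
    have e2 := (norm_sub_le (f (σ + t * Complex.I)) (f 1)).trans (add_le_add (hbd σ t h1 h3) hH1)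
    calc _ ≤ |Z₂| * (H + H) := by gcongr
      _ ≤ Z * (2 + Z) * (1 + H) := by
        have : |Z₂| ≤ Z := by linarith
        nlinarith [mul_nonneg hZ0 hH0, mul_nonneg hZ0 hZ0, mul_nonneg (mul_nonneg hZ0 hZ0) hH0]
  have key := norm_integral_mul_cexp_le hGd (α := α) (c := c) (T := T) (K := Z * (2 + Z) * (1 + H))
    (by linarith) (by linarith) hT
    (fun t ↦ by
      have hne : (c + t * Complex.I : ℂ) ≠ 1 := by
        intro h
        have := hc1 t
        rw [h] at this
        simp at this
      rw [hGne _ hne, norm_mul]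
      have e2 := (norm_sub_le (f (c + t * Complex.I)) (f 1)).trans (add_le_add (hfline t) hH1)
      calc _ ≤ Z₁ * (Z₁ + H) := by
            have := hζline t
            gcongr
        _ ≤ Z * (2 + Z) * (1 + H) := by
          have : Z₁ ≤ Z := by linarith [abs_nonneg Z₂]
          have : Z₁ * (Z₁ + H) ≤ Z * (Z + H) := by gcongr
          nlinarith [mul_nonneg hZ0 hH0, mul_nonneg hZ0 hZ0, mul_nonneg (mul_nonneg hZ0 hZ0) hH0])
    (fun t ht ↦ hside α t le_rfl (by linarith) ht (by
      have := Complex.abs_re_le_norm ((α + t * Complex.I : ℂ) - 1)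
      simp only [Complex.sub_re, Complex.add_re, Complex.ofReal_re, Complex.mul_re, Complex.I_re,
        mul_zero, Complex.ofReal_im, Complex.I_im, mul_one, sub_self, add_zero,
        Complex.one_re] at this
      rw [show α - 1 = -θ by rw [hα]; ring, abs_neg, abs_of_pos hθ0] at this
      exact this))
    (fun σ t h1 h2 h3 ↦ hside σ t h1 h2 h3.le (by
      have := Complex.abs_im_le_norm ((σ + t * Complex.I : ℂ) - 1)
      simp only [Complex.sub_im, Complex.add_im, Complex.ofReal_re, Complex.mul_im, Complex.I_re,
        mul_zero, Complex.ofReal_im, Complex.I_im, mul_one, add_zero, zero_add,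
        Complex.one_im, sub_zero, h3] at this
      linarith))
  have hb_eq : ∑' n, b n * gaussWeight T n = ∑' n, χ.zetaMul n * gaussWeight T n
      - f 1 * ∑' n, (zeta n : ℂ) * gaussWeight T n := by
    rw [← tsum_mul_left, ← (summable_mul_gaussWeight hT0 (by simp) hcsum).tsum_sub
      ((summable_mul_gaussWeight hT0 (by simp) hcsum').mul_left _)]
    refine tsum_congr fun n ↦ ?_
    simp only [hb, Pi.sub_apply, Pi.smul_apply, smul_eq_mul]
    ring
  rw [← hb_eq]
  rw [hint, norm_mul, norm_pi_div_half_cpow hT0] at key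
  have hexp : Real.exp (T / 2 * (c ^ 2 - 1)) ≤ Real.exp (T / 2 * α ^ 2) := by
    apply Real.exp_le_exp.mpr
    gcongr
    nlinarith
  have key2 : √(Real.pi / (T / 2)) * ‖∑' n, b n * gaussWeight T n‖
      ≤ Z * (2 + Z) * (1 + H) * (V * Real.exp (T / 2 * α ^ 2)) := by
    refine key.trans ?_
    have : 0 ≤ 2 * (c - α) + Real.exp (1 / 2) * √(Real.pi / (1 / 2)) := by
      have : 0 ≤ c - α := by linarith
      positivity
    rw [hV, add_mul 2]
    gcongr
  have hsq : 1 ≤ √T * √(Real.pi / (T / 2)) := by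
    rw [← Real.sqrt_mul hT0.le, Real.one_le_sqrt]
    have : T * (Real.pi / (T / 2)) = 2 * Real.pi := by field_simp
    rw [this]
    linarith [Real.pi_gt_three]
  calc ‖∑' n, b n * gaussWeight T n‖
      ≤ √T * √(Real.pi / (T / 2)) * ‖∑' n, b n * gaussWeight T n‖ :=
        le_mul_of_one_le_left (norm_nonneg _) hsq
    _ = √T * (√(Real.pi / (T / 2)) * ‖∑' n, b n * gaussWeight T n‖) := by ring
    _ ≤ √T * (Z * (2 + Z) * (1 + H) * (V * Real.exp (T / 2 * α ^ 2))) := by gcongr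
    _ ≤ √T * ((Z + 1) * (2 + Z) * (1 + H) * (V * Real.exp (T / 2 * α ^ 2))) := by
        gcongr
        linarith
    _ = _ := by ring

open ArithmeticFunction in
/-- The integers in `[1, x]` alone contribute `≫ x ^ (1 / 2)`, where `x = e ^ T`. -/
theorem half_exp_le_tsum_gaussWeight {T : ℝ} (hT : 0 < T) :
    Real.exp (T / 2) / 2 ≤ ‖∑' n, (zeta n : ℂ) * gaussWeight T n‖ := by
  have hsum : Summable fun n ↦ (zeta n : ℝ) * gaussWeight T n := by
    have h := summable_mul_gaussWeight (a := fun n ↦ (zeta n : ℂ)) (c := 2) hT (by simp)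
      (LSeriesSummable_zeta_iff.mpr (by simp))
    exact_mod_cast h
  have hcast : ∑' n, (zeta n : ℂ) * gaussWeight T n
      = ((∑' n, (zeta n : ℝ) * gaussWeight T n : ℝ) : ℂ) := by
    push_cast; rfl
  have hnn (n : ℕ) : 0 ≤ (zeta n : ℝ) * gaussWeight T n :=
    mul_nonneg (Nat.cast_nonneg _) (gaussWeight_pos T n).le
  rw [hcast, Complex.norm_real, Real.norm_of_nonneg (tsum_nonneg hnn)]
  set N : ℕ := ⌊Real.exp T⌋₊ with hN
  have hx1 : 1 ≤ Real.exp T := Real.one_le_exp hT.le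
  have hN1 : 1 ≤ N := Nat.le_floor (by simpa using hx1)
  have hNx : (N : ℝ) ≤ Real.exp T := Nat.floor_le (Real.exp_pos T).le
  have hNlow : Real.exp T / 2 ≤ N := by
    have h1 := Nat.lt_floor_add_one (Real.exp T)
    have h2 : (1 : ℝ) ≤ N := by exact_mod_cast hN1
    linarith
  have hw (n : ℕ) (hn : n ∈ Finset.Icc 1 N) :
      Real.exp (-(T / 2)) ≤ (zeta n : ℝ) * gaussWeight T n := by
    obtain ⟨h1, h2⟩ := Finset.mem_Icc.mp hn
    rw [zeta_apply, if_neg (by lia), Nat.cast_one, one_mul, gaussWeight, Real.exp_le_exp,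
      le_div_iff₀ (by positivity)]
    have h0 : 0 ≤ Real.log n := Real.log_natCast_nonneg n
    have hle : Real.log n ≤ T := by
      rw [Real.log_le_iff_le_exp (by exact_mod_cast h1)]
      exact le_trans (by exact_mod_cast h2) hNx
    nlinarith
  calc Real.exp (T / 2) / 2 = Real.exp T / 2 * Real.exp (-(T / 2)) := by
        rw [div_mul_eq_mul_div, ← Real.exp_add]; ring_nf
    _ ≤ N * Real.exp (-(T / 2)) := by gcongr
    _ = ∑ _n ∈ Finset.Icc 1 N, Real.exp (-(T / 2)) := by simp
    _ ≤ ∑ n ∈ Finset.Icc 1 N, (zeta n : ℝ) * gaussWeight T n := Finset.sum_le_sum hw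
    _ ≤ _ := hsum.sum_le_tsum _ fun n _ ↦ hnn n

/-! ### Counting ideals of given norm -/

section IdealCount

open Ideal

variable (K : Type*) [Field K] [NumberField K]

/-- The number of integral ideals of norm `n`. -/
noncomputable def idealCount (n : ℕ) : ℕ := Nat.card {I : Ideal (𝓞 K) // absNorm I = n}

variable {K}

theorem span_natCast_sup_span_natCast_eq_top {R : Type*} [CommRing R] {m n : ℕ} (h : m.Coprime n) :
    span {(m : R)} ⊔ span {(n : R)} = ⊤ := by
  have hc : IsCoprime (m : R) n := by exact_mod_cast (Nat.isCoprime_iff_coprime.mpr h).intCast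
  rw [← isCoprime_iff_sup_eq, isCoprime_span_singleton_iff]
  exact hc

theorem mul_sup_span_eq_left {I J : Ideal (𝓞 K)} {m n : ℕ} (hmn : m.Coprime n)
    (hI : absNorm I = m) (hJ : absNorm J = n) : I * J ⊔ span {(m : 𝓞 K)} = I := by
  have hmI : span {(m : 𝓞 K)} ≤ I := by rw [← hI]; exact span_singleton_absNorm_le I
  have hnJ : span {(n : 𝓞 K)} ≤ J := by rw [← hJ]; exact span_singleton_absNorm_le J
  refine le_antisymm (sup_le Ideal.mul_le_left hmI) ?_
  have htop : J ⊔ span {(m : 𝓞 K)} = ⊤ := by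
    rw [eq_top_iff, ← span_natCast_sup_span_natCast_eq_top (R := 𝓞 K) hmn]
    exact sup_le le_sup_right (hnJ.trans le_sup_left)
  calc I = I * (J ⊔ span {(m : 𝓞 K)}) := by rw [htop, mul_top]
    _ = I * J ⊔ I * span {(m : 𝓞 K)} := Ideal.mul_sup _ _ _
    _ ≤ _ := sup_le_sup_left Ideal.mul_le_right _

theorem sup_span_mul_sup_span {I : Ideal (𝓞 K)} {m n : ℕ} (hmn : m.Coprime n)
    (hI : absNorm I = m * n) : (I ⊔ span {(m : 𝓞 K)}) * (I ⊔ span {(n : 𝓞 K)}) = I := by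
  refine le_antisymm ?_ ?_
  · rw [Ideal.sup_mul, Ideal.mul_sup, Ideal.mul_sup, span_singleton_mul_span_singleton]
    refine sup_le (sup_le Ideal.mul_le_right Ideal.mul_le_left) (sup_le Ideal.mul_le_right ?_)
    rw [span_singleton_le_iff_mem]
    have := absNorm_mem I
    rwa [hI, Nat.cast_mul] at this
  · calc I = I * (span {(m : 𝓞 K)} ⊔ span {(n : 𝓞 K)}) := by
          rw [span_natCast_sup_span_natCast_eq_top hmn, mul_top]
      _ = span {(m : 𝓞 K)} * I ⊔ I * span {(n : 𝓞 K)} := by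
          rw [Ideal.mul_sup, mul_comm I (span {(m : 𝓞 K)})]
      _ ≤ _ := sup_le (mul_mono le_sup_right le_sup_left) (mul_mono le_sup_left le_sup_right)

theorem absNorm_sup_span_coprime (I : Ideal (𝓞 K)) {m n : ℕ} (hmn : m.Coprime n) :
    (absNorm (I ⊔ span {(m : 𝓞 K)})).Coprime n := by
  refine Nat.Coprime.coprime_dvd_left
    (absNorm_dvd_absNorm_of_le (le_sup_right (a := I) (b := span {(m : 𝓞 K)}))) ?_
  rw [absNorm_span_natCast]
  exact hmn.pow_left _

/-- Multiplication of ideals of coprime norms `m` and `n`; the factors are recovered as `I + (m)`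
and `I + (n)`. -/
theorem idealCount_mul {m n : ℕ} (hm : m ≠ 0) (hn : n ≠ 0) (hmn : m.Coprime n) :
    idealCount K (m * n) = idealCount K m * idealCount K n := by
  rw [idealCount, idealCount, idealCount, ← Nat.card_prod]
  refine (Nat.card_congr (Equiv.ofBijective (fun x : {I : Ideal (𝓞 K) // absNorm I = m} ×
    {I : Ideal (𝓞 K) // absNorm I = n} ↦ (⟨x.1.1 * x.2.1, by rw [map_mul, x.1.2, x.2.2]⟩ :
      {I : Ideal (𝓞 K) // absNorm I = m * n})) ⟨?_, ?_⟩)).symm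
  · rintro ⟨⟨I, hI⟩, ⟨J, hJ⟩⟩ ⟨⟨I', hI'⟩, ⟨J', hJ'⟩⟩ h
    have h' : I * J = I' * J' := Subtype.ext_iff.mp h
    have e1 : I = I' := by
      rw [← mul_sup_span_eq_left hmn hI hJ, h', mul_sup_span_eq_left hmn hI' hJ']
    have e2 : J = J' := by
      rw [← mul_sup_span_eq_left hmn.symm hJ hI, mul_comm J I, h', mul_comm I' J',
        mul_sup_span_eq_left hmn.symm hJ' hI']
    subst e1 e2
    rfl
  · rintro ⟨I, hI⟩
    have hmul := sup_span_mul_sup_span hmn hI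
    have hN : absNorm (I ⊔ span {(m : 𝓞 K)}) * absNorm (I ⊔ span {(n : 𝓞 K)}) = m * n := by
      rw [← map_mul, hmul, hI]
    have d1 : absNorm (I ⊔ span {(m : 𝓞 K)}) ∣ m :=
      (absNorm_sup_span_coprime I hmn).dvd_of_dvd_mul_right (Dvd.intro _ hN)
    have d2 : absNorm (I ⊔ span {(n : 𝓞 K)}) ∣ n :=
      (absNorm_sup_span_coprime I hmn.symm).dvd_of_dvd_mul_left (Dvd.intro_left _ hN)
    have l1 := Nat.le_of_dvd (Nat.pos_of_ne_zero hm) d1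
    have l2 := Nat.le_of_dvd (Nat.pos_of_ne_zero hn) d2
    have e1 : absNorm (I ⊔ span {(m : 𝓞 K)}) = m := by
      refine le_antisymm l1 (Nat.le_of_mul_le_mul_right ?_ (Nat.pos_of_ne_zero hn))
      rw [← hN]
      exact Nat.mul_le_mul_left _ l2
    have e2 : absNorm (I ⊔ span {(n : 𝓞 K)}) = n := by
      refine le_antisymm l2 (Nat.le_of_mul_le_mul_left ?_ (Nat.pos_of_ne_zero hm))
      rw [← hN]
      exact Nat.mul_le_mul_right _ l1
    exact ⟨⟨⟨_, e1⟩, ⟨_, e2⟩⟩, Subtype.ext hmul⟩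

theorem idealCount_one : idealCount K 1 = 1 := by
  rw [idealCount, Nat.card_eq_one_iff_unique]
  refine ⟨⟨fun I J ↦ Subtype.ext ?_⟩, ⟨⟨⊤, absNorm_top⟩⟩⟩
  rw [absNorm_eq_one_iff.mp I.2, absNorm_eq_one_iff.mp J.2]

section Quadratic

variable (hK : Module.finrank ℚ K = 2)

include hK

theorem absNorm_span_natCast_of_quadratic (n : ℕ) : absNorm (span {(n : 𝓞 K)}) = n ^ 2 := by
  rw [absNorm_span_natCast, RingOfIntegers.rank, hK]

/-- Every ideal whose norm is divisible by `p` has a prime factor above `p`, and a prime ideal above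
`p` either has norm `p` or is `(p)`. -/
theorem exists_prime_dvd_of_quadratic {p : ℕ} (hp : p.Prime) {I : Ideal (𝓞 K)}
    (hI : p ∣ absNorm I) :
    ∃ P : Ideal (𝓞 K), P.IsPrime ∧ P ∣ I ∧ (absNorm P = p ∨ P = span {(p : 𝓞 K)}) := by
  obtain ⟨P, hPmax, hPu, hPI⟩ := exists_isMaximal_dvd_of_dvd_absNorm' hp I hI
  refine ⟨P, hPmax.isPrime, hPI, ?_⟩
  have hpP : (p : 𝓞 K) ∈ P := by
    have : (p : ℤ) ∈ P.under ℤ := by rw [hPu]; exact mem_span_singleton_self _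
    simpa [mem_comap] using this
  obtain ⟨Q, hQ⟩ := dvd_iff_le.mpr ((span_singleton_le_iff_mem P).mpr hpP)
  have hN : p ^ 2 = absNorm P * absNorm Q := by
    rw [← absNorm_span_natCast_of_quadratic hK, hQ, map_mul]
  obtain ⟨j, hj, hPj⟩ := (Nat.dvd_prime_pow hp).mp (Dvd.intro _ hN.symm)
  interval_cases j
  · exact absurd (absNorm_eq_one_iff.mp (by simpa using hPj)) hPmax.ne_top
  · exact .inl (by simpa using hPj)
  · right
    have hQ1 : absNorm Q = 1 := by
      rw [hPj] at hN
      exact Nat.eq_of_mul_eq_mul_left (pow_pos hp.pos 2) (by rw [← hN, mul_one])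
    rw [hQ, absNorm_eq_one_iff.mp hQ1, mul_top]

theorem exists_dvd_of_absNorm_eq_prime {p : ℕ} (hp : p.Prime) {P I : Ideal (𝓞 K)}
    (hP : absNorm P = p) (hI : p ∣ absNorm I) : ∃ Q : Ideal (𝓞 K), absNorm Q = p ∧ Q ∣ I := by
  obtain ⟨Q, hQ, hQI, h | h⟩ := exists_prime_dvd_of_quadratic hK hp hI
  · exact ⟨Q, h, hQI⟩
  · refine ⟨P, hP, dvd_trans ?_ hQI⟩
    rw [h, dvd_iff_le, ← hP]
    exact span_singleton_absNorm_le P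

theorem idealCount_prime_pow_of_inert {p : ℕ} (hp : p.Prime)
    (h : ∀ P : Ideal (𝓞 K), absNorm P ≠ p) (k : ℕ) :
    idealCount K (p ^ k) = if Even k then 1 else 0 := by
  have hsp : (span {(p : 𝓞 K)}) ≠ 0 := by
    rw [zero_eq_bot, Ne, span_singleton_eq_bot]
    exact_mod_cast hp.ne_zero
  induction k using Nat.strong_induction_on with
  | _ k ih =>
    match k with
    | 0 => simpa using idealCount_one
    | 1 =>
      rw [idealCount, pow_one, if_neg (by decide), Nat.card_eq_zero]
      exact .inl ⟨fun I ↦ h I.1 I.2⟩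
    | k + 2 =>
      have e : idealCount K (p ^ (k + 2)) = idealCount K (p ^ k) := by
        refine (Nat.card_congr (Equiv.ofBijective (fun J : {I : Ideal (𝓞 K) // absNorm I = p ^ k} ↦
          (⟨span {(p : 𝓞 K)} * J.1, by
            rw [map_mul, J.2, absNorm_span_natCast_of_quadratic hK]; ring⟩ :
            {I : Ideal (𝓞 K) // absNorm I = p ^ (k + 2)})) ⟨?_, ?_⟩)).symm
        · intro J J' hJ
          exact Subtype.ext (mul_left_cancel₀ hsp (Subtype.ext_iff.mp hJ))
        · rintro ⟨I, hI⟩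
          obtain ⟨Q, -, ⟨J, hJ⟩, h' | h'⟩ := exists_prime_dvd_of_quadratic hK hp
            (I := I) (by rw [hI]; exact dvd_pow_self p (by lia))
          · exact absurd h' (h Q)
          · refine ⟨⟨J, ?_⟩, Subtype.ext (by simp only [hJ, h'])⟩
            rw [hJ, h', map_mul, absNorm_span_natCast_of_quadratic hK, pow_add, mul_comm] at hI
            exact Nat.eq_of_mul_eq_mul_right (pow_pos hp.pos 2) hI
      rw [e, ih k (by lia)]
      simp [Nat.even_add]

/-- If `p` is not inert, the ideals of `p`-power norm are products of primes of norm `p`; the case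
`P₁ = P₂` is that of a ramified prime. -/
theorem eq_pow_mul_pow_of_absNorm {p : ℕ} (hp : p.Prime) {P₁ P₂ : Ideal (𝓞 K)}
    (h₁ : absNorm P₁ = p) (h : ∀ P : Ideal (𝓞 K), absNorm P = p → P = P₁ ∨ P = P₂) (k : ℕ)
    (I : Ideal (𝓞 K)) (hI : absNorm I = p ^ k) : ∃ i ≤ k, I = P₁ ^ i * P₂ ^ (k - i) := by
  induction k generalizing I with
  | zero => exact ⟨0, le_rfl, by simpa [absNorm_eq_one_iff] using hI⟩
  | succ k ih =>
    obtain ⟨Q, hQ, J, hJ⟩ := exists_dvd_of_absNorm_eq_prime hK hp h₁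
      (I := I) (by rw [hI]; exact dvd_pow_self p (by lia))
    have hJn : absNorm J = p ^ k := by
      rw [hJ, map_mul, hQ, pow_succ'] at hI
      exact Nat.eq_of_mul_eq_mul_left hp.pos hI
    obtain ⟨i, hi, hJi⟩ := ih J hJn
    rcases h Q hQ with rfl | rfl
    · refine ⟨i + 1, by lia, ?_⟩
      rw [hJ, hJi, Nat.add_sub_add_right]
      ring
    · refine ⟨i, by lia, ?_⟩
      rw [hJ, hJi, Nat.succ_sub hi, pow_succ]
      ring

theorem idealCount_prime_pow_of_ramified {p : ℕ} (hp : p.Prime) {P : Ideal (𝓞 K)}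
    (hP : absNorm P = p) (h : ∀ Q : Ideal (𝓞 K), absNorm Q = p → Q = P) (k : ℕ) :
    idealCount K (p ^ k) = 1 := by
  rw [idealCount, Nat.card_eq_one_iff_unique]
  refine ⟨⟨fun I J ↦ Subtype.ext ?_⟩, ⟨⟨P ^ k, by rw [map_pow, hP]⟩⟩⟩
  have key (I : Ideal (𝓞 K)) (hI : absNorm I = p ^ k) : I = P ^ k := by
    obtain ⟨i, hi, e⟩ := eq_pow_mul_pow_of_absNorm hK hp hP (P₂ := P)
      (fun Q hQ ↦ .inl (h Q hQ)) k I hI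
    rw [e, ← pow_add, Nat.add_sub_cancel' hi]
  rw [key I.1 I.2, key J.1 J.2]

theorem idealCount_prime_pow_of_split {p : ℕ} (hp : p.Prime) {P₁ P₂ : Ideal (𝓞 K)}
    (hne : P₁ ≠ P₂) (h₁ : absNorm P₁ = p) (h₂ : absNorm P₂ = p)
    (h : ∀ P : Ideal (𝓞 K), absNorm P = p → P = P₁ ∨ P = P₂) (k : ℕ) :
    idealCount K (p ^ k) = k + 1 := by
  have nz {P : Ideal (𝓞 K)} (hP : absNorm P = p) : P ≠ 0 := by
    rintro rfl
    rw [zero_eq_bot, absNorm_bot] at hP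
    exact hp.ne_zero hP.symm
  have hprime {P : Ideal (𝓞 K)} (hP : absNorm P = p) : Prime P :=
    prime_of_isPrime (nz hP) (isPrime_of_irreducible_absNorm (by rw [hP]; exact hp))
  -- `P₁ ∤ P₂ ^ j`
  have hnd (j : ℕ) : ¬ P₁ ∣ P₂ ^ j := fun hd ↦ hne <| associated_iff_eq.mp <|
    (hprime h₁).associated_of_dvd (hprime h₂) ((hprime h₁).dvd_of_dvd_pow hd)
  have aux {i j : ℕ} (hij : i < j) (hj : j ≤ k) :
      P₁ ^ i * P₂ ^ (k - i) ≠ P₁ ^ j * P₂ ^ (k - j) := by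
    intro e
    obtain ⟨d, rfl⟩ : ∃ d, j = i + (d + 1) := ⟨j - i - 1, by lia⟩
    rw [pow_add, mul_assoc] at e
    have := mul_left_cancel₀ (pow_ne_zero i (nz h₁)) e
    refine hnd (k - i) ?_
    rw [this, pow_succ', mul_assoc]
    exact dvd_mul_right _ _
  rw [idealCount, ← Nat.card_fin (k + 1)]
  refine (Nat.card_congr (Equiv.ofBijective (fun i : Fin (k + 1) ↦
    (⟨P₁ ^ (i : ℕ) * P₂ ^ (k - i), by
      rw [map_mul, map_pow, map_pow, h₁, h₂, ← pow_add, Nat.add_sub_cancel' (by lia)]⟩ :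
      {I : Ideal (𝓞 K) // absNorm I = p ^ k})) ⟨?_, ?_⟩)).symm
  · intro i j hij
    have hij' := Subtype.ext_iff.mp hij
    rcases lt_trichotomy (i : ℕ) j with hlt | heq | hgt
    · exact absurd hij' (aux hlt (by lia))
    · exact Fin.ext heq
    · exact absurd hij'.symm (aux hgt (by lia))
  · rintro ⟨I, hI⟩
    obtain ⟨i, hi, e⟩ := eq_pow_mul_pow_of_absNorm hK hp h₁ h k I hI
    exact ⟨⟨i, by lia⟩, Subtype.ext e.symm⟩

end Quadratic

end IdealCount

/-! ### Quadratic fields: the norm form and the splitting of primes -/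

section QuadraticOrder

open Ideal Module

variable {K : Type*} [Field K] [NumberField K]

/-- The element `1` is a primitive vector of the lattice `𝓞 K`: if it is divisible by `d` then the
ideal `(d)`, of norm `d ^ 2`, is the unit ideal. -/
theorem isCoprime_repr_one (hK : finrank ℚ K = 2) (b : Basis (Fin 2) ℤ (𝓞 K)) :
    IsCoprime (b.repr 1 0) (b.repr 1 1) := by
  rw [Int.isCoprime_iff_gcd_eq_one]
  set d := Int.gcd (b.repr 1 0) (b.repr 1 1) with hd
  obtain ⟨x, hx⟩ : (d : ℤ) ∣ b.repr 1 0 := Int.gcd_dvd_left _ _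
  obtain ⟨y, hy⟩ : (d : ℤ) ∣ b.repr 1 1 := Int.gcd_dvd_right _ _
  have h1 : (1 : 𝓞 K) = (d : 𝓞 K) * (x • b 0 + y • b 1) := by
    conv_lhs => rw [← b.sum_repr 1, Fin.sum_univ_two, hx, hy]
    simp only [zsmul_eq_mul]
    push_cast
    ring
  have h2 : absNorm (span {(d : 𝓞 K)}) = 1 := by
    rw [absNorm_eq_one_iff, span_singleton_eq_top]
    exact IsUnit.of_mul_eq_one _ h1.symm
  rw [absNorm_span_natCast_of_quadratic hK] at h2
  exact (Nat.pow_eq_one.mp h2).resolve_right (by norm_num)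

variable (K) in
/-- There is an integral basis `1, ω`, and `Δ_K` is the discriminant of the minimal polynomial
`X² - t X + n` of `ω`. -/
theorem exists_basis_one_and_discr_eq (hK : finrank ℚ K = 2) :
    ∃ (b : Basis (Fin 2) ℤ (𝓞 K)) (t n : ℤ), b 0 = 1 ∧ b 1 * b 1 = t * b 1 - n ∧
      discr K = t ^ 2 - 4 * n := by
  have hrank : finrank ℤ (𝓞 K) = 2 := by rw [RingOfIntegers.rank, hK]
  set c : Basis (Fin 2) ℤ (𝓞 K) := finBasisOfFinrankEq ℤ (𝓞 K) hrank with hc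
  obtain ⟨u, v, huv⟩ := isCoprime_repr_one hK c
  set x := c.repr 1 0
  set y := c.repr 1 1
  have h1 : (1 : 𝓞 K) = x • c 0 + y • c 1 := by
    conv_lhs => rw [← c.sum_repr 1, Fin.sum_univ_two]
  -- the base change from `c` to `1, ω` has determinant `u x + v y = 1`
  set ω : 𝓞 K := -v • c 0 + u • c 1 with hω
  have hlin : LinearIndependent ℤ ![(1 : 𝓞 K), ω] := by
    rw [LinearIndependent.pair_iff]
    intro p q hpq
    have e : (p * x - q * v) • c 0 + (p * y + q * u) • c 1 = 0 := by
      rw [← hpq, hω, h1]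
      simp only [zsmul_eq_mul]
      push_cast
      ring
    have hli := LinearIndependent.pair_iff.mp (show LinearIndependent ℤ ![c 0, c 1] by
      convert c.linearIndependent using 1
      ext i
      fin_cases i <;> rfl)
    obtain ⟨e1, e2⟩ := hli _ _ e
    constructor
    · linear_combination u * e1 + v * e2 - p * huv
    · linear_combination x * e2 - y * e1 - q * huv
  have hspan : ⊤ ≤ Submodule.span ℤ (Set.range ![(1 : 𝓞 K), ω]) := by
    rw [← c.span_eq, Submodule.span_le]
    rintro _ ⟨i, rfl⟩
    rw [Matrix.range_cons, Matrix.range_cons, Matrix.range_empty, Set.union_empty,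
      Set.singleton_union, SetLike.mem_coe, Submodule.mem_span_pair]
    have huv' : (u : 𝓞 K) * x + v * y = 1 := by exact_mod_cast congrArg (Int.cast (R := 𝓞 K)) huv
    fin_cases i
    · refine ⟨u, -y, ?_⟩
      rw [hω, h1]
      simp only [zsmul_eq_mul, Fin.zero_eta]
      push_cast
      linear_combination c 0 * huv'
    · refine ⟨v, x, ?_⟩
      rw [hω, h1]
      simp only [zsmul_eq_mul, Fin.mk_one]
      push_cast
      linear_combination c 1 * huv'
  set b := Basis.mk hlin hspan with hb
  have hb0 : b 0 = 1 := by rw [hb, Basis.mk_apply]; rfl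
  set t := b.repr (b 1 * b 1) 1 with ht
  set n := -b.repr (b 1 * b 1) 0 with hn
  have hsq : b 1 * b 1 = t * b 1 - n := by
    conv_lhs => rw [← b.sum_repr (b 1 * b 1), Fin.sum_univ_two, hb0]
    rw [ht, hn]
    simp only [zsmul_eq_mul]
    push_cast
    ring
  refine ⟨b, t, n, hb0, hsq, ?_⟩
  have tr1 : Algebra.trace ℤ (𝓞 K) 1 = 2 := by
    have := Algebra.trace_algebraMap_of_basis (R := ℤ) b 1
    simpa using this
  have trω : Algebra.trace ℤ (𝓞 K) (b 1) = t := by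
    rw [Algebra.trace_eq_matrix_trace b, Matrix.trace_fin_two, Algebra.leftMulMatrix_eq_repr_mul,
      Algebra.leftMulMatrix_eq_repr_mul, hb0, mul_one, b.repr_self, ← ht]
    simp
  have trω2 : Algebra.trace ℤ (𝓞 K) (b 1 * b 1) = t * t - 2 * n := by
    rw [hsq, show (t : 𝓞 K) * b 1 - n = t • b 1 - n • (1 : 𝓞 K) by simp [zsmul_eq_mul], map_sub,
      map_smul, map_smul, trω, tr1]
    simp only [smul_eq_mul]
    ring
  rw [← discr_eq_discr K b, Algebra.discr_def, Matrix.det_fin_two]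
  simp only [Algebra.traceMatrix_apply, Algebra.traceForm_apply, hb0, mul_one, one_mul, tr1, trω,
    trω2]
  ring

/-- A root `r` of `X² - t X + n` modulo `p` gives the homomorphism `x + y ω ↦ x + y r`. -/
theorem exists_ringHom_of_root {K : Type*} [Field K] (b : Basis (Fin 2) ℤ (𝓞 K)) {t n : ℤ}
    (hb0 : b 0 = 1) (hb1 : b 1 * b 1 = t * b 1 - n) {p : ℕ} {r : ZMod p} (hr : r ^ 2 - t * r + n = 0) :
    ∃ φ : 𝓞 K →+* ZMod p, φ (b 1) = r := by
  set f : 𝓞 K →ₗ[ℤ] ZMod p := b.constr ℤ ![1, r] with hf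
  have f0 : f 1 = 1 := by rw [← hb0, hf, Basis.constr_basis]; rfl
  have f1 : f (b 1) = r := by rw [hf, Basis.constr_basis]; rfl
  have hrep (x : 𝓞 K) : ∃ i j : ℤ, x = i • (1 : 𝓞 K) + j • b 1 :=
    ⟨b.repr x 0, b.repr x 1, by
      conv_lhs => rw [← b.sum_repr x, Fin.sum_univ_two, hb0]⟩
  have hval (i j : ℤ) : f (i • (1 : 𝓞 K) + j • b 1) = i + j * r := by
    rw [map_add, map_smul, map_smul, f0, f1]
    simp
  refine ⟨{ f.toAddMonoidHom with
    map_one' := f0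
    map_mul' := fun x y ↦ ?_ }, f1⟩
  obtain ⟨i, j, rfl⟩ := hrep x
  obtain ⟨k, l, rfl⟩ := hrep y
  have hmul : (i • (1 : 𝓞 K) + j • b 1) * (k • (1 : 𝓞 K) + l • b 1)
      = (i * k - j * l * n) • (1 : 𝓞 K) + (i * l + j * k + j * l * t) • b 1 := by
    simp only [zsmul_eq_mul]
    push_cast
    linear_combination (j * l : 𝓞 K) * hb1
  change f _ = f _ * f _
  rw [hmul, hval, hval, hval]
  push_cast
  linear_combination (-(j : ZMod p) * l) * hr

theorem absNorm_ker_eq {p : ℕ} [Fact p.Prime] (φ : 𝓞 K →+* ZMod p) :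
    absNorm (RingHom.ker φ) = p := by
  rw [absNorm_apply, Submodule.cardQuot_apply]
  have hs : Function.Surjective φ := ZMod.ringHom_surjective φ
  rw [Nat.card_congr (RingHom.quotientKerEquivOfSurjective hs).toEquiv, Nat.card_zmod]

theorem exists_ringHom_ker_eq {p : ℕ} [Fact p.Prime] {P : Ideal (𝓞 K)} (hP : absNorm P = p) :
    ∃ φ : 𝓞 K →+* ZMod p, RingHom.ker φ = P := by
  have hcard : Nat.card (𝓞 K ⧸ P) = p := by
    rw [← hP, absNorm_apply, Submodule.cardQuot_apply]
  have : Finite (𝓞 K ⧸ P) := Nat.finite_of_card_ne_zero (by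
    rw [hcard]; exact (Fact.out : p.Prime).ne_zero)
  have : Fintype (𝓞 K ⧸ P) := Fintype.ofFinite _
  have hcard' : Fintype.card (𝓞 K ⧸ P) = p := by rw [← Nat.card_eq_fintype_card, hcard]
  let e := ZMod.ringEquivOfPrime (𝓞 K ⧸ P) Fact.out hcard'
  refine ⟨(e.symm : (𝓞 K ⧸ P) →+* ZMod p).comp (Ideal.Quotient.mk P), ?_⟩
  rw [RingHom.ker_comp_of_injective _ e.symm.injective, Ideal.mk_ker]

/-- The ideals of norm `p` are the kernels of the homomorphisms to `ℤ/p`, and such a homomorphism is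
determined by the image of `ω`, an arbitrary root of its minimal polynomial. -/
theorem idealCount_prime_eq_card_roots (b : Basis (Fin 2) ℤ (𝓞 K)) {t n : ℤ} (hb0 : b 0 = 1)
    (hb1 : b 1 * b 1 = t * b 1 - n) {p : ℕ} [Fact p.Prime] :
    idealCount K p = Nat.card {r : ZMod p // r ^ 2 - t * r + n = 0} := by
  have hext (φ ψ : 𝓞 K →+* ZMod p) (h : φ (b 1) = ψ (b 1)) : φ = ψ := by
    ext x
    rw [← b.sum_repr x, Fin.sum_univ_two, hb0]
    simp [h]
  choose φ hφ using fun r : {r : ZMod p // r ^ 2 - t * r + n = 0} ↦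
    exists_ringHom_of_root b hb0 hb1 r.2
  rw [idealCount]
  refine (Nat.card_congr (Equiv.ofBijective
    (fun r ↦ (⟨RingHom.ker (φ r), absNorm_ker_eq _⟩ : {I : Ideal (𝓞 K) // absNorm I = p}))
      ⟨fun r r' h ↦ ?_, ?_⟩)).symm
  · have hk : RingHom.ker (φ r) = RingHom.ker (φ r') := Subtype.ext_iff.mp h
    -- `ω - r` lies in the first kernel, where `r` is lifted to an integer
    have hmem : b 1 - (r.1.val : 𝓞 K) ∈ RingHom.ker (φ r) := by
      rw [RingHom.mem_ker, map_sub, hφ, map_natCast, ZMod.natCast_zmod_val, sub_self]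
    rw [hk, RingHom.mem_ker, map_sub, hφ, map_natCast, ZMod.natCast_zmod_val, sub_eq_zero] at hmem
    exact Subtype.ext hmem.symm
  · rintro ⟨P, hP⟩
    obtain ⟨ψ, hψ⟩ := exists_ringHom_ker_eq hP
    have hroot : ψ (b 1) ^ 2 - t * ψ (b 1) + n = 0 := by
      have := congrArg ψ hb1
      simp only [map_mul, map_sub, map_intCast] at this
      linear_combination this
    refine ⟨⟨ψ (b 1), hroot⟩, Subtype.ext ?_⟩
    simp only
    rw [hext (φ ⟨ψ (b 1), hroot⟩) ψ (hφ _), hψ]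

theorem card_roots_two (t n : ℤ) :
    (Nat.card {r : ZMod 2 // r ^ 2 - t * r + n = 0} : ℤ)
      = 1 + if (t ^ 2 - 4 * n) % 8 = 1 then 1 else if (t ^ 2 - 4 * n) % 8 = 5 then -1 else 0 := by
  have hcard (u v : ZMod 2) : Nat.card {r : ZMod 2 // r ^ 2 - u * r + v = 0}
      = if u = 0 then 1 else if v = 0 then 2 else 0 := by
    rw [Nat.card_eq_fintype_card]
    revert u v
    decide
  rw [hcard]
  have ht : (t : ZMod 2) = 0 ↔ (2 : ℤ) ∣ t := ZMod.intCast_zmod_eq_zero_iff_dvd t 2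
  have hn : (n : ZMod 2) = 0 ↔ (2 : ℤ) ∣ n := ZMod.intCast_zmod_eq_zero_iff_dvd n 2
  rcases Int.even_or_odd' t with ⟨k, rfl | rfl⟩
  · have : ((2 * k : ℤ) : ZMod 2) = 0 := ht.mpr ⟨k, rfl⟩
    rw [if_pos this, if_neg, if_neg]
    · rfl
    · rw [show (2 * k) ^ 2 - 4 * n = 4 * (k ^ 2 - n) by ring]; lia
    · rw [show (2 * k) ^ 2 - 4 * n = 4 * (k ^ 2 - n) by ring]; lia
  · have : ¬ ((2 * k + 1 : ℤ) : ZMod 2) = 0 := fun h ↦ by have := ht.mp h; lia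
    rw [if_neg this]
    have hk : (2 * k + 1) ^ 2 % 8 = 1 := by
      obtain ⟨j, hj⟩ := Int.even_mul_succ_self k
      rw [show (2 * k + 1) ^ 2 = 4 * (k * (k + 1)) + 1 by ring, hj]
      lia
    by_cases h2 : (n : ZMod 2) = 0
    · have := hn.mp h2
      rw [if_pos h2, if_pos (by lia)]
      rfl
    · have : ¬ (2 : ℤ) ∣ n := fun h ↦ h2 (hn.mpr h)
      rw [if_neg h2, if_neg (by lia), if_pos (by lia)]
      rfl

theorem card_roots_of_odd (t n : ℤ) {p : ℕ} [Fact p.Prime] (hp : p ≠ 2) :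
    (Nat.card {r : ZMod p // r ^ 2 - t * r + n = 0} : ℤ) = 1 + J(t ^ 2 - 4 * n | p) := by
  have h2 : (2 : ZMod p) ≠ 0 := by
    intro h
    have : ((2 : ℕ) : ZMod p) = 0 := by exact_mod_cast h
    rw [ZMod.natCast_eq_zero_iff] at this
    exact hp ((Nat.prime_dvd_prime_iff_eq Fact.out Nat.prime_two).mp this)
  have hleg := legendreSym.card_sqrts p hp (t ^ 2 - 4 * n)
  rw [← jacobiSym.legendreSym.to_jacobiSym, add_comm, ← hleg, ← Nat.card_eq_card_toFinset]
  -- completing the square: `r` is a root precisely when `(2 r - t)² = t² - 4 n`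
  let e : ZMod p ≃ ZMod p :=
    { toFun := fun r ↦ 2 * r - t
      invFun := fun s ↦ (s + t) / 2
      left_inv := fun r ↦ by field_simp; ring
      right_inv := fun s ↦ by field_simp; ring }
  congr 1
  refine Nat.card_congr (e.subtypeEquiv fun r ↦ ?_)
  have h4 : (4 : ZMod p) ≠ 0 := by
    rw [show (4 : ZMod p) = 2 * 2 by norm_num]; exact mul_ne_zero h2 h2
  change _ ↔ (2 * r - t) ^ 2 = ((t ^ 2 - 4 * n : ℤ) : ZMod p)
  push_cast
  constructor
  · intro h
    linear_combination 4 * h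
  · intro h
    have : 4 * (r ^ 2 - t * r + n) = 0 := by linear_combination h
    exact (mul_eq_zero.mp this).resolve_left h4

/-- The number of prime ideals of norm `p` is `1 + (Δ_K / p)`. -/
theorem idealCount_prime_eq (hK : Module.finrank ℚ K = 2) {p : ℕ} (hp : p.Prime) :
    (idealCount K p : ℂ) = 1 + quadraticFieldChar K (p : ZMod (discr K).natAbs) := by
  have := Fact.mk hp
  obtain ⟨b, t, n, hb0, hb1, hD⟩ := exists_basis_one_and_discr_eq K hK
  have hmod : discr K % 4 = 0 ∨ discr K % 4 = 1 := by
    rcases Int.even_or_odd' t with ⟨k, rfl | rfl⟩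
    · left; rw [hD, show (2 * k) ^ 2 - 4 * n = 4 * (k ^ 2 - n) by ring]; lia
    · right; rw [hD, show (2 * k + 1) ^ 2 - 4 * n = 4 * (k ^ 2 + k - n) + 1 by ring]; lia
  rw [idealCount_prime_eq_card_roots b hb0 hb1, quadraticFieldChar]
  rcases eq_or_ne p 2 with rfl | h2
  · have h := card_roots_two t n
    rw [← hD] at h
    rw [kroneckerChar_two hmod, ← Int.cast_natCast (R := ℂ), h]
    push_cast
    split_ifs <;> simp
  · have h := card_roots_of_odd t n h2
    rw [← hD] at h
    rw [kroneckerChar_odd_prime hmod hp h2, ← Int.cast_natCast (R := ℂ), h]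
    push_cast
    rfl

end QuadraticOrder

/-! ### The Dedekind zeta function of a quadratic field -/

section QuadraticZeta

open Ideal Filter Topology

theorem tendsto_ofReal_nhdsGT_one : Tendsto (fun s : ℝ ↦ (s : ℂ)) (𝓝[>] 1) (𝓝[≠] 1) := by
  refine tendsto_nhdsWithin_iff.mpr ⟨?_, ?_⟩
  · exact (Complex.continuous_ofReal.tendsto' 1 1 (by simp)).mono_left nhdsWithin_le_nhds
  · filter_upwards [self_mem_nhdsWithin] with s hs
    simpa using hs.ne'

variable {K : Type*} [Field K] [NumberField K]

open Classical in
theorem quadraticFieldChar_sq : quadraticFieldChar K ^ 2 = 1 := by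
  ext a
  have ha : IsUnit (a : ZMod (discr K).natAbs) := a.isUnit
  have hc := coprime_val_of_isUnit ha
  rw [MulChar.pow_apply' _ two_ne_zero, MulChar.one_apply ha, quadraticFieldChar,
    ← ZMod.natCast_zmod_val (a : ZMod (discr K).natAbs), kroneckerChar_natCast hc, kroneckerValue,
    ← Int.cast_pow]
  norm_cast
  split_ifs
  · refine jacobiSym.sq_one ?_
    rw [Int.gcd_comm]
    exact hc
  · exact jacobiSym.sq_one hc

variable (hK : Module.finrank ℚ K = 2)
include hK

/-- At prime powers, according to the three splitting types, `1 + χ(p) + ⋯ + χ(p) ^ k`. -/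
theorem idealCount_prime_pow {p : ℕ} (hp : p.Prime) (k : ℕ) :
    (idealCount K (p ^ k) : ℂ)
      = ∑ i ∈ Finset.range (k + 1), quadraticFieldChar K (p : ZMod (discr K).natAbs) ^ i := by
  have hc := idealCount_prime_eq hK hp
  set χ := quadraticFieldChar K with hχ
  have hcard : (Nat.card {I : Ideal (𝓞 K) // absNorm I = p} : ℂ) = 1 + χ p := hc
  have hcases : χ p = 0 ∨ χ p = 1 ∨ χ p = -1 := by
    by_cases hu : IsUnit (p : ZMod (discr K).natAbs)
    · right
      have h := congrArg (fun ψ : DirichletCharacter ℂ _ ↦ ψ p) (quadraticFieldChar_sq (K := K))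
      simp only [MulChar.pow_apply' _ two_ne_zero, MulChar.one_apply hu] at h
      exact (sq_eq_sq_iff_eq_or_eq_neg.mp (h.trans (one_pow 2).symm))
    · exact .inl (MulChar.map_nonunit _ hu)
  rcases hcases with h | h | h
  · have h1 : Nat.card {I : Ideal (𝓞 K) // absNorm I = p} = 1 := by
      rw [h, add_zero] at hcard; exact_mod_cast hcard
    obtain ⟨⟨hsub⟩, ⟨P⟩⟩ := Nat.card_eq_one_iff_unique.mp h1
    rw [idealCount_prime_pow_of_ramified hK hp P.2
      (fun Q hQ ↦ Subtype.ext_iff.mp (hsub ⟨Q, hQ⟩ P)), h, Finset.sum_range_succ',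
      Finset.sum_eq_zero fun i _ ↦ zero_pow (Nat.succ_ne_zero i)]
    simp
  · have h2 : Nat.card {I : Ideal (𝓞 K) // absNorm I = p} = 2 := by
      rw [h, one_add_one_eq_two] at hcard; exact_mod_cast hcard
    obtain ⟨P, Q, hne, hPQ⟩ := Nat.card_eq_two_iff.mp h2
    rw [idealCount_prime_pow_of_split hK hp (fun e ↦ hne (Subtype.ext e)) P.2 Q.2
      (fun I hI ↦ ?_), h]
    · simp
    · have : (⟨I, hI⟩ : {I : Ideal (𝓞 K) // absNorm I = p}) ∈ ({P, Q} : Set _) := by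
        rw [hPQ]; exact Set.mem_univ _
      simpa [Subtype.ext_iff] using this
  · have h0 : Nat.card {I : Ideal (𝓞 K) // absNorm I = p} = 0 := by
      rw [h, add_neg_cancel] at hcard; exact_mod_cast hcard
    have hne (P : Ideal (𝓞 K)) : absNorm P ≠ p := by
      intro hP
      have : Finite {I : Ideal (𝓞 K) // absNorm I = p} :=
        (finite_setOfPred_absNorm_eq p).to_subtype
      exact (Finite.card_eq_zero_iff.mp h0).false ⟨P, hP⟩
    rw [idealCount_prime_pow_of_inert hK hp hne, h, neg_one_geom_sum]
    simp only [Nat.even_add_one]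
    split_ifs <;> simp

theorem idealCount_eq_zetaMul {n : ℕ} (hn : n ≠ 0) :
    (idealCount K n : ℂ) = (quadraticFieldChar K).zetaMul n := by
  let f : ArithmeticFunction ℂ := ⟨fun n ↦ if n = 0 then 0 else idealCount K n, if_pos rfl⟩
  have hf (n : ℕ) (hn : n ≠ 0) : f n = idealCount K n := if_neg hn
  have hmul : f.IsMultiplicative := by
    rw [ArithmeticFunction.IsMultiplicative.iff_ne_zero]
    refine ⟨by rw [hf 1 one_ne_zero, idealCount_one, Nat.cast_one], fun {m n} hm hn hmn ↦ ?_⟩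
    rw [hf _ (mul_ne_zero hm hn), hf m hm, hf n hn, idealCount_mul hm hn hmn, Nat.cast_mul]
  rw [← hf n hn]
  congr 1
  refine (hmul.eq_iff_eq_on_prime_powers f _
    (DirichletCharacter.isMultiplicative_zetaMul _)).mpr fun p k hp ↦ ?_
  rw [hf _ (pow_ne_zero _ hp.ne_zero), idealCount_prime_pow hK hp,
    DirichletCharacter.zetaMul_prime_pow _ hp]

theorem dedekindZeta_eq_mul {s : ℂ} (hs : 1 < s.re) :
    dedekindZeta K s = riemannZeta s * (quadraticFieldChar K).LFunction s := by
  rw [← DirichletCharacter.LSeries_zetaMul _ hs, dedekindZeta]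
  exact LSeries_congr (fun hn ↦ idealCount_eq_zetaMul hK hn) s

/-- If the character were trivial, the Dedekind zeta function would have a double pole at `1`. -/
theorem quadraticFieldChar_ne_one : quadraticFieldChar K ≠ 1 := by
  intro h
  have hto := tendsto_ofReal_nhdsGT_one
  have h1 := riemannZeta_residue_one.comp hto
  have h2 := (DirichletCharacter.LFunctionTrivChar_residue_one (N := (discr K).natAbs)).comp hto
  have h0 : Tendsto (fun s : ℝ ↦ ((s : ℂ) - 1)) (𝓝[>] 1) (𝓝 0) :=
    ((continuous_sub_right (1 : ℂ)).tendsto' 1 0 (sub_self _)).comp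
      (hto.mono_right nhdsWithin_le_nhds)
  have h4 := tendsto_nhds_unique_of_eventuallyEq
    (h0.mul (tendsto_sub_one_mul_dedekindZeta_nhdsGT K)) (h1.mul h2) <| by
      filter_upwards [self_mem_nhdsWithin] with s hs
      rw [dedekindZeta_eq_mul hK (by simpa using hs), h]
      simp only [Function.comp, DirichletCharacter.LFunctionTrivChar]
      ring
  rw [zero_mul, one_mul, eq_comm, Finset.prod_eq_zero_iff] at h4
  obtain ⟨p, hp, hp1⟩ := h4
  rw [sub_eq_zero, eq_comm, inv_eq_one] at hp1
  exact (Nat.prime_of_mem_primeFactors hp).one_lt.ne' (by exact_mod_cast hp1)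

theorem dedekindZeta_residue_eq :
    (dedekindZeta_residue K : ℂ) = (quadraticFieldChar K).LFunction 1 := by
  have hto := tendsto_ofReal_nhdsGT_one
  have h1 := riemannZeta_residue_one.comp hto
  have h2 := ((DirichletCharacter.differentiable_LFunction (quadraticFieldChar_ne_one hK)
    ).continuous.tendsto 1).comp (hto.mono_right nhdsWithin_le_nhds)
  have h3 := h1.mul h2
  rw [one_mul] at h3
  refine tendsto_nhds_unique ((tendsto_sub_one_mul_dedekindZeta_nhdsGT K)) (h3.congr' ?_)
  filter_upwards [self_mem_nhdsWithin] with s hs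
  rw [dedekindZeta_eq_mul hK (by simpa using hs)]
  simp only [Function.comp]
  ring

end QuadraticZeta

/-! ### Sums over ideals and Rankin's trick -/

section IdealSums

open Ideal

variable (K : Type*) [Field K] [NumberField K]

open Classical in
/-- The nonzero ideals of norm at most `N`. -/
noncomputable def idealsOfNormLE (N : ℕ) : Finset (Ideal (𝓞 K)) :=
  (finite_setOfPred_absNorm_le (S := 𝓞 K) N).toFinset.filter (· ≠ ⊥)

variable {K}

theorem mem_idealsOfNormLE {N : ℕ} {I : Ideal (𝓞 K)} :
    I ∈ idealsOfNormLE K N ↔ I ≠ ⊥ ∧ absNorm I ≤ N := by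
  classical
  simp [idealsOfNormLE, and_comm]

theorem sum_idealsOfNormLE (N : ℕ) (f : ℕ → ℝ) :
    ∑ I ∈ idealsOfNormLE K N, f (absNorm I) = ∑ n ∈ Finset.Icc 1 N, idealCount K n * f n := by
  classical
  have hmaps : ∀ I ∈ idealsOfNormLE K N, absNorm I ∈ Finset.Icc 1 N := fun I hI ↦ by
    have h := mem_idealsOfNormLE.mp hI
    exact Finset.mem_Icc.mpr ⟨Nat.one_le_iff_ne_zero.mpr (absNorm_eq_zero_iff.not.mpr h.1), h.2⟩
  rw [← Finset.sum_fiberwise_of_maps_to hmaps]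
  refine Finset.sum_congr rfl fun n hn ↦ ?_
  have hn' := Finset.mem_Icc.mp hn
  rw [Finset.sum_congr rfl fun I hI ↦ by rw [(Finset.mem_filter.mp hI).2], Finset.sum_const,
    nsmul_eq_mul, idealCount]
  congr 2
  rw [← Nat.card_eq_finsetCard]
  refine Nat.card_congr (Equiv.subtypeEquivRight fun I ↦ ?_)
  rw [Finset.mem_filter, mem_idealsOfNormLE, and_iff_right_iff_imp]
  rintro rfl
  exact ⟨absNorm_eq_zero_iff.not.mp (by lia), hn'.2⟩

theorem summable_card_divisors_rpow {σ : ℝ} (hσ : 1 < σ) :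
    Summable fun n : ℕ ↦ (n.divisors.card : ℝ) * (n : ℝ) ^ (-σ) := by
  have h := ((1 : DirichletCharacter ℂ 1).LSeriesSummable_zetaMul
    (s := (σ : ℂ)) (by simpa using hσ)).norm
  refine h.congr fun n ↦ ?_
  rcases eq_or_ne n 0 with rfl | hn
  · simp
  rw [LSeries.term_of_ne_zero hn, norm_div,
    Complex.norm_natCast_cpow_of_pos (Nat.pos_of_ne_zero hn), Complex.ofReal_re, Real.rpow_neg (Nat.cast_nonneg n), div_eq_mul_inv]
  congr 1
  rw [DirichletCharacter.zetaMul, ArithmeticFunction.coe_zeta_mul_apply]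
  have (d : ℕ) (hd : d ∈ n.divisors) :
      toArithmeticFunction (fun m ↦ (1 : DirichletCharacter ℂ 1) m) d = 1 := by
    simp [toArithmeticFunction, (Nat.pos_of_mem_divisors hd).ne',
      MulChar.one_apply (isUnit_of_subsingleton _)]
  rw [Finset.sum_congr rfl this]
  simp

variable (hK : Module.finrank ℚ K = 2)
include hK

theorem idealCount_le_card_divisors {n : ℕ} (hn : n ≠ 0) : idealCount K n ≤ n.divisors.card := by
  have h : ‖(idealCount K n : ℂ)‖ ≤ n.divisors.card := by
    rw [idealCount_eq_zetaMul hK hn, DirichletCharacter.zetaMul,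
      ArithmeticFunction.coe_zeta_mul_apply]
    refine (norm_sum_le _ _).trans ((Finset.sum_le_card_nsmul _ _ 1 fun d hd ↦ ?_).trans_eq
      (by simp))
    simp only [toArithmeticFunction, ArithmeticFunction.coe_mk]
    split_ifs
    · simp
    · exact DirichletCharacter.norm_le_one _ _
  rw [Complex.norm_natCast] at h
  exact_mod_cast h

/-- The sum of `N(I) ^ (-σ)` is bounded by `ζ(σ) ^ 2`, uniformly in the quadratic field. -/
theorem sum_absNorm_rpow_le {σ : ℝ} (hσ : 1 < σ) (N : ℕ) :
    ∑ I ∈ idealsOfNormLE K N, (absNorm I : ℝ) ^ (-σ)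
      ≤ ∑' n : ℕ, (n.divisors.card : ℝ) * (n : ℝ) ^ (-σ) := by
  rw [sum_idealsOfNormLE N (fun n ↦ (n : ℝ) ^ (-σ))]
  refine (Finset.sum_le_sum fun n hn ↦ ?_).trans
    ((summable_card_divisors_rpow hσ).sum_le_tsum (Finset.Icc 1 N) fun n _ ↦ by positivity)
  have := idealCount_le_card_divisors hK (n := n) (by have := (Finset.mem_Icc.mp hn).1; lia)
  gcongr

theorem card_idealsOfNormLE_le {N : ℕ} (hN : 1 ≤ N) :
    ((idealsOfNormLE K N).card : ℝ)
      ≤ (∑' n : ℕ, (n.divisors.card : ℝ) * (n : ℝ) ^ (-(2 : ℝ))) * (N : ℝ) ^ 2 := by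
  have hN' : (0 : ℝ) < N := by exact_mod_cast hN
  rw [← div_le_iff₀ (by positivity)]
  refine le_trans ?_ (sum_absNorm_rpow_le hK one_lt_two N)
  rw [div_eq_mul_inv, ← nsmul_eq_mul]
  refine Finset.card_nsmul_le_sum _ _ _ fun I hI ↦ ?_
  obtain ⟨h0, h1⟩ := mem_idealsOfNormLE.mp hI
  have h0' : (0 : ℝ) < absNorm I :=
    by exact_mod_cast Nat.pos_of_ne_zero (absNorm_eq_zero_iff.not.mpr h0)
  rw [Real.rpow_neg h0'.le, Real.rpow_two]
  have h1' : (absNorm I : ℝ) ≤ N := by exact_mod_cast h1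
  gcongr

/-- Cutting the smoothed sum at `N`: the tail is estimated by Rankin's trick, comparing the weight
of `n > N` with `n ^ (-σ)` and then with `N ^ (-(σ - 1 - δ)) n ^ (-(1 + δ))`. -/
theorem norm_tsum_zetaMul_gaussWeight_le {T σ δ : ℝ} (hT : 0 < T) (hδ : 0 < δ) (hσ : 1 + δ ≤ σ)
    {N : ℕ} (hN : 1 ≤ N) :
    ‖∑' n, (quadraticFieldChar K).zetaMul n * gaussWeight T n‖
      ≤ ∑ I ∈ idealsOfNormLE K N, gaussWeight T (absNorm I)
        + Real.exp (T * σ ^ 2 / 2) * (N : ℝ) ^ (-(σ - 1 - δ))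
          * ∑' n : ℕ, (n.divisors.card : ℝ) * (n : ℝ) ^ (-(1 + δ)) := by
  have hN0 : (0 : ℝ) < N := by exact_mod_cast hN
  have h1 : HasSum (fun n ↦ if n ∈ Finset.Icc 1 N then idealCount K n * gaussWeight T n else 0)
      (∑ I ∈ idealsOfNormLE K N, gaussWeight T (absNorm I)) := by
    rw [sum_idealsOfNormLE N (gaussWeight T)]
    convert hasSum_sum_of_ne_finset_zero (s := Finset.Icc 1 N) ?_ using 1
    · exact (Finset.sum_congr rfl fun n hn ↦ if_pos hn).symm
    · exact fun n hn ↦ if_neg hn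
    · infer_instance
  have h2 := (summable_card_divisors_rpow (σ := 1 + δ) (by linarith)).hasSum.mul_left
    (Real.exp (T * σ ^ 2 / 2) * (N : ℝ) ^ (-(σ - 1 - δ)))
  refine tsum_of_norm_bounded (h1.add h2) fun n ↦ ?_
  rcases eq_or_ne n 0 with rfl | hn
  · simp
  rw [← idealCount_eq_zetaMul hK hn, norm_mul, Complex.norm_natCast, Complex.norm_real,
    Real.norm_of_nonneg (gaussWeight_pos T n).le]
  have hn1 : 1 ≤ n := Nat.one_le_iff_ne_zero.mpr hn
  split_ifs with hmem
  · exact le_add_of_nonneg_right (by positivity)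
  rw [zero_add, mul_left_comm]
  have hNn : N ≤ n := by
    by_contra h
    exact hmem (Finset.mem_Icc.mpr ⟨hn1, by lia⟩)
  have hn0 : (0 : ℝ) < n := by exact_mod_cast hn1
  have hNn' : (N : ℝ) ≤ n := by exact_mod_cast hNn
  refine mul_le_mul (by exact_mod_cast idealCount_le_card_divisors hK hn) ?_
    (gaussWeight_pos T n).le (Nat.cast_nonneg _)
  refine (gaussWeight_le hT σ hn).trans ?_
  rw [mul_assoc, show -σ = -(σ - 1 - δ) + -(1 + δ) by ring, Real.rpow_add hn0]
  have : (n : ℝ) ^ (-(σ - 1 - δ)) ≤ (N : ℝ) ^ (-(σ - 1 - δ)) :=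
    Real.rpow_le_rpow_of_nonpos hN0 hNn' (by linarith)
  gcongr

end IdealSums

/-! ### Integers of a quadratic field with small conjugates -/

section SmallConjugates

open Ideal Module

variable {K : Type*} [Field K] [NumberField K]

variable (K) in
theorem exists_embeddings_pair (hK : finrank ℚ K = 2) :
    ∃ σ τ : K →+* ℂ, σ ≠ τ ∧ ∀ ρ : K →+* ℂ, ρ = σ ∨ ρ = τ := by
  have h : Nat.card (K →+* ℂ) = 2 := by
    rw [Nat.card_eq_fintype_card, Embeddings.card K ℂ, hK]
  obtain ⟨σ, τ, hne, huniv⟩ := Nat.card_eq_two_iff.mp h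
  refine ⟨σ, τ, hne, fun ρ ↦ ?_⟩
  have : ρ ∈ ({σ, τ} : Set (K →+* ℂ)) := by rw [huniv]; exact Set.mem_univ _
  simpa using this

theorem abs_norm_eq_mul {σ τ : K →+* ℂ} (hne : σ ≠ τ) (h : ∀ ρ : K →+* ℂ, ρ = σ ∨ ρ = τ)
    (x : 𝓞 K) : ((Algebra.norm ℤ x).natAbs : ℝ) = ‖σ x‖ * ‖τ x‖ := by
  classical
  have h1 := Algebra.norm_eq_prod_embeddings ℚ ℂ (x : K)
  have h2 : ∏ φ : K →ₐ[ℚ] ℂ, φ (x : K) = ∏ φ : K →+* ℂ, φ x :=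
    (Fintype.prod_equiv (RingHom.equivRatAlgHom K ℂ) _ _ fun φ ↦ rfl).symm
  have h3 : (Finset.univ : Finset (K →+* ℂ)) = {σ, τ} := by
    ext ρ; simpa using h ρ
  rw [h2, h3, Finset.prod_pair hne] at h1
  rw [← norm_mul, ← h1, ← Algebra.coe_norm_int, Nat.cast_natAbs]
  simp

/-- If `α = x + y ω` then `|y| √|Δ|` is the distance between the two conjugates of `α`; so an
integer with conjugates less than `√|Δ| / 2` is rational. -/
theorem exists_eq_intCast_of_norm_lt (hK : finrank ℚ K = 2) {α : 𝓞 K}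
    (h : ∀ σ : K →+* ℂ, 2 * ‖σ α‖ < √|(discr K : ℝ)|) : ∃ k : ℤ, α = k := by
  obtain ⟨b, t, n, hb0, hb1, hD⟩ := exists_basis_one_and_discr_eq K hK
  obtain ⟨σ, τ, hne, -⟩ := exists_embeddings_pair K hK
  have hα : α = b.repr α 0 + b.repr α 1 * b 1 := by
    conv_lhs => rw [← b.sum_repr α, Fin.sum_univ_two, hb0]
    simp
  set x := b.repr α 0
  set y := b.repr α 1
  have hroot (ρ : K →+* ℂ) : ρ (b 1) * ρ (b 1) = t * ρ (b 1) - n := by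
    have := congrArg (fun z : 𝓞 K ↦ ρ z) hb1
    simpa using this
  have hω : σ (b 1) ≠ τ (b 1) := by
    intro e
    refine hne (IsFractionRing.ringHom_ext (A := 𝓞 K) fun z ↦ ?_)
    have hz := b.sum_repr z
    rw [Fin.sum_univ_two, hb0] at hz
    rw [← hz]
    simp [e]
  have hsum : σ (b 1) + τ (b 1) = t := by
    have : (σ (b 1) - τ (b 1)) * (σ (b 1) + τ (b 1) - t) = 0 := by
      linear_combination hroot σ - hroot τ
    have := (mul_eq_zero.mp this).resolve_left (sub_ne_zero.mpr hω)
    linear_combination this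
  have hdisc : (σ (b 1) - τ (b 1)) ^ 2 = discr K := by
    rw [hD]
    push_cast
    have hτ : τ (b 1) = t - σ (b 1) := by linear_combination hsum
    rw [hτ]
    linear_combination 4 * hroot σ
  have hnorm : ‖σ (b 1) - τ (b 1)‖ = √|(discr K : ℝ)| := by
    rw [eq_comm, Real.sqrt_eq_iff_eq_sq (abs_nonneg _) (norm_nonneg _), ← norm_pow, hdisc]
    simp
  have hdiff : ‖σ α - τ α‖ = |(y : ℝ)| * √|(discr K : ℝ)| := by
    rw [← hnorm, ← Complex.norm_intCast, ← norm_mul, hα]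
    congr 1
    push_cast [map_add, map_mul, map_intCast]
    ring
  have hlt : |(y : ℝ)| * √|(discr K : ℝ)| < 1 * √|(discr K : ℝ)| := by
    rw [← hdiff]
    have := norm_sub_le (σ α) (τ α)
    linarith [h σ, h τ]
  have hy : |(y : ℝ)| < 1 := lt_of_mul_lt_mul_right hlt (Real.sqrt_nonneg _)
  have hy0 : y = 0 := Int.abs_lt_one_iff.mp (by exact_mod_cast hy)
  exact ⟨x, by rw [hα, hy0]; simp⟩

end SmallConjugates

/-! ### Primitive ideals -/

section PrimitiveIdeals

open Ideal Module

variable {K : Type*} [Field K] [NumberField K]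

/-- An ideal is primitive if it is not divisible by a rational integer `m > 1`.  The zero ideal is
not primitive. -/
def IsPrimitiveIdeal (I : Ideal (𝓞 K)) : Prop := ∀ m : ℕ, span {(m : 𝓞 K)} ∣ I → m = 1

theorem span_natCast_ne_zero {m : ℕ} (hm : m ≠ 0) : span {(m : 𝓞 K)} ≠ 0 := by
  rw [zero_eq_bot, Ne, span_singleton_eq_bot]
  exact_mod_cast hm

theorem span_natCast_mul {R : Type*} [CommRing R] (m n : ℕ) :
    span {((m * n : ℕ) : R)} = span {(m : R)} * span {(n : R)} := by
  rw [span_singleton_mul_span_singleton, Nat.cast_mul]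

theorem span_natCast_pow {R : Type*} [CommRing R] (m k : ℕ) :
    span {((m ^ k : ℕ) : R)} = span {(m : R)} ^ k := by
  rw [span_singleton_pow, Nat.cast_pow]

theorem IsPrimitiveIdeal.ne_zero {K : Type*} [Field K] {I : Ideal (𝓞 K)}
    (hI : IsPrimitiveIdeal I) : I ≠ 0 := by
  rintro rfl
  exact absurd (hI 2 (dvd_zero _)) (by norm_num)

/-- Two primitive ideals whose quotient is rational are equal. -/
theorem IsPrimitiveIdeal.eq_of_mul_eq {I J : Ideal (𝓞 K)} (hI : IsPrimitiveIdeal I)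
    (hJ : IsPrimitiveIdeal J) {m n : ℕ} (hm : m ≠ 0)
    (h : span {(n : 𝓞 K)} * I = span {(m : 𝓞 K)} * J) : I = J := by
  obtain ⟨g, m', n', hg, hcop, rfl, rfl⟩ :=
    Nat.exists_coprime' (Nat.gcd_pos_of_pos_left n (Nat.pos_of_ne_zero hm))
  rw [mul_comm m', mul_comm n', span_natCast_mul, span_natCast_mul, mul_assoc, mul_assoc] at h
  have h := mul_left_cancel₀ (span_natCast_ne_zero hg.ne') h
  have hc : IsCoprime (span {(m' : 𝓞 K)}) (span {(n' : 𝓞 K)}) := by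
    rw [isCoprime_iff_sup_eq]
    exact span_natCast_sup_span_natCast_eq_top hcop
  have h1 := hI m' (hc.dvd_of_dvd_mul_left ⟨J, h⟩)
  have h2 := hJ n' (hc.symm.dvd_of_dvd_mul_left ⟨I, h.symm⟩)
  rw [h1, h2] at h
  exact mul_left_cancel₀ (span_natCast_ne_zero one_ne_zero) h

theorem exists_eq_span_mul_primitive {I : Ideal (𝓞 K)} (hI : I ≠ ⊥) (hK : finrank ℚ K = 2) :
    ∃ (m : ℕ) (J : Ideal (𝓞 K)), m ≠ 0 ∧ IsPrimitiveIdeal J ∧ I = span {(m : 𝓞 K)} * J := by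
  induction hn : absNorm I using Nat.strong_induction_on generalizing I with
  | _ n ih =>
    by_cases hp : IsPrimitiveIdeal I
    · exact ⟨1, I, one_ne_zero, hp, by simp⟩
    · simp only [IsPrimitiveIdeal, not_forall] at hp
      obtain ⟨m, ⟨J, hJ⟩, hm⟩ := hp
      have hm0 : m ≠ 0 := by rintro rfl; exact hI (by simp [hJ])
      have hJ0 : J ≠ ⊥ := by rintro rfl; exact hI (by simp [hJ])
      have hlt : absNorm J < n := by
        rw [← hn, hJ, map_mul, absNorm_span_natCast_of_quadratic hK]
        have := Nat.pos_of_ne_zero (absNorm_eq_zero_iff.not.mpr hJ0)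
        have hm2 : 2 ^ 2 ≤ m ^ 2 := Nat.pow_le_pow_left (by lia) 2
        nlinarith
      obtain ⟨m', J', hm', hJ', e⟩ := ih _ hlt hJ0 rfl
      exact ⟨m * m', J', mul_ne_zero hm0 hm', hJ', by rw [hJ, e, span_natCast_mul, mul_assoc]⟩

/-- If the quotient of the `ℓ`-th powers of two primitive ideals is rational, `ℓ` odd, then the
ideals are equal: the square of the quotient is `N(I) / N(J)`. -/
theorem IsPrimitiveIdeal.eq_of_pow (hK : finrank ℚ K = 2) {I J : Ideal (𝓞 K)}
    (hI : IsPrimitiveIdeal I) (hJ : IsPrimitiveIdeal J) {ℓ : ℕ} (hℓ : Odd ℓ) {x y : ℕ}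
    (hx : x ≠ 0) (hy : y ≠ 0)
    (h : span {(x : 𝓞 K)} * I ^ ℓ = span {(y : 𝓞 K)} * J ^ ℓ) : I = J := by
  have hN : x ^ 2 * absNorm I ^ ℓ = y ^ 2 * absNorm J ^ ℓ := by
    have := congrArg absNorm h
    simpa only [map_mul, map_pow, absNorm_span_natCast_of_quadratic hK] using this
  set a := absNorm I
  set b := absNorm J
  have hb : b ≠ 0 := absNorm_eq_zero_iff.not.mpr hJ.ne_zero
  have hℓ0 : ℓ ≠ 0 := by rintro rfl; simp at hℓ
  have hsq : span {(b : 𝓞 K)} * I ^ 2 = span {(a : 𝓞 K)} * J ^ 2 := by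
    refine pow_left_injective hℓ0 (mul_left_cancel₀ (span_natCast_ne_zero (pow_ne_zero 2 hx)) ?_)
    calc span {((x ^ 2 : ℕ) : 𝓞 K)} * (span {(b : 𝓞 K)} * I ^ 2) ^ ℓ
        = span {(b : 𝓞 K)} ^ ℓ * (span {(x : 𝓞 K)} * I ^ ℓ) ^ 2 := by
          rw [span_natCast_pow]; ring
      _ = span {((y ^ 2 * b ^ ℓ : ℕ) : 𝓞 K)} * (J ^ 2) ^ ℓ := by
          rw [h, span_natCast_mul, span_natCast_pow, span_natCast_pow]; ring
      _ = span {((x ^ 2 : ℕ) : 𝓞 K)} * (span {(a : 𝓞 K)} * J ^ 2) ^ ℓ := by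
          rw [← hN, span_natCast_mul, span_natCast_pow _ ℓ]; ring
  obtain ⟨k, rfl⟩ := hℓ
  refine hI.eq_of_mul_eq hJ (n := x * a ^ k) (m := y * b ^ k) (mul_ne_zero hy (pow_ne_zero _ hb)) ?_
  refine mul_left_cancel₀ (pow_ne_zero (2 * k) hJ.ne_zero) ?_
  have hk : span {(a : 𝓞 K)} ^ k * J ^ (2 * k) = span {(b : 𝓞 K)} ^ k * I ^ (2 * k) := by
    rw [pow_mul, pow_mul, ← mul_pow, ← mul_pow, hsq]
  rw [span_natCast_mul, span_natCast_mul, span_natCast_pow, span_natCast_pow]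
  calc J ^ (2 * k) * (span {(x : 𝓞 K)} * span {(a : 𝓞 K)} ^ k * I)
      = (span {(a : 𝓞 K)} ^ k * J ^ (2 * k)) * span {(x : 𝓞 K)} * I := by ring
    _ = span {(b : 𝓞 K)} ^ k * (span {(x : 𝓞 K)} * I ^ (2 * k + 1)) := by rw [hk]; ring
    _ = J ^ (2 * k) * (span {(y : 𝓞 K)} * span {(b : 𝓞 K)} ^ k * J) := by rw [h]; ring

end PrimitiveIdeals

/-! ### Units of quadratic fields -/

section QuadraticUnits

open Ideal Module Units InfinitePlace

variable {K : Type*} [Field K] [NumberField K]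

theorem exists_eq_intCast_of_norm_eq_one (hK : finrank ℚ K = 2) (hD : 4 < |(discr K : ℝ)|)
    {α : 𝓞 K} (h : ∀ σ : K →+* ℂ, ‖σ α‖ = 1) : ∃ k : ℤ, α = k :=
  exists_eq_intCast_of_norm_lt hK fun σ ↦ by
    rw [h, mul_one]
    exact Real.lt_sqrt_of_sq_lt (by linarith)

theorem torsionOrder_le_two (hK : finrank ℚ K = 2) (hD : 4 < |(discr K : ℝ)|) :
    torsionOrder K ≤ 2 := by
  obtain ⟨g, hg⟩ := IsCyclic.exists_generator (α := torsion K)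
  rw [torsionOrder, ← orderOf_eq_card_of_forall_mem_zpowers hg]
  refine Nat.le_of_dvd two_pos (orderOf_dvd_of_pow_eq_one ?_)
  obtain ⟨k, hk⟩ := exists_eq_intCast_of_norm_eq_one hK hD (α := ((g : (𝓞 K)ˣ) : 𝓞 K))
    fun σ ↦ by
      have := (mem_torsion K).mp g.2 (InfinitePlace.mk σ)
      simpa using this
  have hu : IsUnit k := by
    have h1 : IsUnit (algebraMap ℤ (𝓞 K) k) := by
      rw [eq_intCast, ← hk]; exact (g : (𝓞 K)ˣ).isUnit
    have h2 := h1.map (Algebra.norm ℤ)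
    rwa [Algebra.norm_algebraMap, isUnit_pow_iff] at h2
    rw [RingOfIntegers.rank, hK]
    exact two_ne_zero
  refine Subtype.ext (Units.ext ?_)
  simp only [Subgroup.coe_pow, Units.val_pow_eq_pow_val, hk]
  rcases Int.isUnit_iff.mp hu with rfl | rfl <;> simp

variable {σ τ : K →+* ℂ}

/-- If both embeddings have the same absolute value, the field is imaginary quadratic. -/
theorem regulator_eq_one_of_mk_eq (h : ∀ ρ : K →+* ℂ, ρ = σ ∨ ρ = τ)
    (hmk : InfinitePlace.mk σ = InfinitePlace.mk τ) : regulator K = 1 := by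
  classical
  have hall (w : InfinitePlace K) : w = InfinitePlace.mk σ := by
    rw [← w.mk_embedding]
    rcases h w.embedding with h | h <;> rw [h]
    exact hmk.symm
  have : IsEmpty {w // w ≠ InfinitePlace.mk σ} := ⟨fun w ↦ w.2 (hall w)⟩
  have hr : Units.rank K = 0 := by
    rw [Units.rank, Nat.sub_eq_zero_iff_le, Fintype.card_le_one_iff]
    exact fun a b ↦ (hall a).trans (hall b).symm
  rw [regulator_eq_det K (InfinitePlace.mk σ) (Fintype.equivOfCardEq (by simp [hr])),
    Matrix.det_isEmpty, abs_one]

/-- If the two embeddings define distinct places, the field is real quadratic, and the regulator is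
the absolute value of a `1 × 1` determinant. -/
theorem exists_unit_abs_log_eq_regulator (hK : finrank ℚ K = 2)
    (h : ∀ ρ : K →+* ℂ, ρ = σ ∨ ρ = τ) (hmk : InfinitePlace.mk σ ≠ InfinitePlace.mk τ) :
    ∃ u : (𝓞 K)ˣ, |Real.log ‖σ u‖| = regulator K := by
  classical
  have hall (w : InfinitePlace K) : w = InfinitePlace.mk σ ∨ w = InfinitePlace.mk τ := by
    rw [← w.mk_embedding]
    rcases h w.embedding with h | h <;> rw [h] <;> simp
  have huniv : (Finset.univ : Finset (InfinitePlace K))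
      = {InfinitePlace.mk σ, InfinitePlace.mk τ} := by
    ext w; simpa using hall w
  have hmult : (InfinitePlace.mk σ).mult = 1 := by
    have := sum_mult_eq (K := K)
    rw [huniv, Finset.sum_pair hmk, hK] at this
    have h1 := (InfinitePlace.mk σ).mult_pos
    have h2 := (InfinitePlace.mk τ).mult_pos
    lia
  have hr : Units.rank K = 1 := by
    rw [Units.rank, ← Finset.card_univ, huniv, Finset.card_pair hmk]
  let : Unique {w // w ≠ InfinitePlace.mk τ} :=
    ⟨⟨⟨InfinitePlace.mk σ, hmk⟩⟩, fun w ↦ Subtype.ext ((hall w).resolve_right w.2)⟩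
  let e : {w // w ≠ InfinitePlace.mk τ} ≃ Fin (Units.rank K) :=
    Fintype.equivOfCardEq (by rw [Fintype.card_unique, Fintype.card_fin, hr])
  refine ⟨fundSystem K (e default), ?_⟩
  rw [regulator_eq_det K (InfinitePlace.mk τ) e, Matrix.det_unique, Matrix.of_apply]
  change _ = |((InfinitePlace.mk σ).mult : ℝ) * Real.log ((InfinitePlace.mk σ) _)|
  rw [hmult, Nat.cast_one, one_mul, InfinitePlace.apply]

theorem log_norm_unit_add (hne : σ ≠ τ) (h : ∀ ρ : K →+* ℂ, ρ = σ ∨ ρ = τ) (u : (𝓞 K)ˣ) :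
    Real.log ‖σ u‖ + Real.log ‖τ u‖ = 0 := by
  have hu (ρ : K →+* ℂ) : ‖ρ u‖ ≠ 0 := by simp
  rw [← Real.log_mul (hu _) (hu _), ← abs_norm_eq_mul hne h, Int.isUnit_iff_natAbs_eq.mp]
  · simp
  · exact u.isUnit.map (Algebra.norm ℤ)

/-- For a large discriminant a unit close to the unit circle at both places is rational, so the
fundamental unit of a real quadratic field is not small. -/
theorem one_le_regulator (hK : finrank ℚ K = 2) (hD : 4 * Real.exp 2 ≤ |(discr K : ℝ)|) :
    1 ≤ regulator K := by
  obtain ⟨σ, τ, hne, h⟩ := exists_embeddings_pair K hK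
  by_cases hmk : InfinitePlace.mk σ = InfinitePlace.mk τ
  · rw [regulator_eq_one_of_mk_eq h hmk]
  obtain ⟨u, hu⟩ := exists_unit_abs_log_eq_regulator hK h hmk
  have hpos := regulator_pos K
  have hadd := log_norm_unit_add hne h u
  by_contra! hlt
  -- a unit with `|log|` less than `1` has small conjugates, hence is rational, hence `±1`
  have hsmall (ρ : K →+* ℂ) : |Real.log ‖ρ u‖| < 1 := by
    rcases h ρ with rfl | rfl
    · rwa [hu]
    · rwa [eq_neg_of_add_eq_zero_right hadd, abs_neg, hu]
  obtain ⟨k, hk⟩ := exists_eq_intCast_of_norm_lt hK (α := (u : 𝓞 K)) fun ρ ↦ by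
    have h0 : 0 < ‖ρ u‖ := by simp
    have h1 : ‖ρ u‖ < Real.exp 1 := by
      rw [← Real.log_lt_iff_lt_exp h0]
      exact (abs_lt.mp (hsmall ρ)).2
    refine Real.lt_sqrt_of_sq_lt (lt_of_lt_of_le ?_ hD)
    rw [mul_pow, show (2 : ℝ) = 1 + 1 by norm_num, Real.exp_add]
    nlinarith
  have heq : ‖σ u‖ = ‖τ u‖ := by
    change ‖σ ((u : 𝓞 K) : K)‖ = ‖τ ((u : 𝓞 K) : K)‖
    rw [hk]
    simp
  rw [heq] at hadd hu
  rw [show Real.log ‖τ u‖ = 0 by linarith, abs_zero] at hu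
  linarith

/-- Multiplying by a unit moves `log ‖σ z‖ - log ‖τ z‖` into an interval of length `2 R`. -/
theorem exists_unit_log_sub_log_mem (hK : finrank ℚ K = 2) (hne : σ ≠ τ)
    (h : ∀ ρ : K →+* ℂ, ρ = σ ∨ ρ = τ) (x : 𝓞 K) {y : 𝓞 K} (hy : y ≠ 0) :
    ∃ u : (𝓞 K)ˣ, (Real.log ‖σ (u * y : 𝓞 K)‖ - Real.log ‖τ (u * y : 𝓞 K)‖)
      - (Real.log ‖σ x‖ - Real.log ‖τ x‖) ∈ Set.Icc 0 (2 * regulator K) := by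
  have hpos := regulator_pos K
  by_cases hmk : InfinitePlace.mk σ = InfinitePlace.mk τ
  · have heq (z : 𝓞 K) : ‖σ z‖ = ‖τ z‖ := by
      rw [← InfinitePlace.apply, ← InfinitePlace.apply, hmk]
    refine ⟨1, ?_⟩
    rw [heq, heq, sub_self, sub_self, sub_self]
    exact ⟨le_rfl, by positivity⟩
  obtain ⟨u, hu⟩ := exists_unit_abs_log_eq_regulator hK h hmk
  obtain ⟨v, hv⟩ : ∃ v : (𝓞 K)ˣ, Real.log ‖σ v‖ = regulator K := by
    rcases abs_choice (Real.log ‖σ u‖) with h | h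
    · exact ⟨u, by rw [← h, hu]⟩
    · refine ⟨u⁻¹, ?_⟩
      rw [← hu, h, ← Real.log_inv, ← norm_inv, ← map_inv₀]
      simp
  have hv' : Real.log ‖τ v‖ = - regulator K := by
    linarith [log_norm_unit_add hne h v]
  have hz (ρ : K →+* ℂ) (k : ℤ) : Real.log ‖ρ ((v ^ k : (𝓞 K)ˣ) * y : 𝓞 K)‖
      = k * Real.log ‖ρ v‖ + Real.log ‖ρ y‖ := by
    have h2 : ρ ((v ^ k : (𝓞 K)ˣ) * y : 𝓞 K) = ρ v ^ k * ρ y := by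
      change ρ (algebraMap (𝓞 K) K ((v ^ k : (𝓞 K)ˣ) * y)) = _
      rw [map_mul, map_mul, Units.coe_zpow, map_zpow₀]
    rw [h2, norm_mul, norm_zpow, Real.log_mul (zpow_ne_zero _ (by simp))
      (by simpa using hy), Real.log_zpow]
  set p := (Real.log ‖σ y‖ - Real.log ‖τ y‖) - (Real.log ‖σ x‖ - Real.log ‖τ x‖) with hp
  refine ⟨v ^ (-⌊p / (2 * regulator K)⌋), ?_⟩
  rw [hz, hz, hv, hv']
  have h1 := Int.floor_le (p / (2 * regulator K))
  have h2 := Int.lt_floor_add_one (p / (2 * regulator K))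
  rw [le_div_iff₀ (by positivity)] at h1
  rw [div_lt_iff₀ (by positivity)] at h2
  push_cast
  constructor <;> linarith

end QuadraticUnits

/-! ### Counting primitive ideals by the class of their `ℓ`-th power -/

section BoxArgument

open Ideal Module
open scoped nonZeroDivisors

variable {K : Type*} [Field K] [NumberField K]

/-- Two primitive ideals of small norm are equal as soon as the quotient of their `ℓ`-th powers has
a generator whose conjugates are nearly of the same size: after clearing denominators that generator
becomes an integer with small conjugates, so it is rational. -/
theorem IsPrimitiveIdeal.eq_of_abs_log_le (hK : finrank ℚ K = 2) {σ τ : K →+* ℂ} (hne : σ ≠ τ)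
    (h : ∀ ρ : K →+* ℂ, ρ = σ ∨ ρ = τ) {I J : Ideal (𝓞 K)} (hI : IsPrimitiveIdeal I)
    (hJ : IsPrimitiveIdeal J) {ℓ N : ℕ} (hℓ : Odd ℓ) (hIN : absNorm I ≤ N) (hJN : absNorm J ≤ N)
    (hN : 4 * Real.exp 1 * (N : ℝ) ^ (2 * ℓ) < |(discr K : ℝ)|) {x y : 𝓞 K} (hx : x ≠ 0)
    (hy : y ≠ 0) (hxy : span {x} * I ^ ℓ = span {y} * J ^ ℓ)
    (hlog : |(Real.log ‖σ y‖ - Real.log ‖τ y‖) - (Real.log ‖σ x‖ - Real.log ‖τ x‖)| ≤ 1) :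
    I = J := by
  set b := absNorm J with hb
  have hb0 : b ≠ 0 := absNorm_eq_zero_iff.not.mpr hJ.ne_zero
  obtain ⟨C, hC⟩ : J ∣ span {(b : 𝓞 K)} := dvd_iff_le.mpr (span_singleton_absNorm_le J)
  have hxα : span {x} * (I ^ ℓ * C ^ ℓ) = span {y * (b : 𝓞 K) ^ ℓ} := by
    rw [← span_singleton_mul_span_singleton, ← span_singleton_pow, hC, mul_pow, ← mul_assoc, hxy,
      mul_assoc]
  obtain ⟨α, hα⟩ : x ∣ y * (b : 𝓞 K) ^ ℓ := by
    rw [← span_singleton_le_span_singleton, ← hxα]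
    exact Ideal.mul_le_left
  have hα0 : α ≠ 0 := by
    rintro rfl
    rw [mul_zero] at hα
    exact mul_ne_zero hy (pow_ne_zero _ (by exact_mod_cast hb0)) hα
  have hspan : span {x} * span {α} = span {y} * span {(b : 𝓞 K)} ^ ℓ := by
    rw [span_singleton_mul_span_singleton, span_singleton_pow,
      span_singleton_mul_span_singleton, hα]
  have hNα : absNorm (span {α}) = absNorm I ^ ℓ * b ^ ℓ := by
    have h1 := congrArg absNorm hspan
    have h2 := congrArg absNorm hxy
    simp only [map_mul, map_pow, absNorm_span_natCast_of_quadratic hK] at h1 h2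
    have hx0 : absNorm (span {x}) ≠ 0 := by
      rw [Ne, absNorm_eq_zero_iff, span_singleton_eq_bot]; exact hx
    refine Nat.eq_of_mul_eq_mul_left (Nat.pos_of_ne_zero hx0) ?_
    rw [h1, ← mul_assoc, h2]
    ring
  have hprod : ‖σ α‖ * ‖τ α‖ ≤ (N : ℝ) ^ (2 * ℓ) := by
    rw [← abs_norm_eq_mul hne h, ← absNorm_span_singleton, hNα, two_mul, pow_add]
    push_cast
    gcongr
  have hnz (ρ : K →+* ℂ) {z : 𝓞 K} (hz : z ≠ 0) : ‖ρ z‖ ≠ 0 := by simpa using hz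
  have hlogα (ρ : K →+* ℂ) :
      Real.log ‖ρ x‖ + Real.log ‖ρ α‖ = Real.log ‖ρ y‖ + ℓ * Real.log b := by
    have h1 : ρ y * (b : ℂ) ^ ℓ = ρ x * ρ α := by
      have := congrArg (fun z : 𝓞 K ↦ ρ z) hα
      simpa using this
    rw [← Real.log_mul (hnz _ hx) (hnz _ hα0), ← norm_mul, ← h1, norm_mul,
      Real.log_mul (hnz _ hy) (by simpa using fun h ↦ absurd h hb0), norm_pow, Real.log_pow,
      Complex.norm_natCast]
  rw [show (Real.log ‖σ y‖ - Real.log ‖τ y‖) - (Real.log ‖σ x‖ - Real.log ‖τ x‖)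
    = Real.log ‖σ α‖ - Real.log ‖τ α‖ by linarith [hlogα σ, hlogα τ], abs_le] at hlog
  have hpos (ρ : K →+* ℂ) : 0 < ‖ρ α‖ := (norm_nonneg _).lt_of_ne' (hnz _ hα0)
  have hle {a c : ℝ} (ha : 0 < a) (hc : 0 < c) (hac : Real.log a - Real.log c ≤ 1) :
      a ≤ Real.exp 1 * c := by
    rw [← Real.log_le_log_iff ha (by positivity), Real.log_mul (Real.exp_ne_zero _) hc.ne',
      Real.log_exp]
    linarith
  have h1 : ‖σ α‖ ≤ Real.exp 1 * ‖τ α‖ := hle (hpos _) (hpos _) hlog.2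
  have h2 : ‖τ α‖ ≤ Real.exp 1 * ‖σ α‖ := hle (hpos _) (hpos _) (by linarith)
  obtain ⟨k, hk⟩ := exists_eq_intCast_of_norm_lt hK (α := α) fun ρ ↦ by
    have he := Real.exp_pos 1
    refine Real.lt_sqrt_of_sq_lt (lt_of_le_of_lt ?_ hN)
    have hm := mul_le_mul_of_nonneg_left hprod he.le
    rcases h ρ with rfl | rfl
    · nlinarith [mul_le_mul_of_nonneg_left h1 (hpos ρ).le]
    · nlinarith [mul_le_mul_of_nonneg_left h2 (hpos ρ).le]
  have hk0 : k.natAbs ≠ 0 := by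
    rw [Ne, Int.natAbs_eq_zero]
    rintro rfl
    exact hα0 (by simpa using hk)
  have hspank : span {α} = span {(k.natAbs : 𝓞 K)} := by
    rw [hk, span_singleton_eq_span_singleton]
    simpa using (Int.associated_natAbs k).map (Int.castRingHom (𝓞 K))
  refine hI.eq_of_pow hK hJ hℓ (x := b ^ ℓ) (y := k.natAbs) (pow_ne_zero _ hb0) hk0 ?_
  have hx' : span {x} ≠ 0 := by rw [zero_eq_bot, Ne, span_singleton_eq_bot]; exact hx
  refine mul_left_cancel₀ hx' ?_
  rw [← hspank, ← mul_assoc _ _ (J ^ ℓ), hspan, span_natCast_pow, mul_left_comm, hxy]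
  ring

variable (K) in
open Classical in
/-- The number of primitive ideals of norm at most `N` is at most `(2 R + 1) h / h_ℓ`. -/
theorem card_primitive_mul_classTorsionNumber_le (hK : finrank ℚ K = 2) {ℓ N : ℕ} (hℓ : Odd ℓ)
    (hN : 4 * Real.exp 1 * (N : ℝ) ^ (2 * ℓ) < |(discr K : ℝ)|) :
    (((idealsOfNormLE K N).filter IsPrimitiveIdeal).card : ℝ) * classTorsionNumber K ℓ
      ≤ classNumber K * (2 * Units.regulator K + 1) := by
  obtain ⟨σ, τ, hne, h⟩ := exists_embeddings_pair K hK
  have hR := Units.regulator_pos K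
  set S := (idealsOfNormLE K N).filter IsPrimitiveIdeal with hS
  let f : ClassGroup (𝓞 K) →* ClassGroup (𝓞 K) := powMonoidHom ℓ
  have hclass : Nat.card f.range * classTorsionNumber K ℓ = classNumber K := by
    rw [← Subgroup.index_ker, mul_comm, classTorsionNumber, classGroupTorsion,
      Subgroup.card_mul_index, classNumber, Nat.card_eq_fintype_card]
  have hprim (I : S) : IsPrimitiveIdeal I.1 := (Finset.mem_filter.mp I.2).2
  have hnorm (I : S) : absNorm I.1 ≤ N := (mem_idealsOfNormLE.mp (Finset.mem_filter.mp I.2).1).2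
  let I₀ (I : S) : (Ideal (𝓞 K))⁰ := ⟨I.1, mem_nonZeroDivisors_of_ne_zero (hprim I).ne_zero⟩
  let c (I : S) : f.range := ⟨f (ClassGroup.mk0 (I₀ I)), ⟨_, rfl⟩⟩
  -- a representative for the class of the `ℓ`-th power
  choose J hJ using fun z : f.range ↦ ClassGroup.mk0_surjective z.1
  have hex (I : S) : ∃ x y : 𝓞 K, x ≠ 0 ∧ y ≠ 0 ∧ span {x} * I.1 ^ ℓ = span {y} * (J (c I)).1 ∧
      (Real.log ‖σ y‖ - Real.log ‖τ y‖) - (Real.log ‖σ x‖ - Real.log ‖τ x‖)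
        ∈ Set.Icc 0 (2 * Units.regulator K) := by
    have hmk : ClassGroup.mk0 (I₀ I ^ ℓ) = ClassGroup.mk0 (J (c I)) := by
      rw [hJ, map_pow]; rfl
    obtain ⟨x, y, hx, hy, hxy⟩ := (ClassGroup.mk0_eq_mk0_iff).mp hmk
    obtain ⟨u, hu⟩ := exists_unit_log_sub_log_mem hK hne h x hy
    refine ⟨x, u * y, hx, mul_ne_zero u.ne_zero hy, ?_, hu⟩
    rw [show span {(u : 𝓞 K) * y} = span {y} from span_singleton_mul_left_unit u.isUnit y]
    exact hxy
  choose x y hx hy hxy hmem using hex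
  let p (I : S) : ℝ := (Real.log ‖σ (y I)‖ - Real.log ‖τ (y I)‖)
    - (Real.log ‖σ (x I)‖ - Real.log ‖τ (x I)‖)
  have hp (I : S) : ⌊p I⌋₊ < ⌊2 * Units.regulator K⌋₊ + 1 :=
    Nat.lt_succ_of_le (Nat.floor_le_floor (hmem I).2)
  let g (I : S) : f.range × Fin (⌊2 * Units.regulator K⌋₊ + 1) := (c I, ⟨⌊p I⌋₊, hp I⟩)
  have hg : Function.Injective g := by
    intro I I' e
    have hc : c I = c I' := congrArg Prod.fst e
    have hfl : ⌊p I⌋₊ = ⌊p I'⌋₊ := congrArg (fun z ↦ z.2.val) e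
    have hlog (ρ : K →+* ℂ) {z w : 𝓞 K} (hz : z ≠ 0) (hw : w ≠ 0) :
        Real.log ‖ρ (z * w : 𝓞 K)‖ = Real.log ‖ρ z‖ + Real.log ‖ρ w‖ := by
      change Real.log ‖ρ (algebraMap (𝓞 K) K (z * w))‖ = _
      rw [map_mul, map_mul, norm_mul, Real.log_mul (by simpa using hz) (by simpa using hw)]
    refine Subtype.ext ((hprim I).eq_of_abs_log_le hK hne h (hprim I') hℓ (hnorm I) (hnorm I') hN
      (x := y I' * x I) (y := y I * x I') (mul_ne_zero (hy I') (hx I))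
      (mul_ne_zero (hy I) (hx I')) ?_ ?_)
    · rw [← span_singleton_mul_span_singleton, ← span_singleton_mul_span_singleton, mul_assoc,
        mul_assoc, hxy, hxy, hc]
      exact mul_left_comm _ _ _
    · rw [hlog _ (hy I) (hx I'), hlog _ (hy I) (hx I'), hlog _ (hy I') (hx I),
        hlog _ (hy I') (hx I), abs_le]
      have h1 := Nat.floor_le (hmem I).1
      have h2 := Nat.floor_le (hmem I').1
      have h3 := Nat.lt_floor_add_one (p I)
      have h4 := Nat.lt_floor_add_one (p I')
      have hfl' : (⌊p I⌋₊ : ℝ) = ⌊p I'⌋₊ := by rw [hfl]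
      simp only [p] at h1 h2 h3 h4 hfl'
      constructor <;> linarith
  have hcard := Nat.card_le_card_of_injective g hg
  rw [Nat.card_prod, Nat.card_fin, Nat.card_eq_finsetCard] at hcard
  have h1 : (S.card : ℝ) ≤ Nat.card f.range * (⌊2 * Units.regulator K⌋₊ + 1) := by
    exact_mod_cast hcard
  have h2 := Nat.floor_le (mul_pos two_pos hR).le
  calc (S.card : ℝ) * classTorsionNumber K ℓ
      ≤ (Nat.card f.range * (2 * Units.regulator K + 1)) * classTorsionNumber K ℓ := by
        refine mul_le_mul_of_nonneg_right (h1.trans ?_) (Nat.cast_nonneg _)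
        gcongr
    _ = classNumber K * (2 * Units.regulator K + 1) := by
        rw [← hclass]; push_cast; ring

end BoxArgument

/-! ### Bounding the smoothed sum by the number of primitive ideals -/

section PrimitiveSums

open Ideal Module

variable {K : Type*} [Field K] [NumberField K]

open Classical in
/-- Every nonzero ideal is `(m) J` with `J` primitive, and then its norm is `m ^ 2 N(J)`. -/
theorem sum_gaussWeight_le_sum_primitive (hK : finrank ℚ K = 2) (T : ℝ) (N : ℕ) :
    ∑ I ∈ idealsOfNormLE K N, gaussWeight T (absNorm I)
      ≤ ∑ J ∈ (idealsOfNormLE K N).filter IsPrimitiveIdeal, ∑ m ∈ Finset.Icc 1 N,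
          gaussWeight T (m ^ 2 * absNorm J) := by
  have hex (I : Ideal (𝓞 K)) : ∃ x : Ideal (𝓞 K) × ℕ, I ≠ ⊥ →
      x.2 ≠ 0 ∧ IsPrimitiveIdeal x.1 ∧ I = span {(x.2 : 𝓞 K)} * x.1 := by
    by_cases hI : I = ⊥
    · exact ⟨(⊥, 0), fun h ↦ absurd hI h⟩
    · obtain ⟨m, J, hm, hJ, e⟩ := exists_eq_span_mul_primitive hI hK
      exact ⟨(J, m), fun _ ↦ ⟨hm, hJ, e⟩⟩
  choose i hi using hex
  have hnorm {I : Ideal (𝓞 K)} (hI : I ≠ ⊥) : absNorm I = (i I).2 ^ 2 * absNorm (i I).1 := by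
    conv_lhs => rw [(hi I hI).2.2]
    rw [map_mul, absNorm_span_natCast_of_quadratic hK]
  have hinj : Set.InjOn i (idealsOfNormLE K N : Set (Ideal (𝓞 K))) := by
    intro I hI I' hI' e
    rw [(hi I (mem_idealsOfNormLE.mp hI).1).2.2, (hi I' (mem_idealsOfNormLE.mp hI').1).2.2, e]
  rw [← Finset.sum_product', Finset.sum_congr rfl fun I hI ↦ by
    rw [hnorm (mem_idealsOfNormLE.mp hI).1],
    ← Finset.sum_image (f := fun x : Ideal (𝓞 K) × ℕ ↦ gaussWeight T (x.2 ^ 2 * absNorm x.1)) hinj]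
  refine Finset.sum_le_sum_of_subset_of_nonneg (fun x hx ↦ ?_) fun _ _ _ ↦ (gaussWeight_pos _ _).le
  obtain ⟨I, hI, rfl⟩ := Finset.mem_image.mp hx
  obtain ⟨h0, hN⟩ := mem_idealsOfNormLE.mp hI
  obtain ⟨hm, hJ, -⟩ := hi I h0
  have hJ1 : 1 ≤ absNorm (i I).1 :=
    Nat.one_le_iff_ne_zero.mpr (absNorm_eq_zero_iff.not.mpr hJ.ne_zero)
  have hm1 : 1 ≤ (i I).2 := Nat.one_le_iff_ne_zero.mpr hm
  rw [hnorm h0] at hN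
  refine Finset.mem_product.mpr ⟨Finset.mem_filter.mpr
    ⟨mem_idealsOfNormLE.mpr ⟨hJ.ne_zero, ?_⟩, hJ⟩,
    Finset.mem_Icc.mpr ⟨hm1, ?_⟩⟩
  · exact (Nat.le_mul_of_pos_left _ (by positivity)).trans hN
  · exact (Nat.le_self_pow two_ne_zero _).trans ((Nat.le_mul_of_pos_right _ hJ1).trans hN)

theorem sum_gaussWeight_sq_mul_le {T : ℝ} (hT : 0 < T) {s : ℝ} (hs : 3 / 4 ≤ s) (N : ℕ) {n : ℕ}
    (hn : n ≠ 0) : ∑ m ∈ Finset.Icc 1 N, gaussWeight T (m ^ 2 * n)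
      ≤ (∑' m : ℕ, (m : ℝ) ^ (-(3 / 2) : ℝ)) * (Real.exp (T * s ^ 2 / 2) * (n : ℝ) ^ (-s)) := by
  have hsum : Summable fun m : ℕ ↦ (m : ℝ) ^ (-(3 / 2) : ℝ) :=
    Real.summable_nat_rpow.mpr (by norm_num)
  refine le_trans ?_ (mul_le_mul_of_nonneg_right
    (hsum.sum_le_tsum (Finset.Icc 1 N) fun m _ ↦ by positivity) (by positivity))
  rw [Finset.sum_mul]
  refine Finset.sum_le_sum fun m hm ↦ ?_
  have hm1 : 1 ≤ m := (Finset.mem_Icc.mp hm).1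
  have hm1' : (1 : ℝ) ≤ m := by exact_mod_cast hm1
  refine (gaussWeight_le hT s (by positivity)).trans ?_
  rw [Nat.cast_mul, Nat.cast_pow, Real.mul_rpow (by positivity) (by positivity), mul_left_comm,
    ← Real.rpow_natCast, ← Real.rpow_mul (by positivity)]
  have : (m : ℝ) ^ (((2 : ℕ) : ℝ) * -s) ≤ (m : ℝ) ^ (-(3 / 2) : ℝ) :=
    Real.rpow_le_rpow_of_exponent_le hm1' (by push_cast; linarith)
  gcongr

open Classical in
/-- The primitive ideals of norm at most `exp ((1 - c) T)` contribute little, by Rankin's trick, and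
so do the ideals of norm greater than `exp ((1 + c) T)`; hence the smoothed sum is controlled by the
number of primitive ideals of norm in between. -/
theorem exists_norm_tsum_gaussWeight_le {c : ℝ} (hc0 : 0 < c) (hc : c ≤ 1 / 4) :
    ∃ B > 0, ∀ (K : Type*) [Field K] [NumberField K], finrank ℚ K = 2 →
      ∀ T : ℝ, 0 < T → ∀ N : ℕ, Real.exp ((1 + c) * T) ≤ N →
        ‖∑' n, (quadraticFieldChar K).zetaMul n * gaussWeight T n‖
          ≤ Real.exp (T / 2) * (B * Real.exp (-(c ^ 2 / 4 * T)) + B * Real.exp (-((1 - c) * T))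
            * ((idealsOfNormLE K N).filter IsPrimitiveIdeal).card) := by
  -- small enough for both applications of Rankin's trick to save a factor `exp (-c ^ 2 T / 4)`
  obtain ⟨δ, hδ⟩ : ∃ δ : ℝ, δ = c ^ 2 / 8 := ⟨_, rfl⟩
  have hδ0 : 0 < δ := by rw [hδ]; positivity
  have hδc : δ ≤ c := by rw [hδ]; nlinarith
  obtain ⟨Δ, hΔ⟩ : ∃ Δ : ℝ, Δ = ∑' n : ℕ, (n.divisors.card : ℝ) * (n : ℝ) ^ (-(1 + δ)) := ⟨_, rfl⟩
  obtain ⟨Z, hZ⟩ : ∃ Z : ℝ, Z = ∑' m : ℕ, (m : ℝ) ^ (-(3 / 2) : ℝ) := ⟨_, rfl⟩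
  have hΔ0 : 0 ≤ Δ := by rw [hΔ]; exact tsum_nonneg fun _ ↦ by positivity
  have hZ0 : 0 ≤ Z := by rw [hZ]; exact tsum_nonneg fun _ ↦ by positivity
  refine ⟨Δ + Z * Δ + Z + 1, by positivity, fun K _ _ hK T hT N hN ↦ ?_⟩
  have hN0 : (0 : ℝ) < N := (Real.exp_pos _).trans_le hN
  have hN1 : 1 ≤ N := by exact_mod_cast hN0
  set P := (idealsOfNormLE K N).filter IsPrimitiveIdeal with hP
  set Y := Real.exp ((1 - c) * T) with hY
  have h1 := norm_tsum_zetaMul_gaussWeight_le hK hT hδ0 (σ := 1 + c) (by linarith) hN1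
  rw [← hΔ] at h1
  -- the ideals of large norm
  have htail : Real.exp (T * (1 + c) ^ 2 / 2) * (N : ℝ) ^ (-(1 + c - 1 - δ))
      ≤ Real.exp (T / 2) * Real.exp (-(c ^ 2 / 4 * T)) := by
    have : (N : ℝ) ^ (-(1 + c - 1 - δ)) ≤ Real.exp ((1 + c) * T) ^ (-(1 + c - 1 - δ)) :=
      Real.rpow_le_rpow_of_nonpos (Real.exp_pos _) hN (by linarith)
    refine (mul_le_mul_of_nonneg_left this (Real.exp_pos _).le).trans ?_
    rw [← Real.exp_mul, ← Real.exp_add, ← Real.exp_add, Real.exp_le_exp]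
    have : (1 + c) * δ ≤ c ^ 2 / 4 := by rw [hδ]; nlinarith
    nlinarith
  -- the primitive ideals of small norm
  have hlow : Real.exp (T * (1 - c) ^ 2 / 2) * Y ^ (c + δ)
      ≤ Real.exp (T / 2) * Real.exp (-(c ^ 2 / 4 * T)) := by
    rw [hY, ← Real.exp_mul, ← Real.exp_add, ← Real.exp_add, Real.exp_le_exp]
    have : (1 - c) * δ ≤ c ^ 2 / 4 := by rw [hδ]; nlinarith
    nlinarith
  have hterm (J : Ideal (𝓞 K)) (hJ : J ∈ P) :
      ∑ m ∈ Finset.Icc 1 N, gaussWeight T (m ^ 2 * absNorm J)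
        ≤ Z * (Real.exp (T / 2) * Real.exp (-(c ^ 2 / 4 * T))) * (absNorm J : ℝ) ^ (-(1 + δ))
          + Z * (Real.exp (T / 2) * Real.exp (-((1 - c) * T))) := by
    have hn : absNorm J ≠ 0 :=
      absNorm_eq_zero_iff.not.mpr (mem_idealsOfNormLE.mp (Finset.mem_filter.mp hJ).1).1
    have hn0 : (0 : ℝ) < absNorm J := by exact_mod_cast Nat.pos_of_ne_zero hn
    rcases le_or_gt (absNorm J : ℝ) Y with h | h
    · refine le_add_of_le_of_nonneg ?_ (by positivity)
      refine (sum_gaussWeight_sq_mul_le hT (s := 1 - c) (by linarith) N hn).trans ?_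
      rw [← hZ, mul_assoc]
      refine mul_le_mul_of_nonneg_left ?_ hZ0
      rw [show -(1 - c) = (c + δ) + -(1 + δ) by ring, Real.rpow_add hn0, ← mul_assoc]
      refine mul_le_mul_of_nonneg_right (le_trans ?_ hlow) (by positivity)
      refine mul_le_mul_of_nonneg_left ?_ (Real.exp_pos _).le
      exact Real.rpow_le_rpow hn0.le h (by linarith)
    · refine le_add_of_nonneg_of_le (by positivity) ?_
      refine (sum_gaussWeight_sq_mul_le hT (s := 1) (by norm_num) N hn).trans ?_
      rw [← hZ, one_pow, mul_one, Real.rpow_neg_one, Real.exp_neg, ← hY]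
      gcongr
  have hmain : ∑ I ∈ idealsOfNormLE K N, gaussWeight T (absNorm I)
      ≤ Z * (Real.exp (T / 2) * Real.exp (-(c ^ 2 / 4 * T))) * Δ
        + Z * (Real.exp (T / 2) * Real.exp (-((1 - c) * T))) * P.card := by
    refine (sum_gaussWeight_le_sum_primitive hK T N).trans ((Finset.sum_le_sum hterm).trans ?_)
    rw [Finset.sum_add_distrib, ← Finset.mul_sum, Finset.sum_const, nsmul_eq_mul,
      mul_comm (P.card : ℝ)]
    gcongr
    rw [hΔ]
    refine le_trans ?_ (sum_absNorm_rpow_le hK (σ := 1 + δ) (by linarith) N)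
    exact Finset.sum_le_sum_of_subset_of_nonneg (Finset.filter_subset _ _) fun _ _ _ ↦ by positivity
  have htail' := mul_le_mul_of_nonneg_right htail hΔ0
  have e1 : 0 ≤ Real.exp (T / 2) * Real.exp (-(c ^ 2 / 4 * T)) := by positivity
  have e2 : 0 ≤ Real.exp (T / 2) * Real.exp (-((1 - c) * T)) * P.card := by positivity
  have e3 := mul_nonneg (add_nonneg hZ0 zero_le_one) e1
  have e4 := mul_nonneg (add_nonneg (add_nonneg hΔ0 (mul_nonneg hZ0 hΔ0)) zero_le_one) e2
  linarith

end PrimitiveSums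

/-! ### A crude bound for the class number -/

section ClassNumberBound

open Ideal Module

/-- By Minkowski's bound every class contains an ideal of norm `O(√|Δ|)`, and there are `O(N ^ 2)` ideals of norm at most
`N`. -/
theorem exists_classNumber_le : ∃ C : ℝ, ∀ (K : Type*) [Field K] [NumberField K],
    finrank ℚ K = 2 → (classNumber K : ℝ) ≤ C * |(discr K : ℝ)| := by
  obtain ⟨Δ, hΔ⟩ : ∃ Δ : ℝ, Δ = ∑' n : ℕ, (n.divisors.card : ℝ) * (n : ℝ) ^ (-(2 : ℝ)) := ⟨_, rfl⟩
  have hΔ0 : 0 ≤ Δ := by rw [hΔ]; exact tsum_nonneg fun _ ↦ by positivity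
  refine ⟨Δ * 4, fun K _ _ hK ↦ ?_⟩
  have hD : (1 : ℝ) ≤ |(discr K : ℝ)| := by
    exact_mod_cast Int.one_le_abs (discr_ne_zero K)
  choose I hI hN using exists_ideal_in_class_of_norm_le (K := K)
  set N := ⌊2 * √|(discr K : ℝ)|⌋₊ with hNdef
  have hs : 1 ≤ √|(discr K : ℝ)| := Real.one_le_sqrt.mpr hD
  have hle (c : ClassGroup (𝓞 K)) : absNorm (I c : Ideal (𝓞 K)) ≤ N := by
    refine Nat.le_floor ((hN c).trans ?_)
    have hr : InfinitePlace.nrComplexPlaces K ≤ 1 := by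
      have := InfinitePlace.card_add_two_mul_card_eq_rank K
      lia
    have hπ : 1 ≤ 4 / Real.pi := by rw [one_le_div Real.pi_pos]; exact Real.pi_le_four
    have hπ' : 4 / Real.pi ≤ 4 := div_le_self (by norm_num) (by linarith [Real.pi_gt_three])
    have h1 : (4 / Real.pi) ^ InfinitePlace.nrComplexPlaces K ≤ 4 :=
      (pow_le_pow_right₀ hπ hr).trans (by rwa [pow_one])
    rw [hK]
    refine (mul_le_mul_of_nonneg_right h1 (by positivity)).trans_eq ?_
    norm_num [Nat.factorial]
    ring
  have hinj : Function.Injective fun c ↦ (I c : Ideal (𝓞 K)) := fun c d e ↦ by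
    rw [← hI c, ← hI d, Subtype.ext e]
  have hN1 : 1 ≤ N := Nat.le_floor (by push_cast; linarith)
  have hcard : classNumber K ≤ (idealsOfNormLE K N).card := by
    rw [classNumber, ← Finset.card_univ]
    refine Finset.card_le_card_of_injOn (fun c ↦ (I c : Ideal (𝓞 K))) (fun c _ ↦ ?_)
      hinj.injOn
    exact mem_idealsOfNormLE.mpr ⟨nonZeroDivisors.coe_ne_zero _, hle c⟩
  have hNle : (N : ℝ) ≤ 2 * √|(discr K : ℝ)| := Nat.floor_le (by positivity)
  calc (classNumber K : ℝ) ≤ (idealsOfNormLE K N).card := by exact_mod_cast hcard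
    _ ≤ Δ * (N : ℝ) ^ 2 := by rw [hΔ]; exact card_idealsOfNormLE_le hK hN1
    _ ≤ Δ * (2 * √|(discr K : ℝ)|) ^ 2 := by gcongr
    _ = Δ * 4 * |(discr K : ℝ)| := by
      rw [mul_pow, Real.sq_sqrt (abs_nonneg _)]; ring

end ClassNumberBound

/-! ### The bound for the `ℓ`-torsion -/

section TorsionBound

open Ideal Module Filter Topology

variable {K : Type*} [Field K] [NumberField K]

/-- By the class number formula, `h R ≤ 2 √|Δ| |L(1, χ)|`. -/
theorem classNumber_mul_regulator_le (hK : finrank ℚ K = 2) (hD : 4 < |(discr K : ℝ)|) :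
    classNumber K * Units.regulator K
      ≤ 2 * √|(discr K : ℝ)| * ‖(quadraticFieldChar K).LFunction 1‖ := by
  have hw : (Units.torsionOrder K : ℝ) ≤ 2 := by exact_mod_cast torsionOrder_le_two hK hD
  have hw0 : (0 : ℝ) < Units.torsionOrder K := by exact_mod_cast Units.torsionOrder_pos K
  have hs : 0 < √|(discr K : ℝ)| := Real.sqrt_pos.mpr (by linarith)
  have hR := Units.regulator_pos K
  rw [← dedekindZeta_residue_eq hK, Complex.norm_real,
    Real.norm_of_nonneg (dedekindZeta_residue_pos K).le, dedekindZeta_residue_def]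
  have h1 : (1 : ℝ) ≤ 2 ^ InfinitePlace.nrRealPlaces K
      * (2 * Real.pi) ^ InfinitePlace.nrComplexPlaces K :=
    one_le_mul_of_one_le_of_one_le (one_le_pow₀ one_le_two)
      (one_le_pow₀ (by linarith [Real.pi_gt_three]))
  rw [mul_div_assoc', le_div_iff₀ (by positivity)]
  have h2 : classNumber K * Units.regulator K * √|(discr K : ℝ)| * Units.torsionOrder K
      ≤ classNumber K * Units.regulator K * √|(discr K : ℝ)| * 2 := by gcongr
  have h3 := mul_le_mul_of_nonneg_right h1
    (show 0 ≤ classNumber K * Units.regulator K * √|(discr K : ℝ)| * 2 by positivity)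
  nlinarith

open Classical in
/-- If there are `P ≥ |L(1, χ)| / M` primitive ideals of norm at most `N`, then
`h_ℓ ≤ h (2 R + 1) / P`, and the class number formula cancels `h R` against `|L(1, χ)|`. -/
theorem classTorsionNumber_le_of_norm_le (hK : finrank ℚ K = 2) {ℓ N : ℕ} (hℓ : Odd ℓ)
    (hD : 4 * Real.exp 2 ≤ |(discr K : ℝ)|)
    (hN : 4 * Real.exp 1 * (N : ℝ) ^ (2 * ℓ) < |(discr K : ℝ)|) {M : ℝ} (hM : 0 < M)
    (hL : ‖(quadraticFieldChar K).LFunction 1‖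
      ≤ M * ((idealsOfNormLE K N).filter IsPrimitiveIdeal).card) :
    (classTorsionNumber K ℓ : ℝ) ≤ 6 * M * √|(discr K : ℝ)| := by
  have hD4 : 4 < |(discr K : ℝ)| := by
    have := Real.add_one_lt_exp (x := 2) (by norm_num)
    linarith
  have hR := one_le_regulator hK hD
  obtain ⟨P, hP⟩ : ∃ P : ℝ, P = ((idealsOfNormLE K N).filter IsPrimitiveIdeal).card := ⟨_, rfl⟩
  rw [← hP] at hL
  have h1 : P * classTorsionNumber K ℓ ≤ classNumber K * (2 * Units.regulator K + 1) := by
    rw [hP]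
    exact card_primitive_mul_classTorsionNumber_le K hK hℓ hN
  have h2 := classNumber_mul_regulator_le hK hD4
  have hL0 : 0 < ‖(quadraticFieldChar K).LFunction 1‖ := by
    rw [norm_pos_iff, ← dedekindZeta_residue_eq hK]
    exact_mod_cast dedekindZeta_residue_ne_zero K
  have hP0 : 0 < P := pos_of_mul_pos_right (hL0.trans_le hL) hM.le
  refine le_of_mul_le_mul_left ?_ hP0
  have hs := Real.sqrt_nonneg |(discr K : ℝ)|
  have h3 : (classNumber K : ℝ) ≤ classNumber K * Units.regulator K :=
    le_mul_of_one_le_right (Nat.cast_nonneg _) hR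
  have h4 := mul_le_mul_of_nonneg_left hL hs
  nlinarith

/-- The error of the contour shift and the contribution of the ideals of extreme norm, both relative
to `exp (T / 2)` with `T = a log D`, are eventually smaller than Siegel's lower bound for `L(1, χ)`. -/
theorem eventually_error_le {a κ ξ η c A B C s : ℝ} (hξ : 0 < ξ) (ha : 0 < a) (hη : 0 < η)
    (h1 : ξ + 2 * η < a * κ) (h2 : η < a * (c ^ 2 / 4)) (hs : 0 < s) :
    ∀ᶠ D : ℝ in atTop, C * √(a * Real.log D) * (1 + A * D ^ ξ) * D ^ (-(a * κ))
      + B * D ^ (-(a * (c ^ 2 / 4))) ≤ s * D ^ (-η) / 4 := by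
  have hneg {r : ℝ} (hr : r < 0) : Tendsto (fun D : ℝ ↦ D ^ r) atTop (𝓝 0) := by
    simpa using tendsto_rpow_neg_atTop (neg_pos.mpr hr)
  have hlog : Tendsto (fun D : ℝ ↦ √(a * Real.log D) * D ^ (-η)) atTop (𝓝 0) := by
    have h := (isLittleO_log_rpow_rpow_atTop (1 / 2) hη).tendsto_div_nhds_zero.const_mul √a
    rw [mul_zero] at h
    refine h.congr' ?_
    filter_upwards [eventually_gt_atTop 0] with D hD
    rw [Real.sqrt_mul ha.le, Real.sqrt_eq_rpow (Real.log D), Real.rpow_neg hD.le]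
    ring
  have hlim := (hlog.mul (((hneg (r := 2 * η - a * κ) (by linarith)).const_mul C).add
    ((hneg (r := ξ + 2 * η - a * κ) (by linarith)).const_mul (C * A)))).add
    ((hneg (r := η - a * (c ^ 2 / 4)) (by linarith)).const_mul B)
  simp only [mul_zero, add_zero] at hlim
  filter_upwards [hlim.eventually_le_const (show 0 < s / 4 by positivity), eventually_gt_atTop 0]
    with D h hD
  have hη' := Real.rpow_pos_of_pos hD (-η)
  have h' := mul_le_mul_of_nonneg_right h hη'.le
  have e1 : D ^ (2 * η - a * κ) * D ^ (-η) * D ^ (-η) = D ^ (-(a * κ)) := by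
    rw [← Real.rpow_add hD, ← Real.rpow_add hD]; ring_nf
  have e2 : D ^ (ξ + 2 * η - a * κ) * D ^ (-η) * D ^ (-η) = D ^ ξ * D ^ (-(a * κ)) := by
    rw [← Real.rpow_add hD, ← Real.rpow_add hD, ← Real.rpow_add hD]; ring_nf
  have e3 : D ^ (η - a * (c ^ 2 / 4)) * D ^ (-η) = D ^ (-(a * (c ^ 2 / 4))) := by
    rw [← Real.rpow_add hD]; ring_nf
  calc _ = (√(a * Real.log D) * D ^ (-η) * (C * D ^ (2 * η - a * κ)
          + C * A * D ^ (ξ + 2 * η - a * κ)) + B * D ^ (η - a * (c ^ 2 / 4))) * D ^ (-η) := by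
        linear_combination (-C * √(a * Real.log D)) * e1
          - C * A * √(a * Real.log D) * e2 - B * e3
    _ ≤ s / 4 * D ^ (-η) := h'
    _ = s * D ^ (-η) / 4 := by ring

/-- With `|Δ| = D`, the smoothing length is `x = D ^ a` with `a` slightly less than `1 / (2 ℓ)`, and
`D ^ η` is what is lost in Siegel's theorem. -/
theorem exists_exponents {l ξ κ ε : ℝ} (hl : 1 ≤ l) (hκ : 0 < κ)
    (hξκ : 2 * l * ξ < κ) (hε : 0 < ε) :
    ∃ c a η : ℝ, 0 < c ∧ c ≤ 1 / 4 ∧ 0 < a ∧ 0 < η ∧ a * (1 + c) * (2 * l) < 1 ∧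
      ξ + 2 * η < a * κ ∧ η < a * (c ^ 2 / 4) ∧ 1 / (2 * l) - ε ≤ a * (1 - c) := by
  obtain ⟨c, hc0, hc4, hcε, hcξ⟩ : ∃ c : ℝ, 0 < c ∧ c ≤ 1 / 4 ∧ 2 * c ≤ ε ∧
      2 * l * ξ < (1 - 2 * c) * κ := by
    have h0 : 2 * l * ξ / κ < 1 := (div_lt_one hκ).mpr hξκ
    obtain ⟨c, hc0, hc⟩ := exists_between (show 0 < min (1 / 4) (min (ε / 2)
      ((1 - 2 * l * ξ / κ) / 2)) from lt_min (by norm_num) (lt_min (by linarith) (by linarith)))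
    rw [lt_min_iff, lt_min_iff] at hc
    have h2 : 2 * l * ξ / κ * κ = 2 * l * ξ := div_mul_cancel₀ _ hκ.ne'
    have h3 := mul_lt_mul_of_pos_right hc.2.2 hκ
    exact ⟨c, hc0, hc.1.le, by linarith, by linarith⟩
  obtain ⟨a, ha⟩ : ∃ a : ℝ, a = (1 - 2 * c) / (2 * l) := ⟨_, rfl⟩
  have hal : a * (2 * l) = 1 - 2 * c := by rw [ha]; field_simp
  have ha0 : 0 < a := by rw [ha]; exact div_pos (by linarith) (by linarith)
  have haκ : ξ < a * κ := by
    rw [ha, div_mul_eq_mul_div, lt_div_iff₀ (by linarith)]; linarith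
  obtain ⟨η, hη0, hη⟩ := exists_between (show 0 < min ((a * κ - ξ) / 2) (a * (c ^ 2 / 4)) from
    lt_min (by linarith) (by positivity))
  rw [lt_min_iff] at hη
  refine ⟨c, a, η, hc0, hc4, ha0, hη0, ?_, by linarith [hη.1], hη.2, ?_⟩
  · have : a * (1 + c) * (2 * l) = (1 - 2 * c) * (1 + c) := by rw [← hal]; ring
    rw [this]
    nlinarith
  · rw [sub_le_iff_le_add, div_le_iff₀ (by linarith)]
    have h1 : (a * (1 - c) + ε) * (2 * l) = (1 - 2 * c) * (1 - c) + 2 * (ε * l) := by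
      rw [← hal]; ring
    have h2 : ε ≤ ε * l := le_mul_of_one_le_right hε.le hl
    rw [h1]
    nlinarith [sq_nonneg c]

/-- The length `N = D ^ b` with `b < 1 / (2 ℓ)` is admissible in
`card_primitive_mul_classTorsionNumber_le`. -/
theorem eventually_box_lt {b : ℝ} (hb : 0 < b) {ℓ : ℕ} (h : b * (2 * ℓ) < 1) :
    ∀ᶠ D : ℝ in atTop, 4 * Real.exp 1 * (⌈D ^ b⌉₊ : ℝ) ^ (2 * ℓ) < D := by
  have hlim := (tendsto_rpow_neg_atTop (y := 1 - b * (2 * ℓ)) (by linarith)).const_mul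
    (4 * Real.exp 1 * 2 ^ (2 * ℓ))
  rw [mul_zero] at hlim
  filter_upwards [hlim.eventually_lt_const one_pos, eventually_ge_atTop 1] with D hD hD1
  have hD0 : 0 < D := by linarith
  have h1 : 1 ≤ D ^ b := Real.one_le_rpow hD1 hb.le
  have h2 : (⌈D ^ b⌉₊ : ℝ) ≤ 2 * D ^ b := by
    have := Nat.ceil_lt_add_one (show 0 ≤ D ^ b by positivity)
    linarith
  calc 4 * Real.exp 1 * (⌈D ^ b⌉₊ : ℝ) ^ (2 * ℓ) ≤ 4 * Real.exp 1 * (2 * D ^ b) ^ (2 * ℓ) := by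
        gcongr
    _ = 4 * Real.exp 1 * 2 ^ (2 * ℓ) * D ^ (-(1 - b * (2 * ℓ))) * D := by
        rw [mul_pow, ← Real.rpow_natCast (D ^ b), ← Real.rpow_mul hD0.le, mul_assoc _ _ D,
          ← Real.rpow_add_one hD0.ne']
        push_cast
        ring_nf
    _ < 1 * D := mul_lt_mul_of_pos_right hD hD0
    _ = D := one_mul D

end TorsionBound

theorem mainTheorem1 (ℓ : ℕ) (hℓ : ℓ.Prime) (hℓ3 : 3 ≤ ℓ)
    (θ : ℝ) (hθ : θ ∈ Set.Ioo (0 : ℝ) (1 / 2))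
    (ξ : ℝ) (hξ0 : 0 < ξ) (hξ : ξ < (2 * θ - θ ^ 2) / (4 * (ℓ : ℝ)))
    (A : ℝ) (ε : ℝ) (hε : 0 < ε) :
    ∃ C : ℝ, ∀ (K : Type*) [Field K] [NumberField K], Module.finrank ℚ K = 2 →
      (∀ σ t : ℝ, 1 - θ ≤ σ → |t| ≤ 1 →
        ‖(quadraticFieldChar K).LFunction ((σ : ℂ) + (t : ℂ) * Complex.I)‖
          ≤ A * |(discr K : ℝ)| ^ ξ) →
      (classTorsionNumber K ℓ : ℝ) ≤ C * |(discr K : ℝ)| ^ ((1 : ℝ) / 2 - 1 / (2 * (ℓ : ℝ)) + ε) := by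
  have hℓ0 : (0 : ℝ) < ℓ := by exact_mod_cast hℓ.pos
  have hodd : Odd ℓ := hℓ.odd_of_ne_two (by lia)
  -- the exponent saved by moving the contour: `(1 - θ) ^ 2 / 2 = 1 / 2 - κ`
  obtain ⟨κ, hκ⟩ : ∃ κ : ℝ, κ = (2 * θ - θ ^ 2) / 2 := ⟨_, rfl⟩
  have hκ0 : 0 < κ := by rw [hκ]; nlinarith [hθ.1, hθ.2]
  have hξκ : 2 * ℓ * ξ < κ := by
    rw [lt_div_iff₀ (by positivity)] at hξ
    rw [hκ]; linarith
  obtain ⟨c, a, η, hc0, hc4, ha0, hη0, hbox, hη1, hη2, hexpo⟩ :=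
    exists_exponents (by exact_mod_cast hℓ.one_lt.le) hκ0 hξκ hε
  obtain ⟨s, hs0, hs⟩ := DirichletCharacter.exists_le_norm_LFunction_one hη0
  obtain ⟨C₁, hC₁0, hC₁⟩ := exists_norm_tsum_zetaMul_sub_le hθ
  obtain ⟨B, hB0, hB⟩ := exists_norm_tsum_gaussWeight_le hc0 hc4
  obtain ⟨C₀, hC₀⟩ := exists_classNumber_le
  obtain ⟨D₀, hD₀⟩ := Filter.eventually_atTop.mp
    ((eventually_error_le (A := A) (B := B) (C := C₁) hξ0 ha0 hη0 hη1 hη2 hs0).and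
      ((eventually_box_lt (by positivity) hbox).and
        ((Filter.eventually_ge_atTop (Real.exp (1 / a))).and
          (Filter.eventually_ge_atTop (4 * Real.exp 2)))))
  have hE0 : (0 : ℝ) ≤ 1 / 2 - 1 / (2 * ℓ) + ε := by
    have : 1 / (2 * (ℓ : ℝ)) ≤ 1 / 2 := by
      refine one_div_le_one_div_of_le two_pos ?_
      have : (1 : ℝ) ≤ ℓ := by exact_mod_cast hℓ.one_lt.le
      linarith
    linarith
  refine ⟨max (6 * (4 * B)) (|C₀| * D₀), fun K _ _ hK hbound ↦ ?_⟩
  set D : ℝ := |(discr K : ℝ)| with hDdef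
  have hD1 : 1 ≤ D := by
    rw [hDdef]
    exact_mod_cast Int.one_le_abs (discr_ne_zero K)
  have hD0 : 0 < D := one_pos.trans_le hD1
  rcases le_or_gt D₀ D with hDD | hDD
  swap
  · -- for bounded discriminants the trivial bound by the class number suffices
    have h1 : (classTorsionNumber K ℓ : ℝ) ≤ classNumber K := by
      rw [classTorsionNumber, classNumber, ← Nat.card_eq_fintype_card]
      exact_mod_cast Subgroup.card_le_card_group _
    calc (classTorsionNumber K ℓ : ℝ) ≤ C₀ * D := h1.trans (hC₀ K hK)
      _ ≤ |C₀| * D₀ := mul_le_mul (le_abs_self _) hDD.le hD0.le (abs_nonneg _)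
      _ ≤ |C₀| * D₀ * D ^ ((1 : ℝ) / 2 - 1 / (2 * (ℓ : ℝ)) + ε) :=
        le_mul_of_one_le_right (mul_nonneg (abs_nonneg _) (hD0.le.trans hDD.le))
          (Real.one_le_rpow hD1 hE0)
      _ ≤ _ := mul_le_mul_of_nonneg_right (le_max_right _ _) (by positivity)
  obtain ⟨herr, hN, hDa, hDe⟩ := hD₀ D hDD
  set χ := quadraticFieldChar K with hχ
  set N := ⌈D ^ (a * (1 + c))⌉₊ with hNdef
  obtain ⟨T, hT⟩ : ∃ T : ℝ, T = a * Real.log D := ⟨_, rfl⟩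
  have hT1 : 1 ≤ T := by
    have := (Real.le_log_iff_exp_le hD0).mpr hDa
    rw [div_le_iff₀ ha0] at this
    linarith
  have hexp (r : ℝ) : Real.exp (r * T) = D ^ (a * r) := by
    rw [Real.rpow_def_of_pos hD0, hT]
    ring_nf
  have hNT : Real.exp ((1 + c) * T) ≤ N := by rw [hexp]; exact Nat.le_ceil _
  have hχ1 := quadraticFieldChar_ne_one hK
  have hupper := hB K hK T (by linarith) N hNT
  have hlower := hC₁ (discr K).natAbs χ (A * D ^ ξ) T hχ1 hT1 hbound
  have hzeta := half_exp_le_tsum_gaussWeight (T := T) (by linarith)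
  have hsiegel := hs (discr K).natAbs χ quadraticFieldChar_sq hχ1
  rw [show (((discr K).natAbs : ℕ) : ℝ) = D by rw [hDdef, Nat.cast_natAbs, Int.cast_abs]] at hsiegel
  set L := ‖χ.LFunction 1‖ with hL
  classical
  obtain ⟨P, hP⟩ : ∃ P : ℝ, P = ((idealsOfNormLE K N).filter IsPrimitiveIdeal).card := ⟨_, rfl⟩
  -- divide the comparison of the two evaluations of the smoothed sum by `exp (T / 2)`
  have hmain : L / 2 ≤ (C₁ * √T * (1 + A * D ^ ξ) * Real.exp (-κ * T)
      + B * Real.exp (-(c ^ 2 / 4) * T)) + B * Real.exp (-(1 - c) * T) * P := by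
    have h1 : L * (Real.exp (T / 2) / 2)
        ≤ L * ‖∑' n, (ArithmeticFunction.zeta n : ℂ) * gaussWeight T n‖ :=
      mul_le_mul_of_nonneg_left hzeta (norm_nonneg _)
    have h2 := norm_sub_norm_le
      (χ.LFunction 1 * ∑' n, (ArithmeticFunction.zeta n : ℂ) * gaussWeight T n)
      (∑' n, χ.zetaMul n * gaussWeight T n)
    rw [norm_sub_rev, norm_mul, ← hL] at h2
    rw [← hP] at hupper
    have h3 : Real.exp (T / 2 * (1 - θ) ^ 2) = Real.exp (T / 2) * Real.exp (-κ * T) := by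
      rw [← Real.exp_add, hκ]
      ring_nf
    rw [h3] at hlower
    refine le_of_mul_le_mul_left ?_ (Real.exp_pos (T / 2))
    rw [neg_mul (c ^ 2 / 4), neg_mul (1 - c)]
    linarith
  rw [hexp, hexp, hexp, mul_neg, mul_neg, mul_neg, hT] at hmain
  have hLP : L ≤ 4 * B * D ^ (-(a * (1 - c))) * P := by linarith
  rw [hP] at hLP
  have hfin := classTorsionNumber_le_of_norm_le hK hodd hDe hN (by positivity) hLP
  calc (classTorsionNumber K ℓ : ℝ)
      ≤ 6 * (4 * B * D ^ (-(a * (1 - c)))) * √D := hfin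
    _ = 6 * (4 * B) * D ^ (1 / 2 - a * (1 - c)) := by
        rw [Real.sqrt_eq_rpow, sub_eq_neg_add (1 / 2 : ℝ), Real.rpow_add hD0]
        ring
    _ ≤ 6 * (4 * B) * D ^ ((1 : ℝ) / 2 - 1 / (2 * (ℓ : ℝ)) + ε) := by
        refine mul_le_mul_of_nonneg_left (Real.rpow_le_rpow_of_exponent_le hD1 ?_) (by positivity)
        linarith
    _ ≤ _ := mul_le_mul_of_nonneg_right (le_max_left _ _) (by positivity)
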